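/- Let $\mathbb K$ be an algebraically closed field of any characteristic and let $f,g\in\mathbb K[[x,y]]$ be irreducible power series that are not associated (so that $fg$ is reduced). **Intersection multiplicity.** A parametrization of $f$ is a pair $(\varphi,\psi)\neq(0,0)$ of series in $t\,\mathbb K[[t]]$ with $f(\varphi(t),\psi(t))=0$. It is primitive if it is not of the form $(\varphi_1(\tau(t)),\psi_1(\tau(t)))$ with $\operatorname{ord}\tau>1$. Put $i(f,g)=\operatorname{ord}_t g(\varphi(t),\psi(t))$ for a primitive parametrization $(\varphi,\psi)$ of $f$. **Newton tree of a reduced series $h\in\mathbb K[[x,y]]$ with $h(0,0)=0$.** Let the compact edges of the Newton polygon of $h$, from top to bottom, be supported by the lines $p_iX+q_iY=N_i$ with $\gcd(p_i,q_i)=1$ $(1\le i\le k)$, and let $$P_i=c_i\,x^{n_i}y^{m_i}\prod_j (x^{q_i}-\mu_{i,j}y^{p_i})^{\nu_{i,j}},\qquad c_i\neq0,\ \mu_{i,j}\ne 0\text{ pairwise distinct for fixed }i,$$ be the face polynomials. Take vertices $v_1,\dots,v_k$ on a vertical line, where $v_i,v_{i+1}$ are joined by an edge, $v_1$ is joined to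 an upper arrowhead (the vertical non-compact face) and $v_k$ to a lower arrowhead (the horizontal non-compact face); if $k=0$ the two arrowheads are joined to each other. Near $v_i$ the edge going up is decorated by $q_i$ and the edge going down by $p_i$. For every $\mu_{i,j}$ with $\nu_{i,j}=1$ attach an arrowhead to $v_i$ by an edge without decoration (that is, decorated by $1$). For every $\mu_{i,j}$ with $\nu_{i,j}>1$ apply the Hamburger–Noether map $$x=(Y_1+\bar\mu)^{q'}X_1^{p_i},\qquad y=(Y_1+\bar\mu)^{p'}X_1^{q_i},$$ where $p',q'\ge0$, $p_ip'-q_iq'=\pm1$, are the exponents produced by the Euclidean algorithm for $(p_i,q_i)$, and $\bar\mu=\mu_{i,j}^{-1}$ if the sign is $+$ and $\bar\mu=\mu_{i,j}$ if it is $-$. The total transform of $h$ is $X_1^{N_i}(Y_1^{\nu_{i,j}}+\cdots)$ up to a unit. Construct in the same way the vertical line of its Newton polygon, with edge weights $(p'_l,q'_l)$, replace its upper arrowhead by an edge from its first vertex to $v_i$, undecorated near $v_i$, and replace each upper decoration $q'_l$ by $q'_l+p\,q\,p'_l$, where $p,q$ are the lower and the upper decoration of $v_i$ in the tree already constructed.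 Continue recursively; all factors $X_1^{N_i}$ are kept. An upper or lower arrowhead represents a branch $f$ if the strict transform of $f$ in the corresponding coordinates is, up to a unit, the corresponding coordinate ($x$ for the upper arrowhead, the second coordinate for a lower one). An arrowhead attached for a factor with $\nu_{i,j}=1$ represents $f$ if the strict transform of $f$ under the Hamburger–Noether map of $(p_i,q_i,\mu_{i,j})$ passes through the origin. For arrowheads $\alpha,\beta$ of the tree, let $\rho(\alpha,\beta)$ be the product, over all vertices $v$ on the path from $\alpha$ to $\beta$ and all edges $e$ at $v$ which do not lie on this path, of the decoration of $e$ near $v$. **Theorem.** The series $f$ has a primitive parametrization. In the Newton tree of $fg$ there is exactly one arrowhead $\alpha_f$ representing $f$ and exactly one arrowhead $\alpha_g$ representing $g$, they are joined by a path, and for every primitive parametrization of $f$ $$i(f,g)=\rho(\alpha_f,\alpha_g).$$ -/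

import Mathlib

noncomputable section

namespace NewtonTree

variable {K : Type*} [Field K]

/-! ### Newton polygons and face polynomials -/

/-- `d` is an exponent of `h` at which the linear form `(i, j) ↦ p * i + q * j` is minimal on the
support of `h`; thus `d` lies on the face of the Newton polygon of `h` supported by a line
`p * X + q * Y = N`.  The weights `(1, 0)` and `(0, 1)` give the vertical and the horizontal
non-compact faces. -/
def OnFace (h : MvPowerSeries (Fin 2) K) (p q : ℕ) (d : Fin 2 →₀ ℕ) : Prop :=
  MvPowerSeries.coeff d h ≠ 0 ∧
    ∀ e : Fin 2 →₀ ℕ, MvPowerSeries.coeff e h ≠ 0 → p * d 0 + q * d 1 ≤ p * e 0 + q * e 1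

/-- The Newton polygon of `h` has a compact edge supported by a line `p * X + q * Y = N`, where
`p, q ≥ 1` are coprime. -/
def IsEdge (h : MvPowerSeries (Fin 2) K) (p q : ℕ) : Prop :=
  0 < p ∧ 0 < q ∧ p.Coprime q ∧ ∃ d d', d ≠ d' ∧ OnFace h p q d ∧ OnFace h p q d'

/-- The faces of the Newton polygon of `h` with weights `(p, q)` and `(p', q')` intersect. -/
def Meets (h : MvPowerSeries (Fin 2) K) (p q p' q' : ℕ) : Prop :=
  ∃ d, OnFace h p q d ∧ OnFace h p' q' d

/-- The face polynomial of a compact edge: the sum of the terms of `h` on that edge. -/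
def facePoly (h : MvPowerSeries (Fin 2) K) (p q : ℕ) : MvPolynomial (Fin 2) K :=
  ∑ᶠ d ∈ {d | OnFace h p q d}, MvPolynomial.monomial d (MvPowerSeries.coeff d h)

/-- The exponent of `x ^ q - μ * y ^ p` in the factorisation of the face polynomial. -/
def faceMult (h : MvPowerSeries (Fin 2) K) (p q : ℕ) (μ : K) : ℕ∞ :=
  emultiplicity (MvPolynomial.X 0 ^ q - MvPolynomial.C μ * MvPolynomial.X 1 ^ p) (facePoly h p q)

/-! ### The Hamburger-Noether algorithm -/

/-- For coprime `p, q`, the pair `(q', p')` such that the Euclidean algorithm on `(p, q)`, applied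
as a sequence of monomial substitutions (`x = x₁ * y₁ ^ k, y = y₁` if `p ≥ q` and `k = p / q`, and
`x = x₁, y = x₁ ^ k * y₁` if `p < q` and `k = q / p`), gives
`x = X ^ p * Y ^ q'` and `y = X ^ q * Y ^ p'`. -/
def hnExp (p q : ℕ) : ℕ × ℕ :=
  if q = 0 then (0, 1)
  else if p = 0 then (1, 0)
  else if q ≤ p then
    ((hnExp (p % q) q).1 + p / q * (hnExp (p % q) q).2, (hnExp (p % q) q).2)
  else
    ((hnExp p (q % p)).1, (hnExp p (q % p)).2 + q / p * (hnExp p (q % p)).1)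
termination_by p + q
decreasing_by
  all_goals
    first
    | (have := Nat.mod_lt p (show q > 0 by omega); omega)
    | (have := Nat.mod_lt q (show p > 0 by omega); omega)

/-- The data of one Hamburger-Noether map: an edge `(p, q)` and the coefficient `μ` of a factor
`x ^ q - μ * y ^ p` of its face polynomial. -/
structure HNStep (K : Type*) where
  p : ℕ
  q : ℕ
  μ : K

open Classical in
/-- The point `Y = μ ^ (±1)` at which the strict transform of `x ^ q - μ * y ^ p` under
`x = X ^ p * Y ^ q'`, `y = X ^ q * Y ^ p'` meets `X = 0`. -/
def HNStep.center (s : HNStep K) : K :=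
  if s.p * (hnExp s.p s.q).2 = s.q * (hnExp s.p s.q).1 + 1 then s.μ⁻¹ else s.μ

/-- The Hamburger-Noether substitution
`x = (Y + c) ^ q' * X ^ p`, `y = (Y + c) ^ p' * X ^ q`, with `c = s.center`. -/
def HNStep.subst (s : HNStep K) : Fin 2 → MvPowerSeries (Fin 2) K :=
  ![(MvPowerSeries.X 1 + MvPowerSeries.C s.center) ^ (hnExp s.p s.q).1 *
      MvPowerSeries.X 0 ^ s.p,
    (MvPowerSeries.X 1 + MvPowerSeries.C s.center) ^ (hnExp s.p s.q).2 *
      MvPowerSeries.X 0 ^ s.q]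

/-- The total transform of `h` under a sequence of Hamburger-Noether maps; the head of the list is
the last map that is applied. -/
def transform (h : MvPowerSeries (Fin 2) K) : List (HNStep K) → MvPowerSeries (Fin 2) K
  | [] => h
  | s :: L => MvPowerSeries.subst s.subst (transform h L)

/-- The sequences of Hamburger-Noether maps that the Newton algorithm of `h` performs: the map of
`(p, q, μ)` is applied when `x ^ q - μ * y ^ p` has exponent at least `2` in the face polynomial. -/
inductive IsChart (h : MvPowerSeries (Fin 2) K) : List (HNStep K) → Prop
  | nil : IsChart h []
  | cons (s : HNStep K) (L : List (HNStep K)) : IsChart h L → IsEdge (transform h L) s.p s.q →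
      s.μ ≠ 0 → 2 ≤ faceMult (transform h L) s.p s.q s.μ → IsChart h (s :: L)

/-! ### The Newton tree -/

/-- Names for the vertices and arrowheads of a Newton tree. -/
inductive Node (K : Type*)
  /-- the vertex of the compact edge `(p, q)` of the Newton polygon after the maps in `L` -/
  | vertex (L : List (HNStep K)) (p q : ℕ)
  /-- the arrowhead attached to the vertex of the edge `(s.p, s.q)` for a factor
  `x ^ s.q - s.μ * y ^ s.p` of exponent one -/
  | arrow (L : List (HNStep K)) (s : HNStep K)
  /-- the arrowhead of the vertical non-compact face of the first Newton polygon -/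
  | top
  /-- the arrowhead of the horizontal non-compact face of the Newton polygon after the maps in
  `L` -/
  | bottom (L : List (HNStep K))

/-- The condition for the arrowhead `arrow L s` to belong to the Newton tree of `h`. -/
def IsArrow (h : MvPowerSeries (Fin 2) K) (L : List (HNStep K)) (s : HNStep K) : Prop :=
  IsChart h L ∧ IsEdge (transform h L) s.p s.q ∧ s.μ ≠ 0 ∧
    faceMult (transform h L) s.p s.q s.μ = 1

/-- The edges of the Newton tree of `h`, each one oriented downwards or to the right. -/
inductive TreeEdge (h : MvPowerSeries (Fin 2) K) : Node K → Node K → Prop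
  /-- the case where the first Newton polygon has no compact edge -/
  | topBottom : Meets h 1 0 0 1 → TreeEdge h .top (.bottom [])
  | topVertex (p q : ℕ) : IsEdge h p q → Meets h 1 0 p q → TreeEdge h .top (.vertex [] p q)
  | vertical (L : List (HNStep K)) (p q p' q' : ℕ) : IsChart h L →
      IsEdge (transform h L) p q → IsEdge (transform h L) p' q' → p' * q < p * q' →
      Meets (transform h L) p q p' q' → TreeEdge h (.vertex L p q) (.vertex L p' q')
  | vertexBottom (L : List (HNStep K)) (p q : ℕ) : IsChart h L → IsEdge (transform h L) p q →
      Meets (transform h L) p q 0 1 → TreeEdge h (.vertex L p q) (.bottom L)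
  | vertexArrow (L : List (HNStep K)) (s : HNStep K) : IsArrow h L s →
      TreeEdge h (.vertex L s.p s.q) (.arrow L s)
  /-- gluing: the vertical non-compact face of the new Newton polygon is replaced by an edge to the
  vertex from which the Hamburger-Noether map started -/
  | glue (L : List (HNStep K)) (s : HNStep K) (p q : ℕ) : IsChart h (s :: L) →
      IsEdge (transform h (s :: L)) p q → Meets (transform h (s :: L)) 1 0 p q →
      TreeEdge h (.vertex L s.p s.q) (.vertex (s :: L) p q)

/-- The Newton tree of `h` (names that do not occur in the tree are isolated points). -/
def newtonTree (h : MvPowerSeries (Fin 2) K) : SimpleGraph (Node K) :=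
  SimpleGraph.fromRel (TreeEdge h)

/-- The upper decoration of the vertex of the edge `(p, q)` after the maps in `L`: it is `q` in the
first Newton polygon, and gluing to a vertex with decorations `p₀` (below) and `q₀` (above) changes
`q` into `q + p₀ * q₀ * p`. -/
def upper : List (HNStep K) → ℕ → ℕ → ℕ
  | [], _, q => q
  | s :: L, p, q => q + s.p * upper L s.p s.q * p

/-- The decoration near `x` on an edge of the tree joining `x` to `y`.  Near a vertex, the edge
going up (or back to the vertex to which it was glued) is decorated by `upper L p q`, the edge going
down by `p`, and the edges going to the right (arrowheads, and vertices of a further Newton polygon)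
are undecorated, that is, decorated by `1`. -/
def decoration : Node K → Node K → ℕ
  | .vertex L p q, .vertex L' p' q' =>
      if L.length < L'.length then 1
      else if L.length = L'.length ∧ p' * q < p * q' then p
      else upper L p q
  | .vertex L p q, .top => upper L p q
  | .vertex _ p _, .bottom _ => p
  | .vertex _ _ _, .arrow _ _ => 1
  | _, _ => 1

open Classical in
/-- The product, over the inner vertices `x` of the walk `w` and the edges `e` of the tree at `x`
which are not on `w`, of the decoration on `e` near `x`. -/
def rho {h : MvPowerSeries (Fin 2) K} {α β : Node K} (w : (newtonTree h).Walk α β) : ℕ :=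
  ∏ x ∈ w.support.toFinset \ {α, β},
    ∏ᶠ y ∈ {y | (newtonTree h).Adj x y ∧ s(x, y) ∉ w.edges}, decoration x y

/-- The arrowhead `α` of the Newton tree of `h` represents the strict transform of the branch `f`
(a factor of `h`).  For an arrowhead of a non-compact face, the strict transform is that face's
coordinate axis; for an arrowhead attached to a factor of exponent one, it passes through the
corresponding point, that is, after removing the powers of the exceptional divisor `X = 0` from the
total transform of `f` a non-unit remains. -/
def Represents (h f : MvPowerSeries (Fin 2) K) : Node K → Prop
  | .top => Associated f (MvPowerSeries.X 0)
  | .bottom L => IsChart h L ∧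
      ∃ a : ℕ, Associated (transform f L) (MvPowerSeries.X 0 ^ a * MvPowerSeries.X 1)
  | .arrow L s => IsArrow h L s ∧
      ∃ (a : ℕ) (f' : MvPowerSeries (Fin 2) K), transform f (s :: L) = MvPowerSeries.X 0 ^ a * f' ∧
        ¬ MvPowerSeries.X 0 ∣ f' ∧ ¬ IsUnit f'
  | .vertex _ _ _ => False

/-! ### Intersection multiplicity -/

/-- The series `g(φ(t), ψ(t))`. -/
def evalAt (g : MvPowerSeries (Fin 2) K) (φ ψ : PowerSeries K) : PowerSeries K :=
  MvPowerSeries.subst ![φ, ψ] g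

/-- `t ↦ (φ(t), ψ(t))` is a primitive parametrization of the branch `f = 0`. -/
structure IsPrimitiveParametrization (f : MvPowerSeries (Fin 2) K) (φ ψ : PowerSeries K) :
    Prop where
  constantCoeff_fst : PowerSeries.constantCoeff φ = 0
  constantCoeff_snd : PowerSeries.constantCoeff ψ = 0
  ne_zero : φ ≠ 0 ∨ ψ ≠ 0
  eval_eq_zero : evalAt f φ ψ = 0
  /-- it is not obtained from another pair of series by a substitution of order greater than one -/
  primitive : ∀ φ₁ ψ₁ τ : PowerSeries K, PowerSeries.constantCoeff τ = 0 →
    φ = PowerSeries.subst τ φ₁ → ψ = PowerSeries.subst τ ψ₁ → τ.order = 1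

end NewtonTree

end

noncomputable section

namespace NewtonTree

variable {K : Type*} [Field K]

/-! ### Expansions in powers of an element -/

/-! The two branches are followed through the Hamburger–Noether maps until they separate, and the
decorations of the tree record exactly the numbers which this produces.

A branch F is handled through a primitive parametrization whose kernel of evaluation is the ideal
(F) (`IsBranch`). The basic tool is the symmetry of the intersection number: by
`IsBranch.length_quotient` it is the length of K[[x,y]]/(F,G). Testing F against the axes and the
monomial curves (c t^p, t^q), whose equations are binomials, then shows in every characteristic that
the Newton polygon of a branch parametrized with orders (kp, kq) is a segment and that its face
polynomial is c (x^q - μ y^p)^k (`IsBranch.exists_isInit`). Parametrizations exist because a finite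
extension domain of K[[x]] embeds in a discrete valuation ring with residue field K (`exists_dvr`,
`exists_param`, `exists_primitive`).

Under the map of its own tangent such a branch has a strict transform which is again a branch and
meets the exceptional divisor with multiplicity k (`EdgeAt.exists_branch`); under any other map it
becomes a unit times a power of the divisor (`IsOut`). The exponent of the divisor in the total
transform is e_L · ord X, where e_{s::L} = p (q + e_L p). The factor q + e_L p is the upper
decoration (`upper_eq`, `Lift.cons`), and i(f,g) = e_L · ord X · ord X' + ord G(X,Y) holds for the
strict transforms at every common point (`Lift.order_evalAt_eq`).

At the last common point this formula is evaluated in five configurations: two different edges, two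
binomials on one edge, an edge and either coordinate axis, or both axes
(`BranchPair.hasPath_of_above`, `BranchPair.hasPath_of_same`, `BranchPair.hasPath_of_bottom`,
`BranchPair.hasPath_of_top`, `BranchPair.hasPath_top_bottom`). The result is the product of the
decorations beside the path there, times the multiplicities k and l of the branches with edges.
Beyond that point each branch is alone: every later polygon has one edge (p', q') with k = p' k', so
the path collects the lower decorations p' until the multiplicity is 1, which is where an arrowhead
of exponent one is attached (`BranchPair.descent`). The process stops because a primitive
parametrization takes two values whose orders differ by 1 (`exists_length_bound`).

The points followed by a branch form a chain (`Lift.suffix_or`), so only one arrowhead represents it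
(`represents_unique`). A node has at most one parent, so the tree has no cycle
(`newtonTree_isAcyclic`) and the path is unique. -/

/-- If every element of `T` is a digit plus `π` times an element of `T`, then, in a `π`-adically
separated ring, every element of `T` is the value of a sequence of digits. -/
theorem exists_eq_digits {S G : Type*} [CommRing S] (π : S)
    (hπ : ∀ s : S, (∀ n : ℕ, π ^ n ∣ s) → s = 0) (ev : G → S) (EV : (ℕ → G) → S)
    (hEV : ∀ u, EV u = ev (u 0) + π * EV (fun n => u (n + 1))) (T : Set S)
    (step : ∀ m ∈ T, ∃ g, ∃ m' ∈ T, m = ev g + π * m') (m : S) (hm : m ∈ T) :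
    ∃ u, m = EV u := by
  choose! g f hf hgf using step
  have hit : ∀ n, f^[n] m ∈ T := fun n => by
    induction n with
    | zero => exact hm
    | succ n ih => rw [Function.iterate_succ_apply']; exact hf _ ih
  let u : ℕ → ℕ → G := fun k n => g (f^[k + n] m) (hit _)
  -- Each error is π times the next one, so the difference between m and the value of its digits is
  -- divisible by all powers of π.
  have key : ∀ k, f^[k] m - EV (u k) = π * (f^[k + 1] m - EV (u (k + 1))) := fun k => by
    have h1 := hgf _ (hit k)
    have h2 := hEV (u k)
    have h3 : (fun n => u k (n + 1)) = u (k + 1) := by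
      funext n; simp only [u, add_right_comm k 1 n]; rfl
    rw [h3] at h2
    have h4 : u k 0 = g (f^[k] m) (hit k) := rfl
    rw [h4] at h2
    rw [Function.iterate_succ_apply']
    rw [h2]; nth_rewrite 1 [h1]; ring
  have key2 : ∀ k, m - EV (u 0) = π ^ k * (f^[k] m - EV (u k)) := fun k => by
    induction k with
    | zero => simp
    | succ k ih => rw [ih, key k]; ring
  exact ⟨u 0, sub_eq_zero.1 (hπ _ fun n => ⟨_, key2 n⟩)⟩

theorem powerSeries_mk_eq {R : Type*} [CommRing R] (a : ℕ → R) : PowerSeries.mk a =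
    PowerSeries.C (a 0) + PowerSeries.X * PowerSeries.mk fun n => a (n + 1) := by
  ext n
  cases n <;> simp [PowerSeries.coeff_succ_X_mul]

/-- Expansion with coefficients in the image of a ring of power series. -/
theorem exists_eq_sum_of_step {S ι : Type*} [CommRing S] [Fintype ι]
    (θ : PowerSeries K →+* S)
    (hπ : ∀ s : S, (∀ n : ℕ, θ PowerSeries.X ^ n ∣ s) → s = 0) (v : ι → S) (T : Set S)
    (step : ∀ m ∈ T, ∃ κ : ι → K, ∃ m' ∈ T,
      m = ∑ i, θ (PowerSeries.C (κ i)) * v i + θ PowerSeries.X * m') (m : S) (hm : m ∈ T) :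
    ∃ U : ι → PowerSeries K, m = ∑ i, θ (U i) * v i := by
  obtain ⟨u, hu⟩ := exists_eq_digits (θ PowerSeries.X) hπ
    (fun κ : ι → K => ∑ i, θ (PowerSeries.C (κ i)) * v i)
    (fun u => ∑ i, θ (PowerSeries.mk fun n => u n i) * v i)
    (fun u => by
      rw [Finset.mul_sum, ← Finset.sum_add_distrib]
      refine Finset.sum_congr rfl fun i _ => ?_
      rw [powerSeries_mk_eq]
      simp only [map_add, map_mul]; ring) T step m hm
  exact ⟨_, hu⟩

/-! ### Exponents and substitutions in two variables -/

/-- The exponent `(i, j)`. -/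
def expo (i j : ℕ) : Fin 2 →₀ ℕ := Finsupp.single 0 i + Finsupp.single 1 j

@[simp] theorem expo_zero (i j : ℕ) : expo i j 0 = i := by simp [expo]
@[simp] theorem expo_one (i j : ℕ) : expo i j 1 = j := by simp [expo]

theorem expo_ext {d e : Fin 2 →₀ ℕ} (h0 : d 0 = e 0) (h1 : d 1 = e 1) : d = e := by
  ext i; fin_cases i <;> simp_all

theorem eq_expo (d : Fin 2 →₀ ℕ) : d = expo (d 0) (d 1) := expo_ext (by simp) (by simp)

variable {τ : Type*}

theorem hasSubst_pair {a b : MvPowerSeries τ K} (ha : MvPowerSeries.constantCoeff a = 0)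
    (hb : MvPowerSeries.constantCoeff b = 0) : MvPowerSeries.HasSubst ![a, b] :=
  MvPowerSeries.hasSubst_of_constantCoeff_zero fun i => by fin_cases i <;> simp [ha, hb]

theorem coeff_subst_pair {a b : MvPowerSeries τ K} (ha : MvPowerSeries.constantCoeff a = 0)
    (hb : MvPowerSeries.constantCoeff b = 0) (f : MvPowerSeries (Fin 2) K) (e : τ →₀ ℕ) :
    MvPowerSeries.coeff e (MvPowerSeries.subst ![a, b] f) =
      ∑ᶠ d : Fin 2 →₀ ℕ, MvPowerSeries.coeff d f * MvPowerSeries.coeff e (a ^ d 0 * b ^ d 1) := by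
  rw [MvPowerSeries.coeff_subst (hasSubst_pair ha hb)]
  refine finsum_congr fun d => ?_
  rw [Finsupp.prod_fintype _ _ (by simp), Fin.prod_univ_two]
  simp

theorem subst_pair_coe (a b : MvPowerSeries τ K) (P : MvPolynomial (Fin 2) K) :
    MvPowerSeries.subst ![a, b] (P : MvPowerSeries (Fin 2) K) = MvPolynomial.aeval ![a, b] P :=
  MvPowerSeries.subst_coe P

/-- Substitution as a homomorphism of algebras. -/
def evHom (φ ψ : PowerSeries K) (hφ : PowerSeries.constantCoeff φ = 0)
    (hψ : PowerSeries.constantCoeff ψ = 0) : MvPowerSeries (Fin 2) K →ₐ[K] PowerSeries K :=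
  MvPowerSeries.substAlgHom (hasSubst_pair (a := φ) (b := ψ) hφ hψ)

theorem evHom_apply {φ ψ : PowerSeries K} (hφ : PowerSeries.constantCoeff φ = 0)
    (hψ : PowerSeries.constantCoeff ψ = 0) (g : MvPowerSeries (Fin 2) K) :
    evHom φ ψ hφ hψ g = evalAt g φ ψ := by
  rw [evHom, MvPowerSeries.substAlgHom_apply]; rfl

section evalAt
variable {φ ψ : PowerSeries K} (hφ : PowerSeries.constantCoeff φ = 0)
    (hψ : PowerSeries.constantCoeff ψ = 0)

theorem evalAt_C (c : K) : evalAt (MvPowerSeries.C c) φ ψ = PowerSeries.C c :=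
  MvPowerSeries.subst_C c

include hφ hψ

theorem evalAt_mul (f g : MvPowerSeries (Fin 2) K) :
    evalAt (f * g) φ ψ = evalAt f φ ψ * evalAt g φ ψ := by
  simp only [← evHom_apply hφ hψ, map_mul]

theorem evalAt_add (f g : MvPowerSeries (Fin 2) K) :
    evalAt (f + g) φ ψ = evalAt f φ ψ + evalAt g φ ψ := by
  simp only [← evHom_apply hφ hψ, map_add]

theorem evalAt_sub (f g : MvPowerSeries (Fin 2) K) :
    evalAt (f - g) φ ψ = evalAt f φ ψ - evalAt g φ ψ := by
  simp only [← evHom_apply hφ hψ, map_sub]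

theorem evalAt_pow (f : MvPowerSeries (Fin 2) K) (n : ℕ) :
    evalAt (f ^ n) φ ψ = evalAt f φ ψ ^ n := by
  simp only [← evHom_apply hφ hψ, map_pow]

theorem evalAt_zero : evalAt 0 φ ψ = 0 := by
  simp only [← evHom_apply hφ hψ, map_zero]

theorem evalAt_X0 : evalAt (MvPowerSeries.X 0) φ ψ = φ := by
  rw [evalAt, MvPowerSeries.subst_X (hasSubst_pair (a := φ) (b := ψ) hφ hψ)]; rfl

theorem evalAt_X1 : evalAt (MvPowerSeries.X 1) φ ψ = ψ := by
  rw [evalAt, MvPowerSeries.subst_X (hasSubst_pair (a := φ) (b := ψ) hφ hψ)]; rfl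

theorem evalAt_dvd {f g : MvPowerSeries (Fin 2) K} (h : f ∣ g) :
    evalAt f φ ψ ∣ evalAt g φ ψ := by
  obtain ⟨c, rfl⟩ := h
  exact ⟨_, evalAt_mul hφ hψ f c⟩

theorem evalAt_isUnit {f : MvPowerSeries (Fin 2) K} (h : IsUnit f) : IsUnit (evalAt f φ ψ) := by
  rw [← evHom_apply hφ hψ]; exact h.map _

end evalAt

theorem constantCoeff_subst_pair {a b : MvPowerSeries τ K}
    (ha : MvPowerSeries.constantCoeff a = 0)
    (hb : MvPowerSeries.constantCoeff b = 0) (f : MvPowerSeries (Fin 2) K) :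
    MvPowerSeries.constantCoeff (MvPowerSeries.subst ![a, b] f) =
      MvPowerSeries.constantCoeff f := by
  rw [← MvPowerSeries.coeff_zero_eq_constantCoeff_apply, coeff_subst_pair ha hb,
    finsum_eq_single _ 0]
  · simp
  · intro d hd
    have : d 0 ≠ 0 ∨ d 1 ≠ 0 := by
      by_contra! h
      exact hd (expo_ext (by simpa using h.1) (by simpa using h.2))
    rcases this with h | h <;> simp [ha, hb, h]

/-- The restriction of a series to the axis `x = 0`. -/
theorem coeff_evalAt_zero_X (g : MvPowerSeries (Fin 2) K) (n : ℕ) :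
    PowerSeries.coeff n (evalAt g 0 PowerSeries.X) = MvPowerSeries.coeff (expo 0 n) g := by
  have := coeff_subst_pair (τ := Unit) (a := (0 : PowerSeries K)) (b := PowerSeries.X)
    (map_zero _) PowerSeries.constantCoeff_X g (Finsupp.single () n)
  rw [PowerSeries.coeff, evalAt, this, finsum_eq_single _ (expo 0 n)]
  · simp only [expo_zero, expo_one, pow_zero, one_mul]
    rw [← PowerSeries.coeff, PowerSeries.coeff_X_pow_self, mul_one]
  · intro d hd
    by_cases h0 : d 0 = 0
    · have h1 : d 1 ≠ n := fun h => hd (expo_ext (by simpa using h0) (by simpa using h))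
      rw [h0, pow_zero, one_mul, ← PowerSeries.coeff, PowerSeries.coeff_X_pow, if_neg h1.symm,
        mul_zero]
    · rw [zero_pow h0, zero_mul, map_zero, mul_zero]

/-- The restriction of a series to the axis `y = 0`. -/
theorem coeff_evalAt_X_zero (g : MvPowerSeries (Fin 2) K) (n : ℕ) :
    PowerSeries.coeff n (evalAt g PowerSeries.X 0) = MvPowerSeries.coeff (expo n 0) g := by
  have := coeff_subst_pair (τ := Unit) (a := (PowerSeries.X : PowerSeries K)) (b := 0)
    PowerSeries.constantCoeff_X (map_zero _) g (Finsupp.single () n)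
  rw [PowerSeries.coeff, evalAt, this, finsum_eq_single _ (expo n 0)]
  · simp only [expo_zero, expo_one, pow_zero, mul_one]
    rw [← PowerSeries.coeff, PowerSeries.coeff_X_pow_self, mul_one]
  · intro d hd
    by_cases h0 : d 1 = 0
    · have h1 : d 0 ≠ n := fun h => hd (expo_ext (by simpa using h) (by simpa using h0))
      rw [h0, pow_zero, mul_one, ← PowerSeries.coeff, PowerSeries.coeff_X_pow, if_neg h1.symm,
        mul_zero]
    · rw [zero_pow h0, mul_zero, map_zero, mul_zero]

/-- Turns divisibility by x into vanishing in the domain K[[y]]; the primality of x is read off from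
this form. -/
theorem X0_dvd_iff {g : MvPowerSeries (Fin 2) K} :
    MvPowerSeries.X 0 ∣ g ↔ evalAt g 0 PowerSeries.X = 0 := by
  rw [MvPowerSeries.X_dvd_iff]
  constructor
  · intro h; ext n
    rw [coeff_evalAt_zero_X, h _ (by simp), map_zero]
  · intro h d hd
    rw [eq_expo d, hd, ← coeff_evalAt_zero_X, h, map_zero]

theorem X1_dvd_iff {g : MvPowerSeries (Fin 2) K} :
    MvPowerSeries.X 1 ∣ g ↔ evalAt g PowerSeries.X 0 = 0 := by
  rw [MvPowerSeries.X_dvd_iff]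
  constructor
  · intro h; ext n
    rw [coeff_evalAt_X_zero, h _ (by simp), map_zero]
  · intro h d hd
    rw [eq_expo d, hd, ← coeff_evalAt_X_zero, h, map_zero]

/-! ### Series in x with coefficients in K[[y]], and Weierstrass division -/

/-- A series in two variables given by its sequence of coefficients with respect to `x`. -/
def ofSeq (a : ℕ → PowerSeries K) : MvPowerSeries (Fin 2) K :=
  fun d => PowerSeries.coeff (d 1) (a (d 0))

theorem coeff_ofSeq (a : ℕ → PowerSeries K) (d : Fin 2 →₀ ℕ) :
    MvPowerSeries.coeff d (ofSeq a) = PowerSeries.coeff (d 1) (a (d 0)) := rfl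

/-- A series in `y`, as a series in `x` and `y`. -/
def ofY (b : PowerSeries K) : MvPowerSeries (Fin 2) K := ofSeq (Pi.single 0 b)

theorem ofSeq_eq (a : ℕ → PowerSeries K) :
    ofSeq a = ofY (a 0) + MvPowerSeries.X 0 * ofSeq fun n => a (n + 1) := by
  ext d
  rw [map_add, eq_expo d]
  rcases h : d 0 with _ | i
  · rw [coeff_ofSeq, ofY, coeff_ofSeq]
    have := (MvPowerSeries.X_dvd_iff (s := (0 : Fin 2))
      (φ := MvPowerSeries.X 0 * ofSeq fun n => a (n + 1))).1 (dvd_mul_right _ _)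
      (expo 0 (d 1)) (by simp)
    rw [this]; simp
  · have h2 : expo (i + 1) (d 1) = Finsupp.single 0 1 + expo i (d 1) :=
      expo_ext (by simp [add_comm]) (by simp)
    rw [coeff_ofSeq, ofY, coeff_ofSeq]
    rw [h2, MvPowerSeries.X_def, MvPowerSeries.coeff_add_monomial_mul, coeff_ofSeq]
    simp [add_comm 1 i]

theorem evalAt_ofY (b : PowerSeries K) : evalAt (ofY b) 0 PowerSeries.X = b := by
  ext n
  rw [coeff_evalAt_zero_X, ofY, coeff_ofSeq]; simp

theorem X0_pow_separated (s : MvPowerSeries (Fin 2) K)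
    (h : ∀ n : ℕ, MvPowerSeries.X 0 ^ n ∣ s) : s = 0 := by
  ext d
  have := MvPowerSeries.X_pow_dvd_iff.1 (h (d 0 + 1)) d (by omega)
  rw [this, map_zero]

/-- Weierstrass division by a series `h` such that `h (0, y)` has order `d`. -/
theorem exists_weierstrass_div {h : MvPowerSeries (Fin 2) K} {d : ℕ}
    (hd : (evalAt h 0 PowerSeries.X).order = d) (g : MvPowerSeries (Fin 2) K) :
    ∃ q r : MvPowerSeries (Fin 2) K, g = q * h + r ∧
      ∀ e : Fin 2 →₀ ℕ, d ≤ e 1 → MvPowerSeries.coeff e r = 0 := by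
  have hz : PowerSeries.constantCoeff (0 : PowerSeries K) = 0 := map_zero _
  have hX : PowerSeries.constantCoeff (PowerSeries.X : PowerSeries K) = 0 :=
    PowerSeries.constantCoeff_X
  obtain ⟨u, hu⟩ := exists_eq_digits
    -- A digit is a remainder of degree below d in y together with a coefficient of the quotient, so
    -- one expansion in powers of x yields remainder and quotient at once.
    (G := {r : PowerSeries K // ∀ n, d ≤ n → PowerSeries.coeff n r = 0} × PowerSeries K)
    (MvPowerSeries.X 0 : MvPowerSeries (Fin 2) K) X0_pow_separated
    (fun x => ofY x.1.1 + ofY x.2 * h)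
    (fun u => ofSeq (fun n => (u n).1.1) + ofSeq (fun n => (u n).2) * h)
    (fun u => by
      rw [ofSeq_eq (fun n => (u n).1.1), ofSeq_eq (fun n => (u n).2)]; ring) Set.univ
    (fun m _ => by
      set m0 := evalAt m 0 PowerSeries.X with hm0
      set h0 := evalAt h 0 PowerSeries.X with hh0
      have hh0ne : h0 ≠ 0 := by
        intro h; rw [h, PowerSeries.order_zero] at hd; exact absurd hd (by simp)
      -- Being a unit times y^d, h0 divides every series of order at least d, in particular the tail
      -- of m0.
      obtain ⟨c, hc⟩ : h0 ∣ m0 - (PowerSeries.trunc d m0 : PowerSeries K) := by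
        have h1 : h0 ∣ PowerSeries.X ^ d := by
          have h2 := PowerSeries.X_pow_order_mul_divXPowOrder (f := h0)
          have h3 : IsUnit (PowerSeries.divXPowOrder h0) := by
            rw [PowerSeries.isUnit_iff_constantCoeff, isUnit_iff_ne_zero, Ne,
              PowerSeries.constantCoeff_divXPowOrder_eq_zero_iff]
            exact hh0ne
          rw [hd, ENat.toNat_natCast] at h2
          rw [← h2]
          exact (h3.mul_right_dvd).2 dvd_rfl
        refine h1.trans ?_
        rw [PowerSeries.X_pow_dvd_iff]
        intro i hi
        simp [PowerSeries.coeff_trunc, hi]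
      obtain ⟨m', hm'⟩ : MvPowerSeries.X 0 ∣
          m - (ofY (PowerSeries.trunc d m0 : PowerSeries K) + ofY c * h) := by
        rw [X0_dvd_iff, evalAt_sub hz hX, evalAt_add hz hX, evalAt_mul hz hX, evalAt_ofY,
          evalAt_ofY, ← hm0, ← hh0, mul_comm c, ← hc]
        ring
      refine ⟨⟨⟨(PowerSeries.trunc d m0 : PowerSeries K), fun n hn => ?_⟩, c⟩, m', trivial, ?_⟩
      · rw [Polynomial.coeff_coe, PowerSeries.coeff_trunc, if_neg (by omega)]
      · rw [← hm']; ring) g trivial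
  refine ⟨_, _, by rw [hu, add_comm], fun e he => ?_⟩
  rw [coeff_ofSeq]
  exact (u (e 0)).1.2 _ he

end NewtonTree

end

noncomputable section

namespace NewtonTree

variable {K : Type*} [Field K]

/-! ### Orders of power series -/

theorem dvd_of_order_le {a b : PowerSeries K} (ha : a ≠ 0) (h : a.order ≤ b.order) : a ∣ b := by
  have h2 := PowerSeries.X_pow_order_mul_divXPowOrder (f := a)
  have h3 : IsUnit (PowerSeries.divXPowOrder a) := by
    rw [PowerSeries.isUnit_iff_constantCoeff, isUnit_iff_ne_zero, Ne,
      PowerSeries.constantCoeff_divXPowOrder_eq_zero_iff]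
    exact ha
  rw [← h2, h3.mul_right_dvd, PowerSeries.X_pow_dvd_iff]
  intro i hi
  refine PowerSeries.coeff_of_lt_order _ (lt_of_lt_of_le ?_ h)
  rw [← PowerSeries.coe_toNat_order ha]
  exact_mod_cast hi

theorem le_order_of_X_pow_dvd {n : ℕ} {a : PowerSeries K} (h : PowerSeries.X ^ n ∣ a) :
    (n : ℕ∞) ≤ a.order :=
  PowerSeries.nat_le_order _ _ (PowerSeries.X_pow_dvd_iff.1 h)

theorem X_pow_dvd_of_le_order {n : ℕ} {a : PowerSeries K} (h : (n : ℕ∞) ≤ a.order) :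
    PowerSeries.X ^ n ∣ a :=
  PowerSeries.X_pow_dvd_iff.2 fun i hi =>
    PowerSeries.coeff_of_lt_order _ (lt_of_lt_of_le (by exact_mod_cast hi) h)

theorem order_mono_of_dvd {a b : PowerSeries K} (h : a ∣ b) : a.order ≤ b.order := by
  obtain ⟨c, rfl⟩ := h
  rw [PowerSeries.order_mul]; exact le_self_add

theorem pow_separated {t : PowerSeries K} (ht : PowerSeries.constantCoeff t = 0)
    (s : PowerSeries K) (h : ∀ n : ℕ, t ^ n ∣ s) : s = 0 := by
  ext i
  have h1 : PowerSeries.X ^ (i + 1) ∣ s :=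
    (pow_dvd_pow_of_dvd (PowerSeries.X_dvd_iff.2 ht) _).trans (h _)
  simpa using PowerSeries.X_pow_dvd_iff.1 h1 i (by omega)

/-! ### Orders of the values taken on a primitive parametrization -/

/-- Substitution of a series without constant term. -/
def substHom (t : PowerSeries K) (ht : PowerSeries.constantCoeff t = 0) :
    PowerSeries K →ₐ[K] PowerSeries K :=
  PowerSeries.substAlgHom (PowerSeries.HasSubst.of_constantCoeff_zero' ht)

theorem substHom_apply {t : PowerSeries K} (ht : PowerSeries.constantCoeff t = 0)
    (a : PowerSeries K) : substHom t ht a = PowerSeries.subst t a := by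
  rw [substHom, PowerSeries.coe_substAlgHom]

theorem substHom_X {t : PowerSeries K} (ht : PowerSeries.constantCoeff t = 0) :
    substHom t ht PowerSeries.X = t := by
  rw [substHom_apply, PowerSeries.subst_X (PowerSeries.HasSubst.of_constantCoeff_zero' ht)]

theorem substHom_C {t : PowerSeries K} (ht : PowerSeries.constantCoeff t = 0) (c : K) :
    substHom t ht (PowerSeries.C c) = PowerSeries.C c := by
  rw [substHom_apply, PowerSeries.subst_C]; rfl

theorem constantCoeff_evalAt {φ ψ : PowerSeries K} (hφ : PowerSeries.constantCoeff φ = 0)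
    (hψ : PowerSeries.constantCoeff ψ = 0) (g : MvPowerSeries (Fin 2) K) :
    PowerSeries.constantCoeff (evalAt g φ ψ) = MvPowerSeries.constantCoeff g :=
  constantCoeff_subst_pair (τ := Unit) hφ hψ g

/-- Every quotient of values on a primitive parametrization has valuation a combination of
valuations; some quotient has valuation one. -/
theorem IsPrimitiveParametrization.exists_order_eq_add_one {F : MvPowerSeries (Fin 2) K}
    {φ ψ : PowerSeries K} (hp : IsPrimitiveParametrization F φ ψ) :
    ∃ a b : MvPowerSeries (Fin 2) K, evalAt b φ ψ ≠ 0 ∧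
      (evalAt a φ ψ).order = (evalAt b φ ψ).order + 1 := by
  classical
  have hφ := hp.constantCoeff_fst
  have hψ := hp.constantCoeff_snd
  let e := evHom φ ψ hφ hψ
  suffices H : ∃ a b, e b ≠ 0 ∧ (e a).order = (e b).order + 1 by
    simpa only [e, evHom_apply] using H
  -- The minimal n is the smallest positive difference between the orders of two values. Such
  -- differences exist: compare a nonzero coordinate with the value 1.
  have hex : ∃ n : ℕ, 0 < n ∧ ∃ a b, e b ≠ 0 ∧ (e a).order = (e b).order + n := by
    have key : ∀ a : MvPowerSeries (Fin 2) K, e a ≠ 0 → PowerSeries.constantCoeff (e a) = 0 →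
        ∃ n : ℕ, 0 < n ∧ ∃ a b, e b ≠ 0 ∧ (e a).order = (e b).order + n := fun a h0 h1 => by
      refine ⟨(e a).order.toNat, ?_, a, 1, by simp, ?_⟩
      · rw [Nat.pos_iff_ne_zero]
        intro h
        have h2 := PowerSeries.coeff_order h0
        rw [h, PowerSeries.coeff_zero_eq_constantCoeff_apply] at h2
        exact h2 h1
      · rw [map_one, PowerSeries.order_one, zero_add, PowerSeries.coe_toNat_order h0]
    rcases hp.ne_zero with h | h
    · refine key (MvPowerSeries.X 0) ?_ ?_ <;> rw [evHom_apply, evalAt_X0 hφ hψ] <;> assumption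
    · refine key (MvPowerSeries.X 1) ?_ ?_ <;> rw [evHom_apply, evalAt_X1 hφ hψ] <;> assumption
  set n := Nat.find hex
  obtain ⟨hn, a, b, hb, hab⟩ := Nat.find_spec hex
  have hmin : ∀ o : ℕ, 0 < o → ∀ a b, e b ≠ 0 → (e a).order = (e b).order + o → n ≤ o :=
    fun o ho a b h1 h2 => Nat.find_min' hex ⟨ho, a, b, h1, h2⟩
  obtain ⟨t, ht⟩ : e b ∣ e a := dvd_of_order_le hb (by rw [hab]; exact le_self_add)
  have hbfin : (e b).order ≠ ⊤ := by rwa [Ne, PowerSeries.order_eq_top]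
  have htn : t.order = n := by
    rw [ht, PowerSeries.order_mul] at hab
    exact ENat.add_right_injective_of_ne_top hbfin hab
  have ht0 : t ≠ 0 := by
    rintro rfl; rw [PowerSeries.order_zero] at htn; exact absurd htn (by simp)
  have htc : PowerSeries.constantCoeff t = 0 := by
    rw [← PowerSeries.order_ne_zero_iff_constCoeff_eq_zero, htn]
    exact_mod_cast hn.ne'
  have ha : e a ≠ 0 := by rw [ht]; exact mul_ne_zero hb ht0
  -- T consists of the quotients of values which are power series. An element of T minus its
  -- constant term is zero or has order at least n, by minimality; so it is divisible by t, and the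
  -- quotient is again in T. Hence T consists of series in t.
  let T : Set (PowerSeries K) := {m | ∃ A B, e B ≠ 0 ∧ m * e B = e A}
  have hstep : ∀ m ∈ T, ∃ κ : Unit → K, ∃ m' ∈ T,
      m = ∑ i, substHom t htc (PowerSeries.C (κ i)) * (fun _ => 1 : Unit → PowerSeries K) i +
        substHom t htc PowerSeries.X * m' := by
    rintro m ⟨A, B, hB, hm⟩
    set κ := PowerSeries.constantCoeff m
    have hC : e (MvPowerSeries.C κ) = PowerSeries.C κ := by rw [evHom_apply, evalAt_C]
    by_cases h0 : m - PowerSeries.C κ = 0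
    · refine ⟨fun _ => κ, 0, ⟨0, 1, by simp, by simp⟩, ?_⟩
      simp only [substHom_C]; simpa using sub_eq_zero.1 h0
    · have h1 : e (A - MvPowerSeries.C κ * B) = e B * (m - PowerSeries.C κ) := by
        rw [map_sub, map_mul, ← hm, hC]; ring
      have h2 : n ≤ (m - PowerSeries.C κ).order.toNat := by
        refine hmin _ ?_ (A - MvPowerSeries.C κ * B) B hB ?_
        · rw [Nat.pos_iff_ne_zero]
          intro h
          have h2 := PowerSeries.coeff_order h0
          rw [h, PowerSeries.coeff_zero_eq_constantCoeff_apply] at h2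
          exact h2 (by simp [κ])
        · rw [h1, PowerSeries.order_mul, PowerSeries.coe_toNat_order h0]
      obtain ⟨m', hm'⟩ : t ∣ m - PowerSeries.C κ := by
        refine dvd_of_order_le ht0 ?_
        rw [htn, ← PowerSeries.coe_toNat_order h0]
        exact_mod_cast h2
      refine ⟨fun _ => κ, m', ⟨(A - MvPowerSeries.C κ * B) * b, B * a, ?_, ?_⟩, ?_⟩
      · rw [map_mul]; exact mul_ne_zero hB ha
      · rw [map_mul, map_mul, h1, hm', ht]; ring
      · simp only [substHom_C, substHom_X, Finset.univ_unique, Finset.sum_singleton, mul_one]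
        rw [← hm']; ring
  have hmem : ∀ r : MvPowerSeries (Fin 2) K, ∃ ρ : PowerSeries K,
      e r = PowerSeries.subst t ρ := fun r => by
    obtain ⟨U, hU⟩ := exists_eq_sum_of_step (substHom t htc : PowerSeries K →+* PowerSeries K)
      (by
        intro s hs
        refine pow_separated htc s fun n => ?_
        simpa [substHom_X] using hs n) (fun _ => 1) T hstep (e r)
      ⟨r, 1, by simp, by simp⟩
    refine ⟨U (), ?_⟩
    rw [hU]
    simp [substHom_apply]
  obtain ⟨φ₁, h1⟩ := hmem (MvPowerSeries.X 0)
  obtain ⟨ψ₁, h2⟩ := hmem (MvPowerSeries.X 1)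
  rw [evHom_apply, evalAt_X0 hφ hψ] at h1
  rw [evHom_apply, evalAt_X1 hφ hψ] at h2
  -- Both coordinates are series in t, so primitivity gives t order 1.
  have := hp.primitive φ₁ ψ₁ t htc h1 h2
  refine ⟨a, b, hb, ?_⟩
  rw [ht, PowerSeries.order_mul, this]

/-- Elimination of leading terms: since the `v i` have the consecutive orders c, c+1, …, the
coefficients of s in these degrees can be killed one after the other. -/
theorem exists_sub_sum_order {c : ℕ} (v : ℕ → PowerSeries K) (j : ℕ)
    (hv : ∀ i < j, (v i).order = (c + i : ℕ)) (s : PowerSeries K)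
    (hs : (c : ℕ∞) ≤ s.order) : ∃ κ : ℕ → K,
      ((c + j : ℕ) : ℕ∞) ≤ (s - ∑ i ∈ Finset.range j, PowerSeries.C (κ i) * v i).order := by
  classical
  induction j with
  | zero => exact ⟨0, by simpa using hs⟩
  | succ j ih =>
    obtain ⟨κ, hκ⟩ := ih fun i hi => hv i (by omega)
    set r := s - ∑ i ∈ Finset.range j, PowerSeries.C (κ i) * v i with hr
    have hvj := hv j (by omega)
    have hvc : PowerSeries.coeff (c + j) (v j) ≠ 0 := (PowerSeries.order_eq_nat.1 hvj).1
    refine ⟨Function.update κ j (PowerSeries.coeff (c + j) r / PowerSeries.coeff (c + j) (v j)), ?_⟩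
    have h1 : s - ∑ i ∈ Finset.range (j + 1), PowerSeries.C (Function.update κ j
        (PowerSeries.coeff (c + j) r / PowerSeries.coeff (c + j) (v j)) i) * v i =
        r - PowerSeries.C (PowerSeries.coeff (c + j) r / PowerSeries.coeff (c + j) (v j)) * v j := by
      rw [Finset.sum_range_succ, hr, ← sub_sub]
      congr 1
      · congr 1
        refine Finset.sum_congr rfl fun i hi => ?_
        rw [Function.update_of_ne (by simp at hi; omega)]
      · rw [Function.update_self]
    rw [h1]
    refine PowerSeries.nat_le_order _ _ fun i hi => ?_
    rw [map_sub, PowerSeries.coeff_C_mul]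
    rcases (show i < c + j ∨ i = c + j by omega) with h | h
    · rw [PowerSeries.coeff_of_lt_order i (lt_of_lt_of_le (by exact_mod_cast h) hκ),
        PowerSeries.coeff_of_lt_order (φ := v j) i (by rw [hvj]; exact_mod_cast h)]
      simp
    · rw [h, div_mul_cancel₀ _ hvc, sub_self]

/-- Series in a value are values, because substitutions compose; this keeps the expansions in powers
of a value inside the ring of values. -/
theorem subst_evalAt {φ ψ : PowerSeries K} (hφ : PowerSeries.constantCoeff φ = 0)
    (hψ : PowerSeries.constantCoeff ψ = 0) {B : MvPowerSeries (Fin 2) K}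
    (hB : MvPowerSeries.constantCoeff B = 0) (U : PowerSeries K) :
    PowerSeries.subst (evalAt B φ ψ) U = evalAt (PowerSeries.subst B U) φ ψ := by
  have h1 : MvPowerSeries.HasSubst (fun _ : Unit => B) :=
    MvPowerSeries.hasSubst_of_constantCoeff_zero fun _ => hB
  have := MvPowerSeries.subst_comp_subst_apply h1 (hasSubst_pair (a := φ) (b := ψ) hφ hψ) U
  exact this.symm

/-- The values on a primitive parametrization contain all series of large order. -/
theorem IsPrimitiveParametrization.exists_conductor {F : MvPowerSeries (Fin 2) K}
    {φ ψ : PowerSeries K} (hp : IsPrimitiveParametrization F φ ψ) :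
    ∃ c : ℕ, ∀ s : PowerSeries K, (c : ℕ∞) ≤ s.order → ∃ r, evalAt r φ ψ = s := by
  have hφ := hp.constantCoeff_fst
  have hψ := hp.constantCoeff_snd
  let e := evHom φ ψ hφ hψ
  suffices H : ∃ c : ℕ, ∀ s : PowerSeries K, (c : ℕ∞) ≤ s.order → ∃ r, e r = s by
    simpa only [e, evHom_apply] using H
  obtain ⟨A, B, m, hm, hA, hB⟩ : ∃ (A B : MvPowerSeries (Fin 2) K) (m : ℕ), 0 < m ∧
      (e A).order = (m + 1 : ℕ) ∧ (e B).order = m := by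
    obtain ⟨a, b, hb, hab⟩ := hp.exists_order_eq_add_one
    rw [← evHom_apply hφ hψ] at hb
    rw [← evHom_apply hφ hψ, ← evHom_apply hφ hψ] at hab
    obtain ⟨k, hk⟩ : ∃ k : ℕ, (e b).order = k := ⟨_, (PowerSeries.coe_toNat_order hb).symm⟩
    -- The extra factor a makes the smaller order positive, even if b is a unit (k = 0).
    refine ⟨a * a, a * b, 2 * k + 1, by omega, ?_, ?_⟩
    · rw [map_mul, PowerSeries.order_mul, hab, hk]; norm_cast; ring
    · rw [map_mul, PowerSeries.order_mul, hab, hk]; norm_cast; ring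
  have hBc : PowerSeries.constantCoeff (e B) = 0 := by
    rw [← PowerSeries.order_ne_zero_iff_constCoeff_eq_zero, hB]; exact_mod_cast hm.ne'
  have hB0 : e B ≠ 0 := by
    intro h; rw [h, PowerSeries.order_zero] at hB; exact absurd hB (by simp)
  have hBc' : MvPowerSeries.constantCoeff B = 0 := by
    rwa [evHom_apply, constantCoeff_evalAt hφ hψ] at hBc
  -- The order is i(m+1) + (m-i)m = m² + i, which meets every residue class modulo m = ord B once.
  -- Together with powers of B all orders from m² on are reached, hence the bound m².
  let v : ℕ → MvPowerSeries (Fin 2) K := fun i => A ^ i * B ^ (m - i)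
  have hv : ∀ i < m, (e (v i)).order = (m * m + i : ℕ) := fun i hi => by
    simp only [v, map_mul, map_pow, PowerSeries.order_mul, PowerSeries.order_pow, hA, hB]
    obtain ⟨j, rfl⟩ := Nat.exists_eq_add_of_lt hi
    rw [show i + j + 1 - i = j + 1 by omega, nsmul_eq_mul, nsmul_eq_mul]
    norm_cast; ring
  refine ⟨m * m, fun s hs => ?_⟩
  obtain ⟨U, hU⟩ := exists_eq_sum_of_step (ι := Fin m)
    (substHom (e B) hBc : PowerSeries K →+* PowerSeries K)
    (by
      intro s hs
      refine pow_separated hBc s fun n => ?_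
      simpa [substHom_X] using hs n) (fun i => e (v i)) {s | ((m * m : ℕ) : ℕ∞) ≤ s.order}
    (by
      intro s hs
      obtain ⟨κ, hκ⟩ := exists_sub_sum_order (fun i => e (v i)) m hv s hs
      obtain ⟨s', hs'⟩ : e B ∣ s - ∑ i ∈ Finset.range m, PowerSeries.C (κ i) * e (v i) := by
        refine dvd_of_order_le hB0 (le_trans ?_ hκ)
        rw [hB]; exact_mod_cast Nat.le_add_left _ _
      refine ⟨fun i => κ i, s', ?_, ?_⟩
      · rw [hs', PowerSeries.order_mul, hB, add_comm (m * m), Nat.cast_add] at hκ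
        exact (ENat.add_le_add_iff_left (ENat.natCast_ne_top m)).1 hκ
      · simp only [RingHom.coe_coe, substHom_C, substHom_X]
        rw [← hs', Finset.sum_range (fun i => PowerSeries.C (κ i) * e (v i))]; ring) s hs
  refine ⟨∑ i : Fin m, PowerSeries.subst B (U i) * v i, ?_⟩
  rw [hU, map_sum]
  refine Finset.sum_congr rfl fun i _ => ?_
  rw [map_mul]; congr 1
  rw [RingHom.coe_coe, substHom_apply, evHom_apply, evHom_apply, subst_evalAt hφ hψ hBc']

/-! ### Kernels of evaluations -/

theorem exists_eq_X0_pow_mul {f : MvPowerSeries (Fin 2) K} (hf : f ≠ 0) :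
    ∃ (a : ℕ) (f₁ : MvPowerSeries (Fin 2) K), f = MvPowerSeries.X 0 ^ a * f₁ ∧
      ¬ MvPowerSeries.X 0 ∣ f₁ := by
  have : FiniteMultiplicity (MvPowerSeries.X 0) f := by
    by_contra h
    refine hf (X0_pow_separated f fun n => ?_)
    rw [FiniteMultiplicity.not_iff_forall] at h
    exact h n
  obtain ⟨c, hc, hc'⟩ := this.exists_eq_pow_mul_and_not_dvd
  exact ⟨_, c, hc, hc'⟩

/-- Take F in the kernel with F(0,y) of least order d and divide by F. A nonzero remainder would lie
in the kernel and have degree below d in y; cancelling its power of x, which is allowed since φ ≠ 0,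
would give an element of the kernel of order below d on x = 0. -/
theorem exists_kernel_generator {φ ψ : PowerSeries K} (hφ : PowerSeries.constantCoeff φ = 0)
    (hψ : PowerSeries.constantCoeff ψ = 0) (hne : φ ≠ 0) {f : MvPowerSeries (Fin 2) K}
    (hf : f ≠ 0) (hf0 : evalAt f φ ψ = 0) :
    ∃ F : MvPowerSeries (Fin 2) K, ∀ g, evalAt g φ ψ = 0 ↔ F ∣ g := by
  classical
  have hdiv : ∀ g : MvPowerSeries (Fin 2) K, g ≠ 0 → evalAt g φ ψ = 0 →
      ∃ (a : ℕ) (g₁ : MvPowerSeries (Fin 2) K), g = MvPowerSeries.X 0 ^ a * g₁ ∧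
        evalAt g₁ φ ψ = 0 ∧ evalAt g₁ 0 PowerSeries.X ≠ 0 := fun g hg hg0 => by
    obtain ⟨a, g₁, h1, h2⟩ := exists_eq_X0_pow_mul hg
    refine ⟨a, g₁, h1, ?_, fun h => h2 (X0_dvd_iff.2 h)⟩
    rw [h1, evalAt_mul hφ hψ, evalAt_pow hφ hψ, evalAt_X0 hφ hψ] at hg0
    exact (mul_eq_zero.1 hg0).resolve_left (pow_ne_zero _ hne)
  have hex : ∃ d : ℕ, ∃ F : MvPowerSeries (Fin 2) K, evalAt F φ ψ = 0 ∧
      (evalAt F 0 PowerSeries.X).order = d := by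
    obtain ⟨a, f₁, -, h1, h2⟩ := hdiv f hf hf0
    exact ⟨_, f₁, h1, (PowerSeries.coe_toNat_order h2).symm⟩
  obtain ⟨F, hF, hd⟩ := Nat.find_spec hex
  refine ⟨F, fun g => ⟨fun hg => ?_, fun h => ?_⟩⟩
  · obtain ⟨q, r, hgr, hr⟩ := exists_weierstrass_div hd g
    have hr0 : evalAt r φ ψ = 0 := by
      rw [hgr, evalAt_add hφ hψ, evalAt_mul hφ hψ, hF, mul_zero, zero_add] at hg
      exact hg
    by_cases hrz : r = 0
    · rw [hgr, hrz, add_zero]; exact dvd_mul_left _ _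
    · exfalso
      obtain ⟨a, r₁, h1, h2, h3⟩ := hdiv r hrz hr0
      have h4 : ∀ n, Nat.find hex ≤ n → PowerSeries.coeff n (evalAt r₁ 0 PowerSeries.X) = 0 := by
        intro n hn
        have := hr (expo a n) (by simpa using hn)
        rw [h1, show expo a n = Finsupp.single 0 a + expo 0 n from
          expo_ext (by simp) (by simp), MvPowerSeries.X_pow_eq,
          MvPowerSeries.coeff_add_monomial_mul, one_mul] at this
        rw [coeff_evalAt_zero_X, this]
      refine Nat.find_min hex (m := (evalAt r₁ 0 PowerSeries.X).order.toNat) ?_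
        ⟨r₁, h2, (PowerSeries.coe_toNat_order h3).symm⟩
      by_contra hle
      exact PowerSeries.coeff_order h3 (h4 _ (not_lt.1 hle))
  · have := evalAt_dvd hφ hψ h
    rw [hF] at this
    exact zero_dvd_iff.1 this

/-- A primitive parametrization of `F` such that the series vanishing on it are the multiples
of `F`. -/
structure IsBranch (F : MvPowerSeries (Fin 2) K) (φ ψ : PowerSeries K) : Prop where
  param : IsPrimitiveParametrization F φ ψ
  ker : ∀ g, evalAt g φ ψ = 0 ↔ F ∣ g
  ne_zero : F ≠ 0

theorem subst_injective {t : PowerSeries K} (ht : PowerSeries.constantCoeff t = 0) (h0 : t ≠ 0)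
    {a : PowerSeries K} (ha : PowerSeries.subst t a = 0) : a = 0 := by
  by_contra hne
  have h2 := PowerSeries.X_pow_order_mul_divXPowOrder (f := a)
  have h3 : IsUnit (PowerSeries.divXPowOrder a) := by
    rw [PowerSeries.isUnit_iff_constantCoeff, isUnit_iff_ne_zero, Ne,
      PowerSeries.constantCoeff_divXPowOrder_eq_zero_iff]
    exact hne
  rw [← substHom_apply ht, ← h2, map_mul, map_pow, substHom_X] at ha
  exact mul_ne_zero (pow_ne_zero _ h0) (h3.map (substHom t ht)).ne_zero ha

theorem evalAt_subst {t : PowerSeries K} (ht : PowerSeries.constantCoeff t = 0)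
    {φ ψ : PowerSeries K} (hφ : PowerSeries.constantCoeff φ = 0)
    (hψ : PowerSeries.constantCoeff ψ = 0) (g : MvPowerSeries (Fin 2) K) :
    evalAt g (PowerSeries.subst t φ) (PowerSeries.subst t ψ) =
      PowerSeries.subst t (evalAt g φ ψ) := by
  have h1 : MvPowerSeries.HasSubst (fun _ : Unit => (t : MvPowerSeries Unit K)) :=
    MvPowerSeries.hasSubst_of_constantCoeff_zero fun _ => ht
  have := MvPowerSeries.subst_comp_subst_apply (hasSubst_pair (a := φ) (b := ψ) hφ hψ) h1 g
  rw [evalAt, evalAt]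
  refine Eq.trans ?_ this.symm
  congr 1
  funext i; fin_cases i <;> rfl

/-- The case φ = 0, not covered by `exists_kernel_generator`: evaluation is restriction to x = 0
followed by the injective substitution of ψ. -/
theorem X0_isBranch {ψ : PowerSeries K} (hψ : PowerSeries.constantCoeff ψ = 0) (hne : ψ ≠ 0)
    (g : MvPowerSeries (Fin 2) K) : evalAt g 0 ψ = 0 ↔ MvPowerSeries.X 0 ∣ g := by
  rw [X0_dvd_iff]
  have hz : PowerSeries.constantCoeff (0 : PowerSeries K) = 0 := map_zero _
  have h := evalAt_subst hψ hz PowerSeries.constantCoeff_X g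
  rw [PowerSeries.subst_X (PowerSeries.HasSubst.of_constantCoeff_zero' hψ), ← substHom_apply hψ,
    ← substHom_apply hψ, map_zero] at h
  rw [h]
  refine ⟨fun h => subst_injective hψ hne ?_, fun h => by rw [h, map_zero]⟩
  rwa [← substHom_apply hψ]

/-- The kernel is principal; its generator divides f and is not a unit, so by irreducibility it is
associated to f. -/
theorem IsPrimitiveParametrization.isBranch {f : MvPowerSeries (Fin 2) K} (hf : Irreducible f)
    {φ ψ : PowerSeries K} (hp : IsPrimitiveParametrization f φ ψ) : IsBranch f φ ψ := by
  refine ⟨hp, ?_, hf.ne_zero⟩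
  have hφ := hp.constantCoeff_fst
  have hψ := hp.constantCoeff_snd
  obtain ⟨F, hF⟩ : ∃ F : MvPowerSeries (Fin 2) K, ∀ g, evalAt g φ ψ = 0 ↔ F ∣ g := by
    by_cases h0 : φ = 0
    · subst h0
      exact ⟨MvPowerSeries.X 0, X0_isBranch hψ (hp.ne_zero.resolve_left (by simp))⟩
    · exact exists_kernel_generator hφ hψ h0 hf.ne_zero hp.eval_eq_zero
  have h1 : F ∣ f := (hF f).1 hp.eval_eq_zero
  have h2 : ¬ IsUnit F := fun h => by
    have := (hF 1).2 (h.dvd)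
    rw [← evHom_apply hφ hψ, map_one] at this
    exact one_ne_zero this
  have h3 : Associated F f := by
    obtain ⟨c, hc⟩ := h1
    have := (hf.isUnit_or_isUnit hc).resolve_left h2
    rw [hc]
    exact (associated_mul_unit_right F c this)
  intro g
  rw [hF g, h3.dvd_iff_dvd_left]

/-! ### Intersection numbers as lengths -/

theorem length_quotient_eq {M M' : Type*} [AddCommGroup M] [AddCommGroup M'] [Module K M]
    [Module K M'] (f : M →ₗ[K] M') (B : Submodule K M') (hB : B ≤ LinearMap.range f) :
    Module.length K (M' ⧸ B) = Module.length K (M ⧸ B.comap f) +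
      Module.length K (M' ⧸ LinearMap.range f) := by
  refine Module.length_eq_add_of_exact ((B.comap f).mapQ B f le_rfl) (Submodule.factor hB) ?_ ?_ ?_
  · rw [← LinearMap.ker_eq_bot, Submodule.mapQ, Submodule.ker_liftQ_eq_bot]
    rw [LinearMap.ker_comp, Submodule.ker_mkQ]
  · exact Submodule.factor_surjective hB
  · rw [LinearMap.exact_iff]
    ext x
    obtain ⟨y, rfl⟩ := Submodule.mkQ_surjective B x
    rw [LinearMap.mem_ker, LinearMap.mem_range, Submodule.mkQ_apply,
      show Submodule.factor hB (Submodule.Quotient.mk y) = Submodule.Quotient.mk y from rfl,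
      Submodule.Quotient.mk_eq_zero, LinearMap.mem_range]
    constructor
    · rintro ⟨z, rfl⟩
      exact ⟨Submodule.Quotient.mk z, by simp⟩
    · rintro ⟨z, hz⟩
      obtain ⟨z, rfl⟩ := Submodule.mkQ_surjective _ z
      rw [Submodule.mkQ_apply, Submodule.mapQ_apply, Submodule.Quotient.eq] at hz
      obtain ⟨w, hw⟩ := hB hz
      exact ⟨z - w, by rw [map_sub, hw]; abel⟩

theorem length_quotient_X_pow (n : ℕ) : Module.length K (PowerSeries K ⧸
    LinearMap.range (LinearMap.mulLeft K ((PowerSeries.X : PowerSeries K) ^ n))) = n := by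
  induction n with
  | zero =>
    rw [Nat.cast_zero, Module.length_eq_zero_iff, Submodule.Quotient.subsingleton_iff]
    ext x; simp
  | succ n ih =>
    rw [length_quotient_eq (LinearMap.mulLeft K (PowerSeries.X : PowerSeries K))]
    · have h1 : (LinearMap.range (LinearMap.mulLeft K ((PowerSeries.X : PowerSeries K) ^ (n + 1)))
          ).comap (LinearMap.mulLeft K (PowerSeries.X : PowerSeries K)) =
          LinearMap.range (LinearMap.mulLeft K ((PowerSeries.X : PowerSeries K) ^ n)) := by
        ext x
        simp only [Submodule.mem_comap, LinearMap.mulLeft_apply, LinearMap.mem_range, pow_succ',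
          mul_assoc]
        exact exists_congr fun y => (mul_right_injective₀ PowerSeries.X_ne_zero).eq_iff
      have h2 : LinearMap.range (LinearMap.mulLeft K (PowerSeries.X : PowerSeries K)) =
          LinearMap.ker (PowerSeries.coeff (R := K) 0) := by
        ext x
        rw [LinearMap.mem_ker, PowerSeries.coeff_zero_eq_constantCoeff_apply, ← PowerSeries.X_dvd_iff]
        simp only [LinearMap.mem_range, LinearMap.mulLeft_apply]
        exact ⟨fun ⟨y, hy⟩ => ⟨y, hy.symm⟩, fun ⟨y, hy⟩ => ⟨y, hy.symm⟩⟩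
      rw [h1, ih, h2]
      have h3 : Function.Surjective (PowerSeries.coeff (R := K) 0) := fun c =>
        ⟨PowerSeries.C c, by simp⟩
      rw [((PowerSeries.coeff (R := K) 0).quotKerEquivOfSurjective h3).length_eq,
        Module.length_eq_one]
      simp
    · rintro _ ⟨y, rfl⟩
      exact ⟨PowerSeries.X ^ n * y, by simp [pow_succ']⟩

theorem length_quotient_mulLeft {γ : PowerSeries K} (hγ : γ ≠ 0) : Module.length K
    (PowerSeries K ⧸ LinearMap.range (LinearMap.mulLeft K γ)) = γ.order := by
  have h : LinearMap.range (LinearMap.mulLeft K γ) = LinearMap.range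
      (LinearMap.mulLeft K ((PowerSeries.X : PowerSeries K) ^ γ.order.toNat)) := by
    ext x
    simp only [LinearMap.mem_range, LinearMap.mulLeft_apply]
    constructor
    · rintro ⟨y, rfl⟩
      obtain ⟨z, hz⟩ := PowerSeries.X_pow_order_dvd (φ := γ)
      exact ⟨z * y, by rw [← mul_assoc, ← hz]⟩
    · rintro ⟨y, rfl⟩
      have h1 : γ ∣ PowerSeries.X ^ γ.order.toNat := by
        refine dvd_of_order_le hγ ?_
        rw [PowerSeries.order_X_pow, PowerSeries.coe_toNat_order hγ]
      obtain ⟨z, hz⟩ := h1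
      exact ⟨z * y, by rw [← mul_assoc, ← hz]⟩
  rw [h, length_quotient_X_pow, PowerSeries.coe_toNat_order hγ]

/-- Let O = K[[t]], let R be the ring of values and γ = G(φ,ψ). The length of O/γR is length(R/γR) +
length(O/R) through R, and length(O/R) + ord γ through multiplication by γ on O. The length of O/R
is finite by `exists_conductor` and cancels, while R/γR is K[[x,y]]/(F,G). -/
theorem IsBranch.length_quotient {F : MvPowerSeries (Fin 2) K} {φ ψ : PowerSeries K}
    (hF : IsBranch F φ ψ) {G : MvPowerSeries (Fin 2) K} (hG : ¬ F ∣ G) :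
    Module.length K (MvPowerSeries (Fin 2) K ⧸ (Ideal.span {F, G}).restrictScalars K) =
      (evalAt G φ ψ).order := by
  have hφ := hF.param.constantCoeff_fst
  have hψ := hF.param.constantCoeff_snd
  set γ := evalAt G φ ψ with hγdef
  have hγ : γ ≠ 0 := fun h => hG ((hF.ker G).1 h)
  let e : MvPowerSeries (Fin 2) K →ₗ[K] PowerSeries K := (evHom φ ψ hφ hψ).toLinearMap
  have he : ∀ g, e g = evalAt g φ ψ := fun g => evHom_apply hφ hψ g
  set R := LinearMap.range e
  set mg := LinearMap.mulLeft K γ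
  have hmg : Function.Injective mg := mul_right_injective₀ hγ
  set N := R.map mg
  have hNR : N ≤ R := by
    rintro _ ⟨_, ⟨x, rfl⟩, rfl⟩
    exact ⟨G * x, by rw [he, he, evalAt_mul hφ hψ]; rfl⟩
  have hNm : N ≤ LinearMap.range mg := LinearMap.map_le_range
  have h1 : N.comap e = (Ideal.span {F, G}).restrictScalars K := by
    ext x
    rw [Submodule.mem_comap, Submodule.restrictScalars_mem, Ideal.mem_span_pair]
    constructor
    · rintro ⟨_, ⟨y, rfl⟩, hy⟩
      have : evalAt (x - G * y) φ ψ = 0 := by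
        rw [evalAt_sub hφ hψ, evalAt_mul hφ hψ, ← he x, ← hy, he]
        simp [mg, hγdef]
      obtain ⟨z, hz⟩ := (hF.ker _).1 this
      exact ⟨z, y, by rw [mul_comm z, ← hz]; ring⟩
    · rintro ⟨a, b, rfl⟩
      refine ⟨_, ⟨b, rfl⟩, ?_⟩
      rw [he, he, evalAt_add hφ hψ, evalAt_mul hφ hψ, evalAt_mul hφ hψ, hF.param.eval_eq_zero]
      simp [mg, hγdef, mul_comm]
  have h2 : N.comap mg = R := Submodule.comap_map_eq_of_injective hmg R
  have h3 := length_quotient_eq e N hNR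
  have h4 := length_quotient_eq mg N hNm
  rw [h1] at h3
  rw [h2, length_quotient_mulLeft hγ] at h4
  have hfin : Module.length K (PowerSeries K ⧸ R) ≠ ⊤ := by
    obtain ⟨c, hc⟩ := hF.param.exists_conductor
    have hle : LinearMap.range (LinearMap.mulLeft K ((PowerSeries.X : PowerSeries K) ^ c)) ≤ R := by
      rintro _ ⟨y, rfl⟩
      obtain ⟨r, hr⟩ := hc (PowerSeries.X ^ c * y) (le_order_of_X_pow_dvd (dvd_mul_right _ _))
      exact ⟨r, by rw [he, hr]; rfl⟩
    have := Module.length_le_of_surjective (Submodule.factor hle) (Submodule.factor_surjective hle)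
    rw [length_quotient_X_pow] at this
    exact ne_top_of_le_ne_top (ENat.natCast_ne_top c) this
  rw [h3, add_comm] at h4
  exact ENat.add_right_injective_of_ne_top hfin h4

theorem IsBranch.order_evalAt_comm {F G : MvPowerSeries (Fin 2) K} {φ ψ φ' ψ' : PowerSeries K}
    (hF : IsBranch F φ ψ) (hG : IsBranch G φ' ψ') (h : ¬ F ∣ G) (h' : ¬ G ∣ F) :
    (evalAt G φ ψ).order = (evalAt F φ' ψ').order := by
  rw [← hF.length_quotient h, ← hG.length_quotient h', Set.pair_comm]

end NewtonTree

end

noncomputable section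

namespace NewtonTree

variable {K : Type*} [Field K]

/-! ### Discrete valuation rings over finite extensions of a ring of power series -/

section integralClosure
universe u
variable (D : Type u) [CommRing D] [IsDomain D] [Algebra (PowerSeries K) D]
  [Module.Finite (PowerSeries K) D]

theorem not_isUnit_algebraMap_X (S : Type*) [CommRing S] [Algebra (PowerSeries K) S]
    [Algebra.IsIntegral (PowerSeries K) S]
    (hinj : Function.Injective (algebraMap (PowerSeries K) S)) :
    ¬ IsUnit (algebraMap (PowerSeries K) S PowerSeries.X) := fun h => by
  have : FaithfulSMul (PowerSeries K) S := (faithfulSMul_iff_algebraMap_injective _ _).2 hinj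
  exact PowerSeries.X_prime.not_isUnit ((isUnit_map_iff (algebraMap (PowerSeries K) S) _).1 h)

theorem exists_eq_X_pow_mul_of_ne_zero {a : PowerSeries K} (ha : a ≠ 0) :
    ∃ (n : ℕ) (u : PowerSeries K), IsUnit u ∧ a = PowerSeries.X ^ n * u := by
  refine ⟨a.order.toNat, a.divXPowOrder, ?_, PowerSeries.X_pow_order_mul_divXPowOrder.symm⟩
  rw [PowerSeries.isUnit_iff_constantCoeff, isUnit_iff_ne_zero, Ne,
    PowerSeries.constantCoeff_divXPowOrder_eq_zero_iff]
  exact ha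

/-- An integral domain, integral over the power series ring, is `X`-adically separated. -/
theorem algebraMap_X_separated (S : Type*) [CommRing S] [IsDomain S] [Algebra (PowerSeries K) S]
    [Algebra.IsIntegral (PowerSeries K) S]
    (hinj : Function.Injective (algebraMap (PowerSeries K) S)) (s : S)
    (hs : ∀ n : ℕ, algebraMap (PowerSeries K) S PowerSeries.X ^ n ∣ s) : s = 0 := by
  by_contra h0
  -- By integrality a nonzero s divides a nonzero element of the base ring, that is, some X^n times
  -- a unit. If X^(n+1) divided s, then X would become a unit.
  have h1 := Ideal.comap_ne_bot_of_integral_mem h0 (Ideal.mem_span_singleton_self s)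
    (Algebra.IsIntegral.isIntegral (R := PowerSeries K) s)
  obtain ⟨a, ha, ha0⟩ := Submodule.exists_mem_ne_zero_of_ne_bot h1
  rw [Ideal.mem_comap, Ideal.mem_span_singleton] at ha
  obtain ⟨n, u, hu, rfl⟩ := exists_eq_X_pow_mul_of_ne_zero ha0
  rw [map_mul, map_pow, (hu.map _).dvd_mul_right] at ha
  have h2 := (hs (n + 1)).trans ha
  have hX : algebraMap (PowerSeries K) S PowerSeries.X ≠ 0 := by
    rw [Ne, map_eq_zero_iff _ hinj]; exact PowerSeries.X_ne_zero
  rw [pow_succ] at h2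
  have h3 : algebraMap (PowerSeries K) S PowerSeries.X ∣ 1 := by
    have h4 : algebraMap (PowerSeries K) S PowerSeries.X ^ n *
      algebraMap (PowerSeries K) S PowerSeries.X ∣
      algebraMap (PowerSeries K) S PowerSeries.X ^ n * 1 := by rwa [mul_one]
    exact (mul_dvd_mul_iff_left (pow_ne_zero n hX)).1 h4
  exact not_isUnit_algebraMap_X S hinj (isUnit_of_dvd_one h3)

/-- Linear independence modulo `X` bounds linear independence over the power series ring. -/
theorem card_le_of_linearIndependent_mod_X
    (S : Type*) [CommRing S] [IsDomain S] [Algebra (PowerSeries K) S]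
    (hinjS : Function.Injective (algebraMap (PowerSeries K) S))
    (j : S →ₐ[PowerSeries K] FractionRing D) (hj : Function.Injective j)
    {ι : Type*} [Fintype ι] (v : ι → S)
    (hv : ∀ κ : ι → K, algebraMap (PowerSeries K) S PowerSeries.X ∣
      ∑ i, algebraMap (PowerSeries K) S (PowerSeries.C (κ i)) * v i → κ = 0) :
    Fintype.card ι ≤ Module.finrank (PowerSeries K) D := by
  classical
  have hX : algebraMap (PowerSeries K) S PowerSeries.X ≠ 0 := by
    rw [Ne, map_eq_zero_iff _ hinjS]; exact PowerSeries.X_ne_zero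
  -- A common denominator moves the family into D, where independent families are bounded by the
  -- rank.
  obtain ⟨b, hb⟩ := IsLocalization.exist_integer_multiples_of_finite (nonZeroDivisors D)
    (fun i => j (v i))
  choose w hw using hb
  have hlin : LinearIndependent (PowerSeries K) w := by
    rw [Fintype.linearIndependent_iff]
    intro a ha
    by_contra! hne
    obtain ⟨i₀, hi₀⟩ := hne
    have hS : ∑ i, algebraMap (PowerSeries K) S (a i) * v i = 0 := by
      have h1 : algebraMap D (FractionRing D) b *
          (∑ i, algebraMap (PowerSeries K) (FractionRing D) (a i) * j (v i)) = 0 := by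
        rw [← map_zero (algebraMap D (FractionRing D)), ← ha, map_sum, Finset.mul_sum]
        refine Finset.sum_congr rfl fun i _ => ?_
        rw [Algebra.smul_def, map_mul, hw, ← IsScalarTower.algebraMap_apply, Algebra.smul_def]
        ring
      have h2 := (mul_eq_zero.1 h1).resolve_left
        (IsFractionRing.to_map_ne_zero_of_mem_nonZeroDivisors b.2)
      apply hj
      rw [map_sum, map_zero, ← h2]
      exact Finset.sum_congr rfl fun i _ => by rw [map_mul, AlgHom.commutes]
    -- Dividing a relation by the largest power of X common to its coefficients leaves a nontrivial
    -- relation modulo X, with coefficients in K.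
    obtain ⟨j₀, -, hj₀⟩ := Finset.exists_min_image Finset.univ (fun i => (a i).order)
      ⟨i₀, Finset.mem_univ _⟩
    have haj : a j₀ ≠ 0 := by
      intro h
      have := hj₀ i₀ (Finset.mem_univ _)
      rw [h, PowerSeries.order_zero, top_le_iff, PowerSeries.order_eq_top] at this
      exact hi₀ this
    set n := (a j₀).order.toNat
    have hdvd : ∀ i, PowerSeries.X ^ n ∣ a i := fun i =>
      X_pow_dvd_of_le_order (by
        rw [PowerSeries.coe_toNat_order haj]; exact hj₀ i (Finset.mem_univ _))
    choose c hc using hdvd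
    have hc0 : ∑ i, algebraMap (PowerSeries K) S (c i) * v i = 0 := by
      have h1 : algebraMap (PowerSeries K) S PowerSeries.X ^ n *
          (∑ i, algebraMap (PowerSeries K) S (c i) * v i) = 0 := by
        rw [← hS, Finset.mul_sum]
        refine Finset.sum_congr rfl fun i _ => ?_
        rw [hc i, map_mul, map_pow]; ring
      exact (mul_eq_zero.1 h1).resolve_left (pow_ne_zero _ hX)
    have h2 := hv (fun i => PowerSeries.constantCoeff (c i)) (by
      have h3 : ∀ i, PowerSeries.X ∣ PowerSeries.C (PowerSeries.constantCoeff (c i)) - c i :=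
        fun i => by rw [PowerSeries.X_dvd_iff]; simp
      have h4 : ∑ i, algebraMap (PowerSeries K) S
          (PowerSeries.C (PowerSeries.constantCoeff (c i))) * v i =
          ∑ i, algebraMap (PowerSeries K) S
          (PowerSeries.C (PowerSeries.constantCoeff (c i)) - c i) * v i := by
        rw [← sub_zero (∑ i, algebraMap (PowerSeries K) S
          (PowerSeries.C (PowerSeries.constantCoeff (c i))) * v i), ← hc0, ← Finset.sum_sub_distrib]
        refine Finset.sum_congr rfl fun i _ => ?_
        rw [map_sub]; ring
      rw [h4]
      exact Finset.dvd_sum fun i _ => Dvd.dvd.mul_right (map_dvd _ (h3 i)) _)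
    have h5 := PowerSeries.coeff_order haj
    have h6 : PowerSeries.coeff n (a j₀) = PowerSeries.constantCoeff (c j₀) := by
      rw [hc j₀, PowerSeries.coeff_X_pow_mul', if_pos le_rfl, Nat.sub_self,
        PowerSeries.coeff_zero_eq_constantCoeff_apply]
    exact h5 (h6.trans (congrFun h2 j₀))
  exact hlin.fintype_card_le_finrank


theorem sum_smul_mk (S : Type*) [CommRing S] [Algebra (PowerSeries K) S] [Algebra K S]
    [IsScalarTower K (PowerSeries K) S] (I : Ideal S) {ι : Type*} [Fintype ι] (v : ι → S)
    (κ : ι → K) : ∑ i, κ i • Ideal.Quotient.mk I (v i) = Ideal.Quotient.mk I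
        (∑ i, algebraMap (PowerSeries K) S (PowerSeries.C (κ i)) * v i) := by
  rw [map_sum]
  refine Finset.sum_congr rfl fun i _ => ?_
  rw [show algebraMap (PowerSeries K) S (PowerSeries.C (κ i)) = algebraMap K S (κ i) from
    (IsScalarTower.algebraMap_apply K (PowerSeries K) S (κ i)).symm, ← Algebra.smul_def]
  rfl

/-- Finiteness of the normalization without any separability. A K-independent family in S/XS lifts
to a family bounded by the rank of D (`card_le_of_linearIndependent_mod_X`), so S/XS is finite
dimensional; lifts of a basis generate S, by expansion in powers of X. -/
theorem finite_of_integral (S : Type*) [CommRing S] [IsDomain S] [Algebra (PowerSeries K) S]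
    [Algebra K S] [IsScalarTower K (PowerSeries K) S] [Algebra.IsIntegral (PowerSeries K) S]
    (hinjS : Function.Injective (algebraMap (PowerSeries K) S))
    (j : S →ₐ[PowerSeries K] FractionRing D) (hj : Function.Injective j) :
    Module.Finite K (S ⧸ Ideal.span {algebraMap (PowerSeries K) S PowerSeries.X}) ∧
      Module.Finite (PowerSeries K) S := by
  classical
  set x : S := algebraMap (PowerSeries K) S PowerSeries.X with hx
  have hQ : Module.Finite K (S ⧸ Ideal.span {x}) := by
    rw [← Module.rank_lt_aleph0_iff]
    refine lt_of_le_of_lt (rank_le (n := Module.finrank (PowerSeries K) D) fun s hs => ?_)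
      (Cardinal.natCast_lt_aleph0)
    choose f hf using fun q : s => Ideal.Quotient.mk_surjective (I := Ideal.span {x}) (q : S ⧸ _)
    rw [← Fintype.card_coe s]
    refine card_le_of_linearIndependent_mod_X D S hinjS j hj f fun κ hκ => ?_
    rw [Fintype.linearIndependent_iff] at hs
    funext i
    refine hs κ ?_ i
    rw [← hx, ← Ideal.mem_span_singleton, ← Ideal.Quotient.eq_zero_iff_mem, ← sum_smul_mk] at hκ
    simpa only [hf] using hκ
  refine ⟨hQ, ?_⟩
  let β := Module.finBasis K (S ⧸ Ideal.span {x})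
  choose f hf using fun i => Ideal.Quotient.mk_surjective (I := Ideal.span {x}) (β i)
  rw [Module.finite_def, Submodule.fg_def]
  refine ⟨Set.range f, Set.finite_range f, ?_⟩
  rw [eq_top_iff]
  rintro s -
  obtain ⟨U, hU⟩ := exists_eq_sum_of_step (algebraMap (PowerSeries K) S)
    (algebraMap_X_separated S hinjS) f Set.univ (fun m _ => by
      refine ⟨β.repr (Ideal.Quotient.mk _ m), ?_⟩
      have h1 := β.sum_repr (Ideal.Quotient.mk _ m)
      simp only [← hf] at h1
      rw [sum_smul_mk, eq_comm, Ideal.Quotient.mk_eq_mk_iff_sub_mem, Ideal.mem_span_singleton] at h1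
      obtain ⟨m', hm'⟩ := h1
      exact ⟨m', trivial, by rw [← hx, ← hm']; ring⟩) s trivial
  rw [hU]
  refine Submodule.sum_mem _ fun i _ => ?_
  rw [← Algebra.smul_def]
  exact Submodule.smul_mem _ _ (Submodule.subset_span ⟨i, rfl⟩)

/-- There is a discrete valuation ring with residue field `K` containing `D` in which `X` is not a
unit. -/
theorem exists_dvr [IsAlgClosed K] [Algebra K D] [IsScalarTower K (PowerSeries K) D]
    (hinj : Function.Injective (algebraMap (PowerSeries K) D)) :
    ∃ (V : Type u) (_ : CommRing V) (_ : IsDomain V) (ι : D →+* V) (π : V),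
      Function.Injective ι ∧ π ≠ 0 ∧ ¬ IsUnit π ∧ (∀ v : V, (∀ n : ℕ, π ^ n ∣ v) → v = 0) ∧
      (∀ v : V, ∃ c : K, π ∣ v - ι (algebraMap K D c)) ∧
      π ∣ ι (algebraMap (PowerSeries K) D PowerSeries.X) := by
  classical
  let A := PowerSeries K
  let E := FractionRing D
  let S := integralClosure A E
  have hinjE : Function.Injective (algebraMap A E) := by
    rw [IsScalarTower.algebraMap_eq A D E, RingHom.coe_comp]
    exact (IsFractionRing.injective D E).comp hinj
  have hinjS : Function.Injective (algebraMap A S) := fun a b h =>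
    hinjE (congrArg (algebraMap S E) h)
  have hint : Algebra.IsIntegral A S := integralClosure.AlgebraIsIntegral ..
  have hfaith : FaithfulSMul A D := (faithfulSMul_iff_algebraMap_injective _ _).2 hinj
  obtain ⟨hQ, hfin⟩ := finite_of_integral D S hinjS (Subalgebra.val S) Subtype.val_injective
  have hnoeth : IsNoetherianRing S := IsNoetherianRing.of_finite A S
  have halg : Algebra.IsAlgebraic A E := by
    have : Algebra.IsAlgebraic A D := Algebra.IsIntegral.isAlgebraic
    exact (IsFractionRing.isAlgebraic_iff' A D E).1 inferInstance
  have hfrac : IsFractionRing S E := integralClosure.isFractionRing_of_algebraic fun x hx =>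
    (map_eq_zero_iff _ hinjE).1 hx
  have hclosed : IsIntegrallyClosed S :=
    (IsIntegrallyClosed.integralClosure_eq_bot_iff E).mp integralClosure_idem
  have hDed : IsDedekindDomain S := { }
  have hx : ¬ IsUnit (algebraMap A S PowerSeries.X) := not_isUnit_algebraMap_X S hinjS
  obtain ⟨m, hm, hxm⟩ := exists_max_ideal_of_mem_nonunits hx
  -- S is Noetherian because it is finite over K[[X]], hence a Dedekind domain, and m is a maximal
  -- ideal containing X.
  let V := Localization.AtPrime m
  have hxne : algebraMap A S PowerSeries.X ≠ 0 := by
    rw [Ne, map_eq_zero_iff _ hinjS]; exact PowerSeries.X_ne_zero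
  have hmne : m ≠ ⊥ := fun h => hxne (by rw [h] at hxm; exact hxm)
  have hV : IsDiscreteValuationRing V :=
    IsLocalization.AtPrime.isDiscreteValuationRing_of_dedekind_domain S hmne V
  obtain ⟨π, hπ⟩ := IsDiscreteValuationRing.exists_irreducible V
  have hmax := hπ.maximalIdeal_eq
  let jD : D →+* S := (algebraMap D E).codRestrict S.toSubring fun d =>
    (Algebra.IsIntegral.isIntegral (R := A) d).algebraMap
  refine ⟨V, inferInstance, inferInstance, (algebraMap S V).comp jD, π, ?_, hπ.ne_zero,
    hπ.not_isUnit, ?_, ?_, ?_⟩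
  · refine (IsLocalization.injective V m.primeCompl_le_nonZeroDivisors).comp fun a b h => ?_
    exact IsFractionRing.injective D E (congrArg Subtype.val h)
  · intro v hv
    by_contra h0
    obtain ⟨n, u, rfl⟩ := IsDiscreteValuationRing.eq_unit_mul_pow_irreducible h0 hπ
    have h1 := hv (n + 1)
    rw [u.isUnit.dvd_mul_left, pow_succ] at h1
    have h2 : π ^ n * π ∣ π ^ n * 1 := by rwa [mul_one]
    exact hπ.not_isUnit (isUnit_of_dvd_one ((mul_dvd_mul_iff_left (pow_ne_zero n hπ.ne_zero)).1 h2))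
  · intro v
    -- The residue field is a quotient of the finite dimensional algebra S/XS, so it is K, which is
    -- algebraically closed.
    have hKm : Function.Surjective (algebraMap K (S ⧸ m)) := by
      have hle : Ideal.span {algebraMap A S PowerSeries.X} ≤ m := by
        rw [Ideal.span_singleton_le_iff_mem]; exact hxm
      have : Module.Finite K (S ⧸ m) := Module.Finite.of_surjective
        (Ideal.Quotient.factorₐ K hle).toLinearMap (Ideal.Quotient.factor_surjective hle)
      have : Algebra.IsIntegral K (S ⧸ m) := Algebra.IsIntegral.of_finite K (S ⧸ m)
      exact (IsAlgClosed.algebraMap_bijective_of_isIntegral (k := K)).2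
    obtain ⟨q, hq⟩ := (IsLocalization.AtPrime.equivQuotMaximalIdeal m V).surjective
      (Ideal.Quotient.mk _ v)
    obtain ⟨c, rfl⟩ := hKm q
    refine ⟨c, ?_⟩
    have h1 : algebraMap K (S ⧸ m) c = Ideal.Quotient.mk m (jD (algebraMap K D c)) := by
      have : jD (algebraMap K D c) = algebraMap K S c := Subtype.ext
        (IsScalarTower.algebraMap_apply K D E c).symm
      rw [this]; rfl
    rw [h1, IsLocalization.AtPrime.equivQuotMaximalIdeal_apply_mk, eq_comm,
      Ideal.Quotient.mk_eq_mk_iff_sub_mem, hmax, Ideal.mem_span_singleton] at hq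
    exact hq
  · rw [← Ideal.mem_span_singleton, ← hmax, RingHom.comp_apply]
    have h1 : jD (algebraMap A D PowerSeries.X) = algebraMap A S PowerSeries.X := Subtype.ext
      (IsScalarTower.algebraMap_apply A D E _).symm
    rw [h1]
    exact (IsLocalization.AtPrime.to_map_mem_maximal_iff V m _).2 hxm

end integralClosure

end NewtonTree

end

noncomputable section

namespace NewtonTree

variable {K : Type*} [Field K]

/-! ### Existence of parametrizations -/

/-- `a` is the expansion of `v` in powers of `π`, with coefficients in the image of `κ`. -/
def IsExpansion {V : Type*} [CommRing V] (κ : K →+* V) (π v : V) (a : PowerSeries K) : Prop :=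
  ∀ n : ℕ, ∃ p : Polynomial K, PowerSeries.X ^ n ∣ a - (p : PowerSeries K) ∧ π ^ n ∣ v - p.eval₂ κ π

namespace IsExpansion
variable {V : Type*} [CommRing V] {κ : K →+* V} {π v w : V} {a b : PowerSeries K}

theorem add (h : IsExpansion κ π v a) (h' : IsExpansion κ π w b) :
    IsExpansion κ π (v + w) (a + b) := fun n => by
  obtain ⟨p, h1, h2⟩ := h n
  obtain ⟨q, h3, h4⟩ := h' n
  refine ⟨p + q, ?_, ?_⟩
  · rw [Polynomial.coe_add, add_sub_add_comm]; exact dvd_add h1 h3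
  · rw [Polynomial.eval₂_add, add_sub_add_comm]; exact dvd_add h2 h4

theorem mul (h : IsExpansion κ π v a) (h' : IsExpansion κ π w b) :
    IsExpansion κ π (v * w) (a * b) := fun n => by
  obtain ⟨p, h1, h2⟩ := h n
  obtain ⟨q, h3, h4⟩ := h' n
  refine ⟨p * q, ?_, ?_⟩
  · rw [Polynomial.coe_mul, show a * b - (p : PowerSeries K) * (q : PowerSeries K) =
      a * (b - q) + (a - p) * q by ring]
    exact dvd_add (h3.mul_left _) (h1.mul_right _)
  · rw [Polynomial.eval₂_mul, show v * w - p.eval₂ κ π * q.eval₂ κ π =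
      v * (w - q.eval₂ κ π) + (v - p.eval₂ κ π) * q.eval₂ κ π by ring]
    exact dvd_add (h4.mul_left _) (h2.mul_right _)

theorem const (c : K) : IsExpansion κ π (κ c) (PowerSeries.C c) := fun n =>
  ⟨Polynomial.C c, by simp, by simp⟩

theorem eq_zero_left (hs : ∀ v : V, (∀ n : ℕ, π ^ n ∣ v) → v = 0)
    (h : IsExpansion κ π v 0) : v = 0 := hs v fun n => by
  obtain ⟨p, h1, h2⟩ := h n
  rw [zero_sub, dvd_neg, ← Polynomial.coe_X, ← Polynomial.coe_pow] at h1
  have h3 : Polynomial.X ^ n ∣ p := by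
    rw [Polynomial.X_pow_dvd_iff]
    intro d hd
    rw [Polynomial.coe_pow, Polynomial.coe_X, PowerSeries.X_pow_dvd_iff] at h1
    simpa using h1 d hd
  obtain ⟨q, rfl⟩ := h3
  have h4 : π ^ n ∣ (Polynomial.X ^ n * q).eval₂ κ π := by
    rw [Polynomial.eval₂_mul, Polynomial.eval₂_X_pow]; exact dvd_mul_right _ _
  simpa using dvd_add h2 h4

/-- If a had a first nonzero coefficient c, in degree m, reduction modulo π^(m+1) and cancellation
of π^m would show that π divides the unit κ(c). -/
theorem eq_zero_right [IsDomain V] (h0 : π ≠ 0) (hu : ¬ IsUnit π)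
    (h : IsExpansion κ π 0 a) : a = 0 := by
  by_contra ha
  obtain ⟨p, h1, h2⟩ := h (a.order.toNat + 1)
  set m := a.order.toNat
  have hco : ∀ d < m + 1, p.coeff d = PowerSeries.coeff d a := fun d hd => by
    have := PowerSeries.X_pow_dvd_iff.1 h1 d hd
    rw [map_sub, sub_eq_zero, Polynomial.coeff_coe] at this
    exact this.symm
  have h3 : Polynomial.X ^ m ∣ p := by
    rw [Polynomial.X_pow_dvd_iff]
    intro d hd
    rw [hco d (by omega), PowerSeries.coeff_of_lt_order_toNat _ hd]
  obtain ⟨q, rfl⟩ := h3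
  have hq0 : q.coeff 0 ≠ 0 := by
    have := hco m (by omega)
    rw [Polynomial.coeff_X_pow_mul', if_pos le_rfl, Nat.sub_self] at this
    rw [this]; exact PowerSeries.coeff_order ha
  rw [zero_sub, dvd_neg, Polynomial.eval₂_mul, Polynomial.eval₂_X_pow, pow_succ,
    mul_dvd_mul_iff_left (pow_ne_zero _ h0), ← Polynomial.divX_mul_X_add q, Polynomial.eval₂_add,
    Polynomial.eval₂_mul, Polynomial.eval₂_X, Polynomial.eval₂_C,
    dvd_add_right (dvd_mul_left _ _)] at h2
  exact hu (isUnit_of_dvd_unit h2 ((isUnit_iff_ne_zero.2 hq0).map κ))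

theorem exists_expansion (hr : ∀ v : V, ∃ c : K, π ∣ v - κ c) (v : V) :
    ∃ a, IsExpansion κ π v a := by
  choose c w hw using hr
  let u : ℕ → V := fun n => w^[n] v
  have hu : ∀ n, u n = κ (c (u n)) + π * u (n + 1) := fun n => by
    simp only [u]; rw [Function.iterate_succ_apply', ← hw]; ring
  refine ⟨PowerSeries.mk fun n => c (u n), fun n =>
    ⟨PowerSeries.trunc n (PowerSeries.mk fun n => c (u n)), ?_, ?_⟩⟩
  · rw [PowerSeries.X_pow_dvd_iff]
    intro m hm
    simp [PowerSeries.coeff_trunc, hm]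
  · refine ⟨u n, ?_⟩
    induction n with
    | zero => simp [u]
    | succ n ih =>
      rw [PowerSeries.trunc_succ, Polynomial.eval₂_add, ← sub_sub, ih,
        Polynomial.eval₂_monomial, PowerSeries.coeff_mk]
      nth_rewrite 1 [hu n]
      ring

end IsExpansion

theorem exists_eq_C_add (g : MvPowerSeries (Fin 2) K) : ∃ g₀ g₁ : MvPowerSeries (Fin 2) K,
    g = MvPowerSeries.C (MvPowerSeries.constantCoeff g) + MvPowerSeries.X 0 * g₀ +
      MvPowerSeries.X 1 * g₁ := by
  have hz : PowerSeries.constantCoeff (0 : PowerSeries K) = 0 := map_zero _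
  have hX : PowerSeries.constantCoeff (PowerSeries.X : PowerSeries K) = 0 :=
    PowerSeries.constantCoeff_X
  set b := evalAt g 0 PowerSeries.X
  obtain ⟨g₀, h0⟩ : MvPowerSeries.X 0 ∣ g - ofY b := by
    rw [X0_dvd_iff, evalAt_sub hz hX, evalAt_ofY, sub_self]
  obtain ⟨g₁, h1⟩ : MvPowerSeries.X 1 ∣
      ofY b - MvPowerSeries.C (MvPowerSeries.constantCoeff g) := by
    rw [X1_dvd_iff, evalAt_sub hX hz, evalAt_C, sub_eq_zero]
    ext n
    rw [coeff_evalAt_X_zero, ofY, coeff_ofSeq, PowerSeries.coeff_C]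
    by_cases hn : n = 0
    · subst hn
      rw [if_pos rfl, ← constantCoeff_evalAt hz hX g]; simp [b]
    · simp [hn]
  exact ⟨g₀, g₁, by rw [← h0, ← h1]; ring⟩

theorem exists_sub_mem_pow (n : ℕ) (g : MvPowerSeries (Fin 2) K) :
    ∃ P : MvPolynomial (Fin 2) K, g - (P : MvPowerSeries (Fin 2) K) ∈
      (Ideal.span {MvPowerSeries.X 0, MvPowerSeries.X 1} : Ideal (MvPowerSeries (Fin 2) K)) ^ n := by
  induction n generalizing g with
  | zero => exact ⟨0, by simp⟩
  | succ n ih =>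
    obtain ⟨g₀, g₁, hg⟩ := exists_eq_C_add g
    obtain ⟨P₀, h0⟩ := ih g₀
    obtain ⟨P₁, h1⟩ := ih g₁
    refine ⟨MvPolynomial.C (MvPowerSeries.constantCoeff g) + MvPolynomial.X 0 * P₀ +
      MvPolynomial.X 1 * P₁, ?_⟩
    nth_rewrite 1 [hg]
    push_cast
    rw [show ∀ a b c d e f i : MvPowerSeries (Fin 2) K,
      a + b * c + d * e - (a + b * f + d * i) = b * (c - f) + d * (e - i) by intros; ring, pow_succ']
    exact add_mem (Ideal.mul_mem_mul (Ideal.subset_span (by simp)) h0)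
      (Ideal.mul_mem_mul (Ideal.subset_span (by simp)) h1)

theorem pow_dvd_map_of_mem_pow {V : Type*} [CommRing V]
    (χ : MvPowerSeries (Fin 2) K →+* V) {π : V} (h0 : π ∣ χ (MvPowerSeries.X 0))
    (h1 : π ∣ χ (MvPowerSeries.X 1)) {n : ℕ} {r : MvPowerSeries (Fin 2) K}
    (hr : r ∈ (Ideal.span {MvPowerSeries.X 0, MvPowerSeries.X 1} :
      Ideal (MvPowerSeries (Fin 2) K)) ^ n) : π ^ n ∣ χ r := by
  have h2 : Ideal.span {MvPowerSeries.X 0, MvPowerSeries.X 1} ≤ (Ideal.span {π}).comap χ := by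
    rw [Ideal.span_le]
    rintro x (rfl | rfl)
    · exact Ideal.mem_span_singleton.2 h0
    · exact Ideal.mem_span_singleton.2 h1
  have h3 := (Ideal.le_comap_pow χ n) (Ideal.pow_right_mono h2 n hr)
  rwa [Ideal.mem_comap, Ideal.span_singleton_pow, Ideal.mem_span_singleton] at h3

/-- No continuity of χ is assumed. A series differs from a polynomial by an element of (x,y)^n, a
purely algebraic statement, and both χ and the evaluation map (x,y)^n into the n-th power of the
uniformizer; for polynomials expansions are compatible with sums and products. -/
theorem isExpansion_evalAt {V : Type*} [CommRing V]
    (χ : MvPowerSeries (Fin 2) K →+* V) {π : V} (h0 : π ∣ χ (MvPowerSeries.X 0))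
    (h1 : π ∣ χ (MvPowerSeries.X 1)) {φ ψ : PowerSeries K}
    (hφ : PowerSeries.constantCoeff φ = 0) (hψ : PowerSeries.constantCoeff ψ = 0)
    (hx : IsExpansion (χ.comp MvPowerSeries.C) π (χ (MvPowerSeries.X 0)) φ)
    (hy : IsExpansion (χ.comp MvPowerSeries.C) π (χ (MvPowerSeries.X 1)) ψ)
    (g : MvPowerSeries (Fin 2) K) :
    IsExpansion (χ.comp MvPowerSeries.C) π (χ g) (evalAt g φ ψ) := by
  have hP : ∀ P : MvPolynomial (Fin 2) K, IsExpansion (χ.comp MvPowerSeries.C) π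
      (χ (P : MvPowerSeries (Fin 2) K)) (evalAt (P : MvPowerSeries (Fin 2) K) φ ψ) := fun P => by
    induction P using MvPolynomial.induction_on with
    | C c =>
      rw [MvPolynomial.coe_C, evalAt_C]; exact IsExpansion.const c
    | add p q hp hq =>
      rw [MvPolynomial.coe_add, map_add, evalAt_add hφ hψ]; exact hp.add hq
    | mul_X p i hp =>
      rw [MvPolynomial.coe_mul, map_mul, evalAt_mul hφ hψ, MvPolynomial.coe_X]
      refine hp.mul ?_
      fin_cases i
      · simpa only [Fin.zero_eta, evalAt_X0 hφ hψ] using hx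
      · simpa only [Fin.mk_one, evalAt_X1 hφ hψ] using hy
  intro n
  obtain ⟨P, hr⟩ := exists_sub_mem_pow n g
  obtain ⟨p, h2, h3⟩ := hP P n
  have h4 := pow_dvd_map_of_mem_pow χ h0 h1 hr
  have h5 := pow_dvd_map_of_mem_pow (evHom φ ψ hφ hψ : _ →+* PowerSeries K) (π := PowerSeries.X)
    (by simpa [evHom_apply, evalAt_X0 hφ hψ] using PowerSeries.X_dvd_iff.2 hφ)
    (by simpa [evHom_apply, evalAt_X1 hφ hψ] using PowerSeries.X_dvd_iff.2 hψ) hr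
  refine ⟨p, ?_, ?_⟩
  · rw [RingHom.coe_coe, evHom_apply, evalAt_sub hφ hψ] at h5
    simpa using dvd_add h5 h2
  · rw [map_sub] at h4
    simpa using dvd_add h4 h3

theorem IsExpansion.self {V : Type*} [CommRing V] (κ : K →+* V) (π : V) :
    IsExpansion κ π π PowerSeries.X := fun n => ⟨Polynomial.X, by simp, by simp⟩

/-- A homomorphism to a discrete valuation ring with residue field `K` gives a parametrization. -/
theorem exists_param_of_hom {V : Type*} [CommRing V] [IsDomain V]
    (χ : MvPowerSeries (Fin 2) K →+* V) {π : V} (hπ0 : π ≠ 0) (hπu : ¬ IsUnit π)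
    (hsep : ∀ v : V, (∀ n : ℕ, π ^ n ∣ v) → v = 0)
    (hres : ∀ v : V, ∃ c : K, π ∣ v - χ (MvPowerSeries.C c)) (hX : χ (MvPowerSeries.X 0) ≠ 0)
    {h : MvPowerSeries (Fin 2) K} (hh : χ h = 0) :
    ∃ φ ψ : PowerSeries K, PowerSeries.constantCoeff φ = 0 ∧ PowerSeries.constantCoeff ψ = 0 ∧
      φ ≠ 0 ∧ evalAt h φ ψ = 0 := by
  have key : ∀ i : Fin 2, ∃ a : PowerSeries K, PowerSeries.constantCoeff a = 0 ∧
      π ∣ χ (MvPowerSeries.X i) ∧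
      IsExpansion (χ.comp MvPowerSeries.C) π (χ (MvPowerSeries.X i)) a := fun i => by
    have hdvd : π ∣ χ (MvPowerSeries.X i) := by
      obtain ⟨c, hc⟩ := hres (χ (MvPowerSeries.X i))
      -- With a nonzero residue c the series `X i - c` would be a unit, yet its image is divisible
      -- by π.
      by_cases h0 : c = 0
      · simpa [h0] using hc
      · rw [← map_sub] at hc
        refine absurd (isUnit_of_dvd_unit hc (IsUnit.map χ ?_)) hπu
        rw [MvPowerSeries.isUnit_iff_constantCoeff]
        simpa using h0
    obtain ⟨v, hv⟩ := hdvd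
    obtain ⟨a, ha⟩ := IsExpansion.exists_expansion (κ := χ.comp MvPowerSeries.C) hres v
    refine ⟨PowerSeries.X * a, by simp, ⟨v, hv⟩, ?_⟩
    rw [hv]
    exact (IsExpansion.self _ _).mul ha
  obtain ⟨φ, hφ, hx0, hx⟩ := key 0
  obtain ⟨ψ, hψ, hy0, hy⟩ := key 1
  refine ⟨φ, ψ, hφ, hψ, ?_, ?_⟩
  · rintro rfl
    exact hX (hx.eq_zero_left hsep)
  · have := isExpansion_evalAt χ hx0 hy0 hφ hψ hx hy h
    rw [hh] at this
    exact this.eq_zero_right hπ0 hπu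

/-! ### Plane germs as finite extensions of K[[x]], and primitive parametrizations -/

/-- A series in `x`, as a series in `x` and `y`. -/
def ofX : PowerSeries K →ₐ[K] MvPowerSeries (Fin 2) K :=
  PowerSeries.substAlgHom (PowerSeries.HasSubst.X (0 : Fin 2))

theorem coeff_ofX (a : PowerSeries K) (e : Fin 2 →₀ ℕ) :
    MvPowerSeries.coeff e (ofX a) = if e 1 = 0 then PowerSeries.coeff (e 0) a else 0 := by
  rw [ofX, PowerSeries.coe_substAlgHom, PowerSeries.coeff_subst_single]
  refine if_congr ⟨fun h => by rw [h]; simp, fun h => ?_⟩ rfl rfl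
  exact expo_ext (by simp) (by simp [h])

theorem ofX_X : ofX (PowerSeries.X : PowerSeries K) = MvPowerSeries.X 0 := by
  rw [ofX, PowerSeries.substAlgHom_X]

theorem ofX_C (c : K) : ofX (PowerSeries.C c) = MvPowerSeries.C c := by
  rw [ofX, PowerSeries.coe_substAlgHom, PowerSeries.subst_C]

theorem eq_sum_ofX {d : ℕ} {r : MvPowerSeries (Fin 2) K}
    (hr : ∀ e : Fin 2 →₀ ℕ, d ≤ e 1 → MvPowerSeries.coeff e r = 0) :
    r = ∑ i ∈ Finset.range d, ofX (PowerSeries.mk fun n => MvPowerSeries.coeff (expo n i) r) *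
      MvPowerSeries.X 1 ^ i := by
  ext e
  rw [map_sum]
  have h1 : ∀ i ∈ Finset.range d, MvPowerSeries.coeff e
      (ofX (PowerSeries.mk fun n => MvPowerSeries.coeff (expo n i) r) * MvPowerSeries.X 1 ^ i) =
      if i = e 1 then MvPowerSeries.coeff e r else 0 := fun i _ => by
    rw [MvPowerSeries.X_pow_eq, MvPowerSeries.coeff_mul_monomial, mul_one, coeff_ofX]
    have h2 : Finsupp.single 1 i ≤ e ↔ i ≤ e 1 := Finsupp.single_le_iff
    rcases lt_trichotomy i (e 1) with h | h | h
    · rw [if_pos (h2.2 h.le), if_neg (by simp; omega), if_neg h.ne]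
    · rw [if_pos (h2.2 h.le), if_pos (by simp [h]), if_pos h, PowerSeries.coeff_mk]
      congr 2
      exact expo_ext (by simp) (by simp [h])
    · rw [if_neg (by rw [h2]; omega), if_neg h.ne']
  rw [Finset.sum_congr rfl h1, Finset.sum_ite_eq']
  split_ifs with h
  · rfl
  · exact hr e (by simpa using h)

theorem X0_prime : Prime (MvPowerSeries.X 0 : MvPowerSeries (Fin 2) K) := by
  have hz : PowerSeries.constantCoeff (0 : PowerSeries K) = 0 := map_zero _
  have hX : PowerSeries.constantCoeff (PowerSeries.X : PowerSeries K) = 0 :=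
    PowerSeries.constantCoeff_X
  refine ⟨fun h => ?_, fun h => ?_, fun a b h => ?_⟩
  · have := congrArg (MvPowerSeries.coeff (Finsupp.single (0 : Fin 2) 1)) h
    simp at this
  · rw [MvPowerSeries.isUnit_iff_constantCoeff] at h; simp at h
  · rw [X0_dvd_iff, evalAt_mul hz hX] at h
    rw [X0_dvd_iff, X0_dvd_iff]
    exact mul_eq_zero.1 h

/-- Every plane curve germ has a parametrization. -/
theorem exists_param [IsAlgClosed K] {h : MvPowerSeries (Fin 2) K} (hu : ¬ IsUnit h) :
    ∃ φ ψ : PowerSeries K, PowerSeries.constantCoeff φ = 0 ∧ PowerSeries.constantCoeff ψ = 0 ∧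
      (φ ≠ 0 ∨ ψ ≠ 0) ∧ evalAt h φ ψ = 0 := by
  by_cases hX : MvPowerSeries.X 0 ∣ h
  · exact ⟨0, PowerSeries.X, map_zero _, PowerSeries.constantCoeff_X, Or.inr PowerSeries.X_ne_zero,
      X0_dvd_iff.1 hX⟩
  have hdisj : Disjoint (Ideal.span {h} : Set (MvPowerSeries (Fin 2) K))
      (Submonoid.powers (MvPowerSeries.X 0 : MvPowerSeries (Fin 2) K)) := by
    rw [Set.disjoint_left]
    rintro _ hx ⟨n, rfl⟩
    rw [SetLike.mem_coe, Ideal.mem_span_singleton] at hx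
    dsimp only at hx
    refine hu ?_
    induction n with
    | zero => exact isUnit_of_dvd_one (by simpa using hx)
    | succ n ih =>
      obtain ⟨c, hc⟩ := hx
      obtain ⟨c', rfl⟩ := (X0_prime.dvd_or_dvd (hc ▸ dvd_pow_self _ (by omega))).resolve_left hX
      refine ih ⟨c', mul_left_cancel₀ X0_prime.ne_zero ?_⟩
      rw [← pow_succ', hc]; ring
  -- P contains h but no power of x. The quotient is therefore a domain into which K[[x]] injects,
  -- and Weierstrass division by h makes it finite over K[[x]], as `exists_dvr` requires.
  obtain ⟨P, hP, hhP, hdP⟩ := Ideal.exists_le_prime_disjoint _ _ hdisj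
  have hhP : h ∈ P := hhP (Ideal.mem_span_singleton_self h)
  have hXP : ∀ n : ℕ, MvPowerSeries.X 0 ^ n ∉ P := fun n hn =>
    Set.disjoint_left.1 hdP hn ⟨n, rfl⟩
  let q : MvPowerSeries (Fin 2) K →+* MvPowerSeries (Fin 2) K ⧸ P := Ideal.Quotient.mk P
  let _ : Algebra (PowerSeries K) (MvPowerSeries (Fin 2) K ⧸ P) :=
    (q.comp (ofX (K := K)).toRingHom).toAlgebra
  have halg : ∀ a : PowerSeries K,
      algebraMap (PowerSeries K) (MvPowerSeries (Fin 2) K ⧸ P) a = q (ofX a) := fun a => rfl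
  have hC : ∀ c : K, algebraMap K (MvPowerSeries (Fin 2) K ⧸ P) c = q (MvPowerSeries.C c) :=
    fun c => rfl
  have : IsScalarTower K (PowerSeries K) (MvPowerSeries (Fin 2) K ⧸ P) :=
    IsScalarTower.of_algebraMap_eq fun c => by
      rw [halg, hC]
      exact congrArg q (ofX_C c).symm
  have hh0 : evalAt h 0 PowerSeries.X ≠ 0 := fun h0 => hX (X0_dvd_iff.2 h0)
  have hfin : Module.Finite (PowerSeries K) (MvPowerSeries (Fin 2) K ⧸ P) := by
    rw [Module.finite_def, Submodule.fg_def]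
    refine ⟨_, ((Finset.range (evalAt h 0 PowerSeries.X).order.toNat).finite_toSet).image
      fun i => q (MvPowerSeries.X 1 ^ i), ?_⟩
    rw [eq_top_iff]
    rintro g -
    obtain ⟨g, rfl⟩ := Ideal.Quotient.mk_surjective g
    obtain ⟨b, r, hg, hr⟩ := exists_weierstrass_div (PowerSeries.coe_toNat_order hh0).symm g
    have h1 : Ideal.Quotient.mk P g = q r := by
      rw [hg, map_add, map_mul, Ideal.Quotient.eq_zero_iff_mem.2 hhP, mul_zero, zero_add]
    rw [h1, eq_sum_ofX hr, map_sum]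
    refine Submodule.sum_mem _ fun i hi => ?_
    rw [map_mul, ← halg, ← Algebra.smul_def]
    exact Submodule.smul_mem _ _ (Submodule.subset_span ⟨i, hi, rfl⟩)
  have hinj : Function.Injective (algebraMap (PowerSeries K) (MvPowerSeries (Fin 2) K ⧸ P)) := by
    rw [injective_iff_map_eq_zero]
    intro a ha
    by_contra h0
    obtain ⟨n, u, hu, rfl⟩ := exists_eq_X_pow_mul_of_ne_zero h0
    rw [halg, Ideal.Quotient.eq_zero_iff_mem, map_mul, map_pow, ofX_X,
      Ideal.mul_unit_mem_iff_mem _ (hu.map ofX)] at ha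
    exact hXP n ha
  obtain ⟨V, _, _, ι, π, hι, h0, hπ, hsep, hres, -⟩ :=
    exists_dvr (MvPowerSeries (Fin 2) K ⧸ P) hinj
  obtain ⟨φ, ψ, h1, h2, h3, h4⟩ := exists_param_of_hom (ι.comp q) h0 hπ hsep hres (h := h)
    (fun h => by
      rw [RingHom.comp_apply, map_eq_zero_iff _ hι, Ideal.Quotient.eq_zero_iff_mem] at h
      exact hXP 1 (by rwa [pow_one]))
    (by rw [RingHom.comp_apply, Ideal.Quotient.eq_zero_iff_mem.2 hhP, map_zero])
  exact ⟨φ, ψ, h1, h2, Or.inl h3, h4⟩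

theorem order_subst {t : PowerSeries K} (ht : PowerSeries.constantCoeff t = 0)
    {a : PowerSeries K} (ha : a ≠ 0) :
    PowerSeries.order (PowerSeries.subst t a) = a.order.toNat • t.order := by
  obtain ⟨u, hu, h⟩ : ∃ u, IsUnit u ∧ a = PowerSeries.X ^ a.order.toNat * u := by
    refine ⟨a.divXPowOrder, ?_, PowerSeries.X_pow_order_mul_divXPowOrder.symm⟩
    rw [PowerSeries.isUnit_iff_constantCoeff, isUnit_iff_ne_zero, Ne,
      PowerSeries.constantCoeff_divXPowOrder_eq_zero_iff]
    exact ha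
  nth_rewrite 1 [h]
  rw [← substHom_apply ht, map_mul, map_pow, substHom_X, PowerSeries.order_mul,
    PowerSeries.order_pow, PowerSeries.order_zero_of_unit (hu.map _), add_zero]

/-- Among all parametrizations choose one with a nonzero coordinate of least possible order. If it
factored through t, orders would be multiplied by ord t, so minimality forces ord t = 1. -/
theorem exists_primitive [IsAlgClosed K] {h : MvPowerSeries (Fin 2) K} (hu : ¬ IsUnit h) :
    ∃ φ ψ : PowerSeries K, IsPrimitiveParametrization h φ ψ := by
  classical
  let Q : ℕ → Prop := fun n => ∃ φ ψ : PowerSeries K, PowerSeries.constantCoeff φ = 0 ∧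
    PowerSeries.constantCoeff ψ = 0 ∧ evalAt h φ ψ = 0 ∧
    ((φ ≠ 0 ∧ φ.order.toNat = n) ∨ (ψ ≠ 0 ∧ ψ.order.toNat = n))
  have hex : ∃ n, Q n := by
    obtain ⟨φ, ψ, h1, h2, h3 | h3, h4⟩ := exists_param hu
    exacts [⟨_, φ, ψ, h1, h2, h4, Or.inl ⟨h3, rfl⟩⟩, ⟨_, φ, ψ, h1, h2, h4, Or.inr ⟨h3, rfl⟩⟩]
  obtain ⟨φ, ψ, h1, h2, h3, h4⟩ := Nat.find_spec hex
  refine ⟨φ, ψ, h1, h2, h4.imp And.left And.left, h3, ?_⟩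
  intro φ₁ ψ₁ t ht hφ hψ
  have hconst : ∀ a : PowerSeries K, PowerSeries.constantCoeff (PowerSeries.subst t a) =
      PowerSeries.constantCoeff a := fun a => by
    have : PowerSeries.X ∣ a - PowerSeries.C (PowerSeries.constantCoeff a) := by
      rw [PowerSeries.X_dvd_iff]; simp
    obtain ⟨b, hb⟩ := this
    rw [sub_eq_iff_eq_add] at hb
    rw [hb, ← substHom_apply ht, map_add, map_mul, substHom_X, substHom_C]
    simp [ht]
  have h5 : PowerSeries.constantCoeff φ₁ = 0 := by rw [← hconst, ← hφ, h1]
  have h6 : PowerSeries.constantCoeff ψ₁ = 0 := by rw [← hconst, ← hψ, h2]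
  have ht0 : t ≠ 0 := by
    rintro rfl
    have : ∀ a : PowerSeries K, PowerSeries.constantCoeff a = 0 → PowerSeries.subst 0 a = 0 :=
      fun a ha => by
        obtain ⟨b, rfl⟩ := PowerSeries.X_dvd_iff.2 ha
        rw [← substHom_apply (map_zero _), map_mul, substHom_X, zero_mul]
    rw [hφ, hψ, this _ h5, this _ h6] at h4
    simp at h4
  have h7 : evalAt h φ₁ ψ₁ = 0 := by
    rw [hφ, hψ, evalAt_subst ht h5 h6] at h3
    exact subst_injective ht ht0 h3
  have hmain : ∀ a : PowerSeries K, PowerSeries.constantCoeff a = 0 →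
      PowerSeries.subst t a ≠ 0 →
      (PowerSeries.order (PowerSeries.subst t a)).toNat ≤ a.order.toNat → t.order = 1 := fun a ha h0 hle => by
    have ha0 : a ≠ 0 := by
      rintro rfl
      rw [← substHom_apply ht, map_zero] at h0; exact h0 rfl
    rw [order_subst ht ha0, ← PowerSeries.coe_toNat_order ht0, nsmul_eq_mul, ← Nat.cast_mul,
      ENat.toNat_natCast] at hle
    have h8 : a.order.toNat ≠ 0 := fun h => by
      have h9 := PowerSeries.coeff_order ha0
      rw [h, PowerSeries.coeff_zero_eq_constantCoeff_apply] at h9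
      exact h9 ha
    have h10 : t.order.toNat ≠ 0 := fun h => by
      have h9 := PowerSeries.coeff_order ht0
      rw [h, PowerSeries.coeff_zero_eq_constantCoeff_apply] at h9
      exact h9 ht
    have h11 : t.order.toNat ≤ 1 := by
      by_contra h12
      have : a.order.toNat * 2 ≤ a.order.toNat * t.order.toNat :=
        Nat.mul_le_mul_left _ (by omega)
      omega
    rw [← PowerSeries.coe_toNat_order ht0, show t.order.toNat = 1 by omega]; rfl
  rcases h4 with ⟨h4, h8⟩ | ⟨h4, h8⟩
  · refine hmain φ₁ h5 (hφ ▸ h4) ?_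
    rw [← hφ, h8]
    refine Nat.find_min' hex ⟨φ₁, ψ₁, h5, h6, h7, Or.inl ⟨?_, rfl⟩⟩
    rintro rfl
    rw [← substHom_apply ht, map_zero] at hφ; exact h4 hφ
  · refine hmain ψ₁ h6 (hψ ▸ h4) ?_
    rw [← hψ, h8]
    refine Nat.find_min' hex ⟨φ₁, ψ₁, h5, h6, h7, Or.inr ⟨?_, rfl⟩⟩
    rintro rfl
    rw [← substHom_apply ht, map_zero] at hψ; exact h4 hψ

end NewtonTree

end

noncomputable section

namespace NewtonTree

variable {K : Type*} [Field K]

/-! ### Initial forms -/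

/-- `P` is the initial form of `F`, of weight `W`, for the weights `(p, q)`. -/
structure IsInit (F : MvPowerSeries (Fin 2) K) (p q W : ℕ) (P : MvPolynomial (Fin 2) K) :
    Prop where
  ne_zero : P ≠ 0
  homog : ∀ d, P.coeff d ≠ 0 → p * d 0 + q * d 1 = W
  lt_of_ne : ∀ d, MvPowerSeries.coeff d (F - (P : MvPowerSeries (Fin 2) K)) ≠ 0 →
    W < p * d 0 + q * d 1

section Subst
variable {τ : Type*}

theorem X_pow_dvd_subst {i : τ} {u v : MvPowerSeries τ K} {p q W : ℕ} (hp : 0 < p) (hq : 0 < q)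
    {F : MvPowerSeries (Fin 2) K}
    (hF : ∀ d, MvPowerSeries.coeff d F ≠ 0 → W ≤ p * d 0 + q * d 1) :
    MvPowerSeries.X i ^ W ∣
      MvPowerSeries.subst ![u * MvPowerSeries.X i ^ p, v * MvPowerSeries.X i ^ q] F := by
  rw [MvPowerSeries.X_pow_dvd_iff]
  intro m hm
  rw [coeff_subst_pair (by simp [hp.ne']) (by simp [hq.ne'])]
  refine finsum_eq_zero_of_forall_eq_zero fun d => ?_
  by_cases hd : MvPowerSeries.coeff d F = 0
  · rw [hd, zero_mul]
  · have h1 : MvPowerSeries.X i ^ W ∣ (u * MvPowerSeries.X i ^ p) ^ d 0 *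
        (v * MvPowerSeries.X i ^ q) ^ d 1 := by
      rw [show (u * MvPowerSeries.X i ^ p) ^ d 0 * (v * MvPowerSeries.X i ^ q) ^ d 1 =
        u ^ d 0 * v ^ d 1 * MvPowerSeries.X i ^ (p * d 0 + q * d 1) by rw [pow_add]; ring]
      exact (pow_dvd_pow _ (hF d hd)).mul_left _
    rw [MvPowerSeries.X_pow_dvd_iff.1 h1 m hm, mul_zero]

theorem aeval_mul_pow {A : Type*} [CommRing A] [Algebra K A] {P : MvPolynomial (Fin 2) K}
    {p q W : ℕ} (hP : ∀ d, P.coeff d ≠ 0 → p * d 0 + q * d 1 = W) (u v t : A) :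
    MvPolynomial.aeval ![u * t ^ p, v * t ^ q] P = t ^ W * MvPolynomial.aeval ![u, v] P := by
  rw [MvPolynomial.aeval_def, MvPolynomial.aeval_def, MvPolynomial.eval₂_eq',
    MvPolynomial.eval₂_eq', Finset.mul_sum]
  refine Finset.sum_congr rfl fun d hd => ?_
  rw [Fin.prod_univ_two, Fin.prod_univ_two, ← hP d (MvPolynomial.mem_support_iff.1 hd), pow_add,
    pow_mul, pow_mul]
  simp only [Matrix.cons_val_zero, Matrix.cons_val_one]
  ring

/-- All terms outside the initial form have larger weight and gain a further factor `X i`. So after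
division by `X i ^ W` only the initial form is visible on `X i = 0`. -/
theorem IsInit.exists_subst {F : MvPowerSeries (Fin 2) K} {p q W : ℕ}
    {P : MvPolynomial (Fin 2) K} (h : IsInit F p q W P) (hp : 0 < p) (hq : 0 < q) (i : τ)
    (u v : MvPowerSeries τ K) : ∃ G,
    MvPowerSeries.subst ![u * MvPowerSeries.X i ^ p, v * MvPowerSeries.X i ^ q] F =
      MvPowerSeries.X i ^ W * (MvPolynomial.aeval ![u, v] P + MvPowerSeries.X i * G) := by
  obtain ⟨G, hG⟩ := X_pow_dvd_subst (i := i) (u := u) (v := v) (W := W + 1) hp hq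
    (fun d hd => h.lt_of_ne d hd)
  refine ⟨G, ?_⟩
  have hs : MvPowerSeries.HasSubst
      ![u * MvPowerSeries.X i ^ p, v * MvPowerSeries.X i ^ q] :=
    hasSubst_pair (by simp [hp.ne']) (by simp [hq.ne'])
  rw [MvPowerSeries.subst_sub hs, sub_eq_iff_eq_add, subst_pair_coe, aeval_mul_pow h.homog] at hG
  rw [hG, pow_succ]; ring

end Subst

theorem IsInit.coeff_eq {F : MvPowerSeries (Fin 2) K} {p q W : ℕ}
    {P : MvPolynomial (Fin 2) K} (h : IsInit F p q W P) {d : Fin 2 →₀ ℕ}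
    (hd : p * d 0 + q * d 1 = W) : MvPowerSeries.coeff d F = P.coeff d := by
  by_contra hne
  refine absurd hd (h.lt_of_ne d ?_).ne'
  rw [map_sub, MvPolynomial.coeff_coe]
  exact sub_ne_zero.2 hne

theorem IsInit.le {F : MvPowerSeries (Fin 2) K} {p q W : ℕ}
    {P : MvPolynomial (Fin 2) K} (h : IsInit F p q W P) {d : Fin 2 →₀ ℕ}
    (hd : MvPowerSeries.coeff d F ≠ 0) : W ≤ p * d 0 + q * d 1 := by
  by_contra hlt
  have h1 : P.coeff d = 0 := by
    by_contra hP
    exact hlt (h.homog d hP).ge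
  refine hlt (h.lt_of_ne d ?_).le
  rw [map_sub, MvPolynomial.coeff_coe, h1, sub_zero]
  exact hd

theorem exists_isInit {F : MvPowerSeries (Fin 2) K} (hF : F ≠ 0) {p q : ℕ} (hp : 0 < p)
    (hq : 0 < q) : ∃ W P, IsInit F p q W P := by
  classical
  have hex : ∃ W : ℕ, ∃ d : Fin 2 →₀ ℕ, MvPowerSeries.coeff d F ≠ 0 ∧ p * d 0 + q * d 1 = W := by
    obtain ⟨d, hd⟩ := MvPowerSeries.ne_zero_iff_exists_coeff_ne_zero F |>.1 hF
    exact ⟨_, d, hd, rfl⟩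
  set W := Nat.find hex
  obtain ⟨d₀, hd₀, hW⟩ := Nat.find_spec hex
  have hmin : ∀ d, MvPowerSeries.coeff d F ≠ 0 → W ≤ p * d 0 + q * d 1 :=
    fun d hd => Nat.find_min' hex ⟨d, hd, rfl⟩
  let s : Finset (Fin 2 →₀ ℕ) :=
    ((Finset.range (W + 1) ×ˢ Finset.range (W + 1)).image fun x => expo x.1 x.2).filter
      fun d => p * d 0 + q * d 1 = W
  have hs : ∀ d, d ∈ s ↔ p * d 0 + q * d 1 = W := fun d => by
    simp only [s, Finset.mem_filter, Finset.mem_image, Finset.mem_product, Finset.mem_range,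
      and_iff_right_iff_imp]
    intro h
    refine ⟨(d 0, d 1), ⟨?_, ?_⟩, (eq_expo d).symm⟩
    · have := Nat.le_mul_of_pos_left (d 0) hp; dsimp only; omega
    · have := Nat.le_mul_of_pos_left (d 1) hq; dsimp only; omega
  let P : MvPolynomial (Fin 2) K :=
    ∑ d ∈ s, MvPolynomial.monomial d (MvPowerSeries.coeff d F)
  have hP : ∀ d, P.coeff d = if p * d 0 + q * d 1 = W then MvPowerSeries.coeff d F else 0 :=
    fun d => by
      simp only [P, MvPolynomial.coeff_sum, MvPolynomial.coeff_monomial, Finset.sum_ite_eq', hs]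
  refine ⟨W, P, ?_, ?_, ?_⟩
  · intro h
    have := hP d₀
    rw [h, if_pos hW, MvPolynomial.coeff_zero] at this
    exact hd₀ this.symm
  · intro d hd
    by_contra h
    rw [hP, if_neg h] at hd
    exact hd rfl
  · intro d hd
    rw [map_sub, MvPolynomial.coeff_coe, hP] at hd
    split_ifs at hd with h
    · exact absurd (sub_self _) hd
    · rw [sub_zero] at hd
      exact lt_of_le_of_ne (hmin d hd) (Ne.symm h)

/-! ### Branches and their initial forms -/

/-- If a does not vanish on the curve then b does, so F divides b and a is a unit. This replaces
irreducibility in all later arguments on strict transforms. -/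
theorem IsBranch.isUnit_of_mul {F : MvPowerSeries (Fin 2) K} {φ ψ : PowerSeries K}
    (hF : IsBranch F φ ψ) {a b : MvPowerSeries (Fin 2) K} (hab : F = a * b)
    (ha : evalAt a φ ψ ≠ 0) : IsUnit a := by
  have hφ := hF.param.constantCoeff_fst
  have hψ := hF.param.constantCoeff_snd
  have h1 := hF.param.eval_eq_zero
  rw [hab, evalAt_mul hφ hψ] at h1
  obtain ⟨c, hc⟩ := (hF.ker b).1 ((mul_eq_zero.1 h1).resolve_left ha)
  refine IsUnit.of_mul_eq_one c (mul_left_cancel₀ hF.ne_zero ?_)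
  rw [mul_one]
  calc F * (a * c) = a * (F * c) := by ring
    _ = F := by rw [← hc, ← hab]

theorem not_isUnit_of_constantCoeff {G : MvPowerSeries (Fin 2) K}
    (h : MvPowerSeries.constantCoeff G = 0) : ¬ IsUnit G := by
  rw [MvPowerSeries.isUnit_iff_constantCoeff, h]; simp

theorem IsBranch.not_dvd {F : MvPowerSeries (Fin 2) K} {φ ψ : PowerSeries K}
    (hF : IsBranch F φ ψ) {G : MvPowerSeries (Fin 2) K} (hG : ¬ IsUnit G)
    (h : evalAt G φ ψ ≠ 0) : ¬ G ∣ F := fun ⟨_, hc⟩ => hG (hF.isUnit_of_mul hc h)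

theorem IsBranch.not_isUnit {F : MvPowerSeries (Fin 2) K} {φ ψ : PowerSeries K}
    (hF : IsBranch F φ ψ) : ¬ IsUnit F := fun h => by
  have h1 := evalAt_isUnit hF.param.constantCoeff_fst hF.param.constantCoeff_snd h
  rw [hF.param.eval_eq_zero] at h1
  exact not_isUnit_zero h1

theorem IsBranch.order_comm {F G : MvPowerSeries (Fin 2) K} {φ ψ φ' ψ' : PowerSeries K}
    (hF : IsBranch F φ ψ) (hG : IsBranch G φ' ψ') (h : evalAt G φ ψ ≠ 0) :
    (evalAt G φ ψ).order = (evalAt F φ' ψ').order :=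
  hF.order_evalAt_comm hG (fun h' => h ((hF.ker G).2 h')) (hF.not_dvd hG.not_isUnit h)

/-- A substitution of order o multiplies all orders by o, so coprimality of the orders of the
nonzero coordinates is enough. -/
theorem primitive_of_order {F : MvPowerSeries (Fin 2) K} {φ ψ : PowerSeries K}
    (hφ : PowerSeries.constantCoeff φ = 0) (hψ : PowerSeries.constantCoeff ψ = 0)
    (hne : φ ≠ 0 ∨ ψ ≠ 0) (hF : evalAt F φ ψ = 0)
    (hord : ∀ o : ℕ, (φ ≠ 0 → o ∣ φ.order.toNat) → (ψ ≠ 0 → o ∣ ψ.order.toNat) → o = 1) :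
    IsPrimitiveParametrization F φ ψ := by
  refine ⟨hφ, hψ, hne, hF, fun φ₁ ψ₁ t ht h1 h2 => ?_⟩
  have key : ∀ a b : PowerSeries K, a = PowerSeries.subst t b → a ≠ 0 →
      t.order.toNat ∣ a.order.toNat := fun a b hab ha => by
    have hb : b ≠ 0 := by
      rintro rfl
      rw [← substHom_apply ht, map_zero] at hab; exact ha hab
    have : a.order = b.order.toNat • t.order := by rw [hab]; exact order_subst ht hb
    rw [this, nsmul_eq_mul, ENat.toNat_mul, ENat.toNat_natCast]
    exact dvd_mul_left _ _
  have h3 := hord t.order.toNat (key φ φ₁ h1) (key ψ ψ₁ h2)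
  have h4 : t ≠ 0 := by
    rintro rfl
    rw [PowerSeries.order_zero, ENat.toNat_top] at h3
    exact absurd h3 (by simp)
  rw [← PowerSeries.coe_toNat_order h4, h3]; rfl

theorem isBranch_X0 : IsBranch (MvPowerSeries.X 0 : MvPowerSeries (Fin 2) K) 0 PowerSeries.X := by
  have hz : PowerSeries.constantCoeff (0 : PowerSeries K) = 0 := map_zero _
  have hX : PowerSeries.constantCoeff (PowerSeries.X : PowerSeries K) = 0 :=
    PowerSeries.constantCoeff_X
  refine ⟨primitive_of_order hz hX (Or.inr PowerSeries.X_ne_zero) (evalAt_X0 hz hX)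
    fun o _ h => ?_, fun g => X0_dvd_iff.symm, X0_prime.ne_zero⟩
  have := h PowerSeries.X_ne_zero
  rw [PowerSeries.order_X, ENat.toNat_one] at this
  exact Nat.dvd_one.1 this

theorem isBranch_X1 : IsBranch (MvPowerSeries.X 1 : MvPowerSeries (Fin 2) K) PowerSeries.X 0 := by
  have hz : PowerSeries.constantCoeff (0 : PowerSeries K) = 0 := map_zero _
  have hX : PowerSeries.constantCoeff (PowerSeries.X : PowerSeries K) = 0 :=
    PowerSeries.constantCoeff_X
  refine ⟨primitive_of_order hX hz (Or.inl PowerSeries.X_ne_zero) (evalAt_X1 hX hz)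
    fun o h _ => ?_, fun g => X1_dvd_iff.symm, fun h => ?_⟩
  · have := h PowerSeries.X_ne_zero
    rw [PowerSeries.order_X, ENat.toNat_one] at this
    exact Nat.dvd_one.1 this
  · have := congrArg (MvPowerSeries.coeff (Finsupp.single (1 : Fin 2) 1)) h
    simp at this

/-- The binomial `x ^ q - μ * y ^ p`, as a power series. -/
def binom (p q : ℕ) (μ : K) : MvPowerSeries (Fin 2) K :=
  MvPowerSeries.X 0 ^ q - MvPowerSeries.C μ * MvPowerSeries.X 1 ^ p

theorem evalAt_binom {φ ψ : PowerSeries K} (hφ : PowerSeries.constantCoeff φ = 0)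
    (hψ : PowerSeries.constantCoeff ψ = 0) (p q : ℕ) (μ : K) :
    evalAt (binom p q μ) φ ψ = φ ^ q - PowerSeries.C μ * ψ ^ p := by
  rw [binom, evalAt_sub hφ hψ, evalAt_mul hφ hψ, evalAt_pow hφ hψ, evalAt_pow hφ hψ, evalAt_C,
    evalAt_X0 hφ hψ, evalAt_X1 hφ hψ]

theorem IsBranch.order_evalAt_zero_X {F : MvPowerSeries (Fin 2) K} {φ ψ : PowerSeries K}
    (hF : IsBranch F φ ψ) (h : φ ≠ 0) : (evalAt F 0 PowerSeries.X).order = φ.order := by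
  have h0 := evalAt_X0 hF.param.constantCoeff_fst hF.param.constantCoeff_snd
  rw [← hF.order_comm isBranch_X0 (by rwa [h0]), h0]

theorem IsBranch.order_evalAt_X_zero {F : MvPowerSeries (Fin 2) K} {φ ψ : PowerSeries K}
    (hF : IsBranch F φ ψ) (h : ψ ≠ 0) : (evalAt F PowerSeries.X 0).order = ψ.order := by
  have h0 := evalAt_X1 hF.param.constantCoeff_fst hF.param.constantCoeff_snd
  rw [← hF.order_comm isBranch_X1 (by rwa [h0]), h0]

/-- A series vanishing on a primitive parametrization and with the right intersection number with
`x = 0` generates the ideal of series vanishing on it. -/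
theorem IsPrimitiveParametrization.isBranch_of_order {G : MvPowerSeries (Fin 2) K}
    {φ ψ : PowerSeries K} (hp : IsPrimitiveParametrization G φ ψ) (hφ0 : φ ≠ 0)
    (hord : (evalAt G 0 PowerSeries.X).order = φ.order) : IsBranch G φ ψ := by
  have hφ := hp.constantCoeff_fst
  have hψ := hp.constantCoeff_snd
  have hz : PowerSeries.constantCoeff (0 : PowerSeries K) = 0 := map_zero _
  have hX : PowerSeries.constantCoeff (PowerSeries.X : PowerSeries K) = 0 :=
    PowerSeries.constantCoeff_X
  have hfin : φ.order ≠ ⊤ := by rwa [Ne, PowerSeries.order_eq_top]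
  have hG0 : G ≠ 0 := by
    rintro rfl
    rw [evalAt_zero hz hX, PowerSeries.order_zero] at hord
    exact hfin hord.symm
  -- Write G = F c with F a generator of the kernel. By symmetry with the branch x = 0, F(0,y) has
  -- order ord φ, the same as G(0,y); so c(0,y) has order 0 and c is a unit.
  obtain ⟨F, hF⟩ := exists_kernel_generator hφ hψ hφ0 hG0 hp.eval_eq_zero
  obtain ⟨c, hc⟩ := (hF G).1 hp.eval_eq_zero
  have hF0 : F ≠ 0 := by rintro rfl; rw [zero_mul] at hc; exact hG0 hc
  have hFb : IsBranch F φ ψ := ⟨⟨hφ, hψ, hp.ne_zero, (hF F).2 dvd_rfl, hp.primitive⟩, hF, hF0⟩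
  have h1 := hFb.order_evalAt_zero_X hφ0
  rw [hc, evalAt_mul hz hX, PowerSeries.order_mul, h1] at hord
  have h2 : (evalAt c 0 PowerSeries.X).order = 0 := by
    have : φ.order + (evalAt c 0 PowerSeries.X).order = φ.order + 0 := by rw [hord, add_zero]
    exact ENat.add_right_injective_of_ne_top hfin this
  have hcu : IsUnit c := by
    rw [MvPowerSeries.isUnit_iff_constantCoeff, isUnit_iff_ne_zero, ← constantCoeff_evalAt hz hX]
    intro h3
    exact PowerSeries.order_ne_zero_iff_constCoeff_eq_zero.2 h3 h2
  refine ⟨hp, fun g => ?_, hG0⟩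
  rw [hF g, hc, hcu.mul_right_dvd]

theorem order_eq_of_eq_X_pow_mul {n : ℕ} {a b : PowerSeries K}
    (h : a = PowerSeries.X ^ n * b) (hb : PowerSeries.constantCoeff b ≠ 0) : a.order = n := by
  rw [h, PowerSeries.order_mul, PowerSeries.order_X_pow, PowerSeries.order_zero_of_unit, add_zero]
  rw [PowerSeries.isUnit_iff_constantCoeff]; exact isUnit_iff_ne_zero.2 hb

theorem exists_of_order_eq {n : ℕ} {a : PowerSeries K} (h : a.order = n) :
    ∃ u : PowerSeries K, a = u * PowerSeries.X ^ n ∧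
      PowerSeries.constantCoeff u = PowerSeries.coeff n a ∧ PowerSeries.coeff n a ≠ 0 := by
  obtain ⟨u, hu⟩ := X_pow_dvd_of_le_order h.ge
  refine ⟨u, by rw [hu, mul_comm], ?_, (PowerSeries.order_eq_nat.1 h).1⟩
  rw [hu, PowerSeries.coeff_X_pow_mul', if_pos le_rfl, Nat.sub_self,
    PowerSeries.coeff_zero_eq_constantCoeff_apply]

/-- The monomial curves `(c * t ^ p, t ^ q)`. -/
theorem isBranch_binom {p q : ℕ} (hp : 0 < p) (hq : 0 < q) (hpq : p.Coprime q) {c : K}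
    (hc : c ≠ 0) : IsBranch (binom p q (c ^ q)) (PowerSeries.C c * PowerSeries.X ^ p)
      (PowerSeries.X ^ q) := by
  have hz : PowerSeries.constantCoeff (0 : PowerSeries K) = 0 := map_zero _
  have hX : PowerSeries.constantCoeff (PowerSeries.X : PowerSeries K) = 0 :=
    PowerSeries.constantCoeff_X
  have h1 : PowerSeries.constantCoeff (PowerSeries.C c * PowerSeries.X ^ p) = 0 := by
    simp [hp.ne']
  have h2 : PowerSeries.constantCoeff (PowerSeries.X ^ q : PowerSeries K) = 0 := by simp [hq.ne']
  have hC : (PowerSeries.C c : PowerSeries K) ≠ 0 := by simpa using hc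
  have h3 : (PowerSeries.C c * PowerSeries.X ^ p).order = (p : ℕ∞) :=
    order_eq_of_eq_X_pow_mul (mul_comm _ _) (b := PowerSeries.C c) (by simpa using hc)
  have h4 : (PowerSeries.X ^ q : PowerSeries K) ≠ 0 := pow_ne_zero _ PowerSeries.X_ne_zero
  have h5 : PowerSeries.C c * PowerSeries.X ^ p ≠ 0 :=
    mul_ne_zero hC (pow_ne_zero _ PowerSeries.X_ne_zero)
  refine IsPrimitiveParametrization.isBranch_of_order
    (primitive_of_order h1 h2 (Or.inr h4) ?_ fun o ho ho' => ?_) h5 ?_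
  · rw [evalAt_binom h1 h2, map_pow]; ring
  · have h6 := ho h5
    have h7 := ho' h4
    rw [h3, ENat.toNat_natCast] at h6
    rw [PowerSeries.order_X_pow, ENat.toNat_natCast] at h7
    exact Nat.eq_one_of_dvd_coprimes hpq h6 h7
  · rw [evalAt_binom hz hX, zero_pow hq.ne', h3]
    refine order_eq_of_eq_X_pow_mul (b := PowerSeries.C (-(c ^ q))) ?_ ?_
    · rw [map_neg]; ring
    · simpa using fun h => absurd h hc

end NewtonTree

end

/-! ### The initial form of a branch -/

noncomputable section

namespace NewtonTree

variable {K : Type*} [Field K]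

theorem IsInit.scale {F : MvPowerSeries (Fin 2) K} {p q W : ℕ}
    {P : MvPolynomial (Fin 2) K} (h : IsInit F p q W P) {k : ℕ} (hk : 0 < k) :
    IsInit F (k * p) (k * q) (k * W) P where
  ne_zero := h.ne_zero
  homog d hd := by rw [← h.homog d hd]; ring
  lt_of_ne d hd := by
    have := Nat.mul_lt_mul_of_pos_left (h.lt_of_ne d hd) hk
    calc k * W < k * (p * d 0 + q * d 1) := this
      _ = _ := by ring

theorem constantCoeff_aeval {τ : Type*} (u v : MvPowerSeries τ K) (P : MvPolynomial (Fin 2) K) :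
    MvPowerSeries.constantCoeff (MvPolynomial.aeval ![u, v] P) =
      MvPolynomial.eval ![MvPowerSeries.constantCoeff u, MvPowerSeries.constantCoeff v] P := by
  rw [MvPolynomial.aeval_def, MvPolynomial.hom_eval₂, MvPolynomial.eval]
  congr 1
  funext i; fin_cases i <;> rfl

/-- The quotient by t^(kW) has as constant term the initial form at the leading coefficients of φ
and ψ; the order is kW exactly when that value is nonzero. -/
theorem IsInit.exists_evalAt {F : MvPowerSeries (Fin 2) K} {p q W : ℕ}
    {P : MvPolynomial (Fin 2) K} (h : IsInit F p q W P) (hp : 0 < p) (hq : 0 < q) {k : ℕ}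
    (hk : 0 < k) {φ ψ : PowerSeries K} (hφ : φ.order = (k * p : ℕ)) (hψ : ψ.order = (k * q : ℕ)) :
    ∃ G : PowerSeries K, evalAt F φ ψ = PowerSeries.X ^ (k * W) * G ∧
      PowerSeries.constantCoeff G =
        MvPolynomial.eval ![PowerSeries.coeff (k * p) φ, PowerSeries.coeff (k * q) ψ] P := by
  obtain ⟨u, hu, hu', -⟩ := exists_of_order_eq hφ
  obtain ⟨v, hv, hv', -⟩ := exists_of_order_eq hψ
  obtain ⟨G, hG⟩ := (h.scale hk).exists_subst (Nat.mul_pos hk hp) (Nat.mul_pos hk hq) () u v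
  refine ⟨MvPolynomial.aeval ![u, v] P + PowerSeries.X * G, ?_, ?_⟩
  · nth_rewrite 1 [hu, hv]
    exact hG
  · rw [← hu', ← hv']
    have h1 := constantCoeff_aeval u v P
    have h2 : PowerSeries.constantCoeff (MvPolynomial.aeval ![u, v] P : PowerSeries K) =
      MvPolynomial.eval ![PowerSeries.constantCoeff u, PowerSeries.constantCoeff v] P := h1
    rw [map_add, h2]
    simp

/-- The binomial `x ^ q - μ * y ^ p`. -/
def binomP (p q : ℕ) (μ : K) : MvPolynomial (Fin 2) K :=
  MvPolynomial.X 0 ^ q - MvPolynomial.C μ * MvPolynomial.X 1 ^ p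

theorem eval_binomP (p q : ℕ) (μ a b : K) :
    MvPolynomial.eval ![a, b] (binomP p q μ) = a ^ q - μ * b ^ p := by
  simp [binomP]

theorem order_evalAt_binom {p q : ℕ} {k : ℕ} {φ ψ : PowerSeries K}
    (hφc : PowerSeries.constantCoeff φ = 0) (hψc : PowerSeries.constantCoeff ψ = 0)
    (hφ : φ.order = (k * p : ℕ)) (hψ : ψ.order = (k * q : ℕ)) {μ : K}
    (hμ : PowerSeries.coeff (k * p) φ ^ q - μ * PowerSeries.coeff (k * q) ψ ^ p ≠ 0) :
    (evalAt (binom p q μ) φ ψ).order = (k * (p * q) : ℕ) := by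
  obtain ⟨u, hu, hu', -⟩ := exists_of_order_eq hφ
  obtain ⟨v, hv, hv', -⟩ := exists_of_order_eq hψ
  rw [evalAt_binom hφc hψc]
  refine order_eq_of_eq_X_pow_mul (b := u ^ q - PowerSeries.C μ * v ^ p) ?_ ?_
  · nth_rewrite 1 [hu, hv]; ring
  · rw [← hu', ← hv'] at hμ
    simpa using hμ

/-- A polynomial over an algebraically closed field with a single root. -/
theorem eq_C_mul_pow_of_roots [IsAlgClosed K] {A : Polynomial K} {k : ℕ} (hk : A.natDegree = k)
    {μ : K} (h : ∀ z ∈ A.roots, z = μ) :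
    A = Polynomial.C A.leadingCoeff * (Polynomial.X - Polynomial.C μ) ^ k := by
  have hs := IsAlgClosed.splits A
  have hcard : A.roots = Multiset.replicate k μ := by
    rw [Multiset.eq_replicate]
    exact ⟨by rw [← hk]; exact (hs.natDegree_eq_card_roots).symm, h⟩
  conv_lhs => rw [hs.eq_prod_roots, hcard]
  simp

/-- Since p and q are coprime, P is a polynomial A of degree k in the one ratio z = x^q / y^p. The
end coefficients are nonzero, every root of A is nonzero and of the form c^q, and therefore equals
μ; so A is a multiple of (z - μ)^k. -/
theorem eq_pow_of_homogeneous [IsAlgClosed K] {p q k : ℕ} (hp : 0 < p) (hq : 0 < q)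
    (hpq : p.Coprime q) {P : MvPolynomial (Fin 2) K}
    (hP : ∀ d, P.coeff d ≠ 0 → p * d 0 + q * d 1 = k * (p * q)) {μ : K}
    (h0 : P.coeff (expo 0 (k * p)) ≠ 0) (h1 : P.coeff (expo (k * q) 0) ≠ 0)
    (hroots : ∀ c : K, c ≠ 0 → MvPolynomial.eval ![c, 1] P = 0 → c ^ q = μ) :
    ∃ c : K, c ≠ 0 ∧ P = MvPolynomial.C c * binomP p q μ ^ k := by
  classical
  let a : ℕ → K := fun j => P.coeff (expo (q * j) (p * (k - j)))
  have hPsum : P = ∑ j ∈ Finset.range (k + 1), MvPolynomial.C (a j) *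
      ((MvPolynomial.X 0 ^ q) ^ j * (MvPolynomial.X 1 ^ p) ^ (k - j)) := by
    ext d
    have hmon : ∀ j, MvPolynomial.C (a j) * ((MvPolynomial.X 0 ^ q) ^ j *
        (MvPolynomial.X 1 ^ p) ^ (k - j)) =
        MvPolynomial.monomial (expo (q * j) (p * (k - j))) (a j) := fun j => by
      rw [← pow_mul, ← pow_mul, MvPolynomial.X_pow_eq_monomial, MvPolynomial.X_pow_eq_monomial,
        MvPolynomial.monomial_mul, MvPolynomial.C_mul_monomial, mul_one, mul_one]; rfl
    simp only [hmon, MvPolynomial.coeff_sum, MvPolynomial.coeff_monomial]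
    by_cases hd : P.coeff d = 0
    · rw [hd, eq_comm]
      refine Finset.sum_eq_zero fun j _ => ?_
      split_ifs with h
      · simp only [a]; rw [h, hd]
      · rfl
    · have h2 := hP d hd
      obtain ⟨j, hj⟩ : q ∣ d 0 := by
        refine (Nat.Coprime.dvd_of_dvd_mul_left hpq.symm (n := d 0) (m := p) ?_)
        rw [← Nat.dvd_add_left (dvd_mul_right q (d 1)), h2]
        exact (dvd_mul_left q p).mul_left k
      have h3 : p * j + d 1 = k * p := by
        refine Nat.eq_of_mul_eq_mul_left hq ?_
        rw [hj] at h2; nlinarith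
      have hjk : j ≤ k := by
        by_contra h
        have := Nat.mul_le_mul_left p (show k + 1 ≤ j by omega)
        nlinarith
      have h4 : d 1 = p * (k - j) := by
        obtain ⟨i, rfl⟩ := Nat.exists_eq_add_of_le hjk
        rw [Nat.add_sub_cancel_left]; nlinarith
      have h5 : d = expo (q * j) (p * (k - j)) := expo_ext (by simpa using hj) (by simpa using h4)
      rw [Finset.sum_eq_single_of_mem j (by simp; omega)]
      · rw [if_pos h5.symm, h5]
      · intro i _ hij
        rw [if_neg]
        intro h
        have h6 := congrArg (fun e : Fin 2 →₀ ℕ => e 0) (h.trans h5)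
        simp only [expo_zero] at h6
        exact hij (Nat.eq_of_mul_eq_mul_left hq h6)
  let A : Polynomial K := ∑ j ∈ Finset.range (k + 1), Polynomial.C (a j) * Polynomial.X ^ j
  have hAco : ∀ j, j ≤ k → A.coeff j = a j := fun j hj => by
    simp only [A, Polynomial.finsetSum_coeff, Polynomial.coeff_C_mul_X_pow]
    rw [Finset.sum_ite_eq, if_pos (by simp; omega)]
  have hak : a k ≠ 0 := by simpa [a, mul_comm] using h1
  have ha0 : a 0 ≠ 0 := by simpa [a, mul_comm] using h0
  have hAdeg : A.natDegree = k := by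
    refine le_antisymm ?_ (Polynomial.le_natDegree_of_ne_zero (by rwa [hAco k le_rfl]))
    refine Polynomial.natDegree_sum_le_of_forall_le _ _ fun j hj => ?_
    exact (Polynomial.natDegree_C_mul_X_pow_le _ _).trans (by simp at hj; omega)
  have hA0 : A ≠ 0 := by
    intro h
    rw [← hAco k le_rfl, h] at hak; simp at hak
  have hAroots : ∀ z ∈ A.roots, z = μ := fun z hz => by
    have hz0 : A.eval z = 0 := (Polynomial.mem_roots hA0).1 hz
    obtain ⟨c, hc⟩ := IsAlgClosed.exists_pow_nat_eq z hq
    have hzne : z ≠ 0 := by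
      rintro rfl
      rw [← Polynomial.coeff_zero_eq_eval_zero, hAco 0 (Nat.zero_le _)] at hz0
      exact ha0 hz0
    have hcne : c ≠ 0 := by rintro rfl; rw [zero_pow hq.ne'] at hc; exact hzne hc.symm
    rw [← hc]
    refine hroots c hcne ?_
    rw [← hz0, ← hc, hPsum]
    simp [A, Polynomial.eval_finsetSum]
  have hA := eq_C_mul_pow_of_roots hAdeg hAroots
  set c := A.leadingCoeff
  refine ⟨c, Polynomial.leadingCoeff_ne_zero.2 hA0, ?_⟩
  rw [binomP, sub_eq_add_neg, add_pow, hPsum, Finset.mul_sum]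
  refine Finset.sum_congr rfl fun j hj => ?_
  have hj' : j ≤ k := by simp at hj; omega
  rw [← hAco j hj', hA, Polynomial.coeff_C_mul, sub_eq_add_neg, ← Polynomial.C_neg,
    Polynomial.coeff_X_add_C_pow, ← neg_mul, ← map_neg, mul_pow]
  simp only [map_mul, map_pow, map_natCast]
  ring

variable [IsAlgClosed K]

/-- The Newton polygon of a branch is a segment and its face polynomial is a power of a binomial. -/
theorem IsBranch.exists_isInit {F : MvPowerSeries (Fin 2) K} {φ ψ : PowerSeries K}
    (hF : IsBranch F φ ψ) {p q k : ℕ} (hp : 0 < p) (hq : 0 < q)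
    (hpq : p.Coprime q) (hφo : φ.order = (k * p : ℕ)) (hψo : ψ.order = (k * q : ℕ)) {μ : K}
    (hμ : PowerSeries.coeff (k * p) φ ^ q = μ * PowerSeries.coeff (k * q) ψ ^ p) :
    ∃ c : K, c ≠ 0 ∧ IsInit F p q (k * (p * q)) (MvPolynomial.C c * binomP p q μ ^ k) := by
  classical
  have hφ := hF.param.constantCoeff_fst
  have hψ := hF.param.constantCoeff_snd
  obtain ⟨-, -, -, hlφ⟩ := exists_of_order_eq hφo
  obtain ⟨-, -, -, hlψ⟩ := exists_of_order_eq hψo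
  have hφ0 : φ ≠ 0 := by rintro rfl; simp at hlφ
  have hψ0 : ψ ≠ 0 := by rintro rfl; simp at hlψ
  obtain ⟨W, P, hP⟩ := NewtonTree.exists_isInit hF.ne_zero hp hq
  -- By symmetry the order of F on a monomial curve is the order of its binomial on (φ,ψ), where the
  -- leading terms do not cancel because c^q ≠ μ.
  have hmon : ∀ c : K, c ≠ 0 → c ^ q ≠ μ →
      (evalAt F (PowerSeries.C c * PowerSeries.X ^ p) (PowerSeries.X ^ q)).order =
        (k * (p * q) : ℕ) := fun c hc hcμ => by
    have h1 := order_evalAt_binom hφ hψ hφo hψo (μ := c ^ q) (by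
      rw [hμ, ← sub_mul]
      exact mul_ne_zero (sub_ne_zero.2 (Ne.symm hcμ)) (pow_ne_zero _ hlψ))
    rw [← hF.order_comm (isBranch_binom hp hq hpq hc), h1]
    intro h
    rw [h, PowerSeries.order_zero] at h1
    exact ENat.natCast_ne_top _ h1.symm
  have hinit : ∀ c : K, c ≠ 0 → ∃ G : PowerSeries K,
      evalAt F (PowerSeries.C c * PowerSeries.X ^ p) (PowerSeries.X ^ q) =
        PowerSeries.X ^ W * G ∧ PowerSeries.constantCoeff G = MvPolynomial.eval ![c, 1] P :=
    fun c hc => by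
      obtain ⟨G, h1, h2⟩ := hP.exists_evalAt hp hq one_pos
        (φ := PowerSeries.C c * PowerSeries.X ^ p) (ψ := PowerSeries.X ^ q)
        (by rw [one_mul]; exact order_eq_of_eq_X_pow_mul (mul_comm _ _) (by simpa using hc))
        (by rw [one_mul, PowerSeries.order_X_pow])
      refine ⟨G, by rwa [one_mul] at h1, ?_⟩
      rw [h2]
      simp [PowerSeries.coeff_X_pow]
  -- By quasi-homogeneity P(z,1) is a nonzero polynomial. A nonzero c with c^q ≠ μ and P(c,1) ≠ 0
  -- exists as K is infinite; for it the order of F on the monomial curve is both W and kpq.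
  have hW : W = k * (p * q) := by
    let B : Polynomial K := MvPolynomial.aeval ![Polynomial.X, 1] P
    have hBeval : ∀ c, B.eval c = MvPolynomial.eval ![c, 1] P := fun c => by
      simp only [B, MvPolynomial.aeval_def]
      rw [← Polynomial.coe_evalRingHom, MvPolynomial.hom_eval₂, MvPolynomial.eval]
      congr 1
      · ext x; simp
      · funext i; fin_cases i <;> simp
    have hB0 : B ≠ 0 := by
      obtain ⟨d, hd⟩ := MvPolynomial.ne_zero_iff.1 hP.ne_zero
      intro h
      refine hd ?_
      have h2 : B.coeff (d 0) = P.coeff d := by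
        simp only [B, MvPolynomial.aeval_def, MvPolynomial.eval₂_eq', Fin.prod_univ_two]
        rw [Polynomial.finsetSum_coeff, Finset.sum_eq_single d]
        · simp
        · intro e he hed
          have he' := hP.homog e (MvPolynomial.mem_support_iff.1 he)
          have hd' := hP.homog d hd
          have h3 : d 0 ≠ e 0 := fun h3 => hed (expo_ext h3.symm (by
            rw [h3] at hd'
            exact Nat.eq_of_mul_eq_mul_left hq (by omega)))
          simp [h3, Polynomial.coeff_X_pow]
        · intro h; simpa using h
      rw [← h2, h, Polynomial.coeff_zero]
    obtain ⟨c, hc⟩ := ((Polynomial.X * (Polynomial.X ^ q - Polynomial.C μ) * B).rootSet_finite K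
      ).infinite_compl.nonempty
    have hne : Polynomial.X * (Polynomial.X ^ q - Polynomial.C μ) * B ≠ 0 :=
      mul_ne_zero (mul_ne_zero Polynomial.X_ne_zero (Polynomial.X_pow_sub_C_ne_zero hq μ)) hB0
    rw [Set.mem_compl_iff, Polynomial.mem_rootSet_of_ne hne, Polynomial.coe_aeval_eq_eval,
      Polynomial.eval_mul, Polynomial.eval_mul, mul_eq_zero, mul_eq_zero, not_or, not_or] at hc
    obtain ⟨⟨hc0, hc1⟩, hc2⟩ := hc
    simp only [Polynomial.eval_X, Polynomial.eval_sub, Polynomial.eval_pow, Polynomial.eval_C,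
      sub_eq_zero] at hc0 hc1
    obtain ⟨G, h1, h2⟩ := hinit c hc0
    have h3 := hmon c hc0 hc1
    rw [order_eq_of_eq_X_pow_mul h1 (by rw [h2, ← hBeval]; exact hc2)] at h3
    exact_mod_cast h3
  subst hW
  obtain ⟨c, hc, hPc⟩ := eq_pow_of_homogeneous hp hq hpq hP.homog (μ := μ) (by
      rw [← hP.coeff_eq (by simp; ring), ← coeff_evalAt_zero_X]
      have h1 := hF.order_evalAt_zero_X hφ0
      rw [hφo] at h1
      exact (PowerSeries.order_eq_nat.1 h1).1) (by
      rw [← hP.coeff_eq (by simp; ring), ← coeff_evalAt_X_zero]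
      have h1 := hF.order_evalAt_X_zero hψ0
      rw [hψo] at h1
      exact (PowerSeries.order_eq_nat.1 h1).1) (by
      -- If P(c,1) = 0 the order on the monomial curve exceeds kpq, which is impossible when c^q ≠
      -- μ.
      intro c hc h0
      by_contra hcμ
      obtain ⟨G, h1, h2⟩ := hinit c hc
      have h3 := hmon c hc hcμ
      rw [h0] at h2
      obtain ⟨G', rfl⟩ := PowerSeries.X_dvd_iff.2 h2
      have h4 := le_order_of_X_pow_dvd (n := k * (p * q) + 1) (a := _)
        ⟨G', h1.trans (by ring)⟩
      rw [h3] at h4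
      have h5 : k * (p * q) + 1 ≤ k * (p * q) := by exact_mod_cast h4
      omega)
  exact ⟨c, hc, hPc ▸ hP⟩

end NewtonTree

end

noncomputable section

namespace NewtonTree

variable {K : Type*} [Field K]

/-! ### Hamburger-Noether maps -/

/-- The matrix of the monomial map has determinant ±1: a Euclidean step adds a multiple of one row
to the other and preserves the determinant. -/
theorem hnExp_spec (p q : ℕ) (h : p.Coprime q) :
    p * (hnExp p q).2 = q * (hnExp p q).1 + 1 ∨ q * (hnExp p q).1 = p * (hnExp p q).2 + 1 := by
  induction p, q using hnExp.induct with
  | case1 p =>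
    rw [hnExp, if_pos rfl]
    rw [Nat.coprime_zero_right] at h
    simp [h]
  | case2 q hq =>
    rw [hnExp, if_neg hq, if_pos rfl]
    rw [Nat.coprime_zero_left] at h
    simp [h]
  | case3 p q hq hp hqp ih =>
    rw [hnExp, if_neg hq, if_neg hp, if_pos hqp]
    have h1 := Nat.mod_add_div p q
    have h2 : (p % q).Coprime q := by
      rwa [Nat.Coprime, ← Nat.gcd_rec, Nat.gcd_comm]
    rcases ih h2 with h3 | h3
    · left; linear_combination h3 - (hnExp (p % q) q).2 * h1
    · right; linear_combination h3 + (hnExp (p % q) q).2 * h1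
  | case4 p q hq hp hqp ih =>
    rw [hnExp, if_neg hq, if_neg hp, if_neg hqp]
    have h1 := Nat.mod_add_div q p
    have h2 : p.Coprime (q % p) := by
      rwa [Nat.Coprime, Nat.gcd_comm, ← Nat.gcd_rec]
    rcases ih h2 with h3 | h3
    · left; linear_combination h3 + (hnExp p (q % p)).1 * h1
    · right; linear_combination h3 - (hnExp p (q % p)).1 * h1

/-- The conditions satisfied by the data of a Hamburger-Noether map of the Newton algorithm. -/
structure HNStep.Admissible (s : HNStep K) : Prop where
  p_pos : 0 < s.p
  q_pos : 0 < s.q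
  coprime : s.p.Coprime s.q
  μ_ne : s.μ ≠ 0

namespace HNStep.Admissible
variable {s : HNStep K} (hs : s.Admissible)
include hs

theorem center_ne : s.center ≠ 0 := by
  rw [HNStep.center]; split_ifs
  exacts [inv_ne_zero hs.μ_ne, hs.μ_ne]

/-- The pull-back of a binomial under a Hamburger-Noether map. -/
theorem binom_eq {A : Type*} [CommRing A] [Algebra K A] (y : A) : ∃ (m : ℕ) (κ : K), κ ≠ 0 ∧
    ((y + algebraMap K A s.center) ^ (hnExp s.p s.q).1) ^ s.q -
      algebraMap K A s.μ * ((y + algebraMap K A s.center) ^ (hnExp s.p s.q).2) ^ s.p =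
      (y + algebraMap K A s.center) ^ m * (algebraMap K A κ * y) := by
  rcases hnExp_spec s.p s.q hs.coprime with h | h
  · refine ⟨s.q * (hnExp s.p s.q).1, -s.μ, neg_ne_zero.2 hs.μ_ne, ?_⟩
    rw [HNStep.center, if_pos h, ← pow_mul, ← pow_mul, mul_comm _ s.p, h, mul_comm _ s.q, pow_succ]
    have h1 : algebraMap K A s.μ * algebraMap K A s.μ⁻¹ = 1 := by
      rw [← map_mul, mul_inv_cancel₀ hs.μ_ne, map_one]
    rw [map_neg]
    linear_combination -(y + algebraMap K A s.μ⁻¹) ^ (s.q * (hnExp s.p s.q).1) * h1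
  · refine ⟨s.p * (hnExp s.p s.q).2, 1, one_ne_zero, ?_⟩
    rw [HNStep.center, if_neg (by omega), ← pow_mul, ← pow_mul, mul_comm _ s.q, h, mul_comm _ s.p,
      pow_succ, map_one]
    ring

/-- The binomials with another coefficient do not vanish at the center. -/
theorem binom_ne {μ : K} (hμ : μ ≠ s.μ) :
    (s.center ^ (hnExp s.p s.q).1) ^ s.q - μ * (s.center ^ (hnExp s.p s.q).2) ^ s.p ≠ 0 := by
  obtain ⟨m, κ, -, h⟩ := hs.binom_eq (0 : K)
  simp only [Algebra.algebraMap_self, RingHom.id_apply, zero_add, mul_zero] at h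
  intro h'
  have h1 := h'.trans h.symm
  have h2 : (s.center ^ (hnExp s.p s.q).2) ^ s.p ≠ 0 :=
    pow_ne_zero _ (pow_ne_zero _ hs.center_ne)
  refine hμ (mul_right_cancel₀ h2 ?_)
  linear_combination -h1

theorem constantCoeff_subst : ∀ i, MvPowerSeries.constantCoeff (s.subst i) = 0 := fun i => by
  fin_cases i <;> simp [HNStep.subst, hs.p_pos.ne', hs.q_pos.ne']

theorem hasSubst : MvPowerSeries.HasSubst s.subst :=
  MvPowerSeries.hasSubst_of_constantCoeff_zero hs.constantCoeff_subst

end HNStep.Admissible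

/-! ### Multiplicity of a binomial in an initial form -/

/-- The point of the face at which the strict transforms are centered. -/
def HNStep.point (s : HNStep K) : Fin 2 → K :=
  ![s.center ^ (hnExp s.p s.q).1, s.center ^ (hnExp s.p s.q).2]

/-- The initial form of `F` for the weights of `s` has weight `W`, and the binomial of `s` divides
it exactly `k` times. -/
def HasMult (F : MvPowerSeries (Fin 2) K) (s : HNStep K) (W k : ℕ) : Prop :=
  ∃ A : MvPolynomial (Fin 2) K, MvPolynomial.eval s.point A ≠ 0 ∧
    IsInit F s.p s.q W (A * binomP s.p s.q s.μ ^ k)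

theorem IsInit.mul {F G : MvPowerSeries (Fin 2) K} {p q V W : ℕ}
    {P Q : MvPolynomial (Fin 2) K} (hF : IsInit F p q V P) (hG : IsInit G p q W Q) :
    IsInit (F * G) p q (V + W) (P * Q) where
  ne_zero := mul_ne_zero hF.ne_zero hG.ne_zero
  homog d hd := by
    classical
    rw [MvPolynomial.coeff_mul] at hd
    obtain ⟨x, hx, hx'⟩ := Finset.exists_ne_zero_of_sum_ne_zero hd
    rw [Finset.HasAntidiagonal.mem_antidiagonal] at hx
    rw [← hF.homog _ (left_ne_zero_of_mul hx'), ← hG.homog _ (right_ne_zero_of_mul hx'), ← hx]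
    simp only [Finsupp.add_apply]; ring
  lt_of_ne d hd := by
    classical
    have h1 : F * G - ((P * Q : MvPolynomial (Fin 2) K) : MvPowerSeries (Fin 2) K) =
        F * (G - (Q : MvPowerSeries (Fin 2) K)) +
          (F - (P : MvPowerSeries (Fin 2) K)) * (Q : MvPowerSeries (Fin 2) K) := by push_cast; ring
    rw [h1, map_add] at hd
    have h2 : MvPowerSeries.coeff d (F * (G - (Q : MvPowerSeries (Fin 2) K))) ≠ 0 ∨
        MvPowerSeries.coeff d ((F - (P : MvPowerSeries (Fin 2) K)) *
          (Q : MvPowerSeries (Fin 2) K)) ≠ 0 := by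
      by_contra! h
      exact hd (by rw [h.1, h.2, add_zero])
    rcases h2 with h2 | h2 <;> rw [MvPowerSeries.coeff_mul] at h2 <;>
      obtain ⟨x, hx, hx'⟩ := Finset.exists_ne_zero_of_sum_ne_zero h2 <;>
      rw [Finset.HasAntidiagonal.mem_antidiagonal] at hx
    · have h3 := hF.le (left_ne_zero_of_mul hx')
      have h4 := hG.lt_of_ne _ (right_ne_zero_of_mul hx')
      rw [← hx]; simp only [Finsupp.add_apply, mul_add]; omega
    · have h3 := hF.lt_of_ne _ (left_ne_zero_of_mul hx')
      have h4 := right_ne_zero_of_mul hx'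
      rw [MvPolynomial.coeff_coe] at h4
      have h4 := hG.homog _ h4
      rw [← hx]; simp only [Finsupp.add_apply, mul_add]; omega

theorem isInit_of_isUnit {u : MvPowerSeries (Fin 2) K} (hu : IsUnit u) {p q : ℕ} (hp : 0 < p)
    (hq : 0 < q) : IsInit u p q 0 (MvPolynomial.C (MvPowerSeries.constantCoeff u)) where
  ne_zero := by
    rw [MvPowerSeries.isUnit_iff_constantCoeff, isUnit_iff_ne_zero] at hu
    simpa using hu
  homog d hd := by
    classical
    rw [MvPolynomial.coeff_C] at hd
    split_ifs at hd with h
    · subst h; simp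
    · exact absurd rfl hd
  lt_of_ne d hd := by
    rw [Nat.pos_iff_ne_zero]
    intro h
    have h0 : d 0 = 0 := by
      rcases Nat.eq_zero_of_add_eq_zero_right h |> Nat.mul_eq_zero.1 with h | h <;> omega
    have h1 : d 1 = 0 := by
      rcases Nat.eq_zero_of_add_eq_zero_left h |> Nat.mul_eq_zero.1 with h | h <;> omega
    have : d = 0 := expo_ext (by simpa using h0) (by simpa using h1)
    subst this
    simp at hd

theorem isInit_coe {P : MvPolynomial (Fin 2) K} (h0 : P ≠ 0) {p q W : ℕ}
    (h : ∀ d, P.coeff d ≠ 0 → p * d 0 + q * d 1 = W) :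
    IsInit (P : MvPowerSeries (Fin 2) K) p q W P :=
  ⟨h0, h, fun d hd => by simp at hd⟩

theorem isInit_X0_pow (n p q : ℕ) : IsInit (MvPowerSeries.X 0 ^ n : MvPowerSeries (Fin 2) K) p q
    (p * n) (MvPolynomial.X 0 ^ n) := by
  classical
  have := isInit_coe (K := K) (P := MvPolynomial.X 0 ^ n) (p := p) (q := q) (W := p * n)
    (pow_ne_zero _ (MvPolynomial.X_ne_zero _)) fun d hd => by
      rw [MvPolynomial.coeff_X_pow] at hd
      split_ifs at hd with h
      · rw [← h]; simp
      · exact absurd rfl hd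
  simpa using this

theorem IsInit.onFace_iff {F : MvPowerSeries (Fin 2) K} {p q W : ℕ}
    {P : MvPolynomial (Fin 2) K} (h : IsInit F p q W P) (d : Fin 2 →₀ ℕ) :
    OnFace F p q d ↔ MvPowerSeries.coeff d F ≠ 0 ∧ p * d 0 + q * d 1 = W := by
  refine and_congr_right fun hd => ⟨fun hle => ?_, fun heq e he => heq ▸ h.le he⟩
  obtain ⟨e, he⟩ := MvPolynomial.ne_zero_iff.1 h.ne_zero
  have h1 := h.homog e he
  rw [← h.coeff_eq h1] at he
  exact le_antisymm (h1 ▸ hle e he) (h.le hd)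

theorem IsInit.onFace_iff_coeff {F : MvPowerSeries (Fin 2) K} {p q W : ℕ}
    {P : MvPolynomial (Fin 2) K} (h : IsInit F p q W P) (d : Fin 2 →₀ ℕ) :
    OnFace F p q d ↔ P.coeff d ≠ 0 := by
  rw [h.onFace_iff]
  refine ⟨fun ⟨h1, h2⟩ => by rwa [← h.coeff_eq h2], fun h1 => ?_⟩
  have h2 := h.homog d h1
  exact ⟨by rwa [h.coeff_eq h2], h2⟩

theorem IsInit.facePoly_eq {F : MvPowerSeries (Fin 2) K} {p q W : ℕ}
    {P : MvPolynomial (Fin 2) K} (h : IsInit F p q W P) : facePoly F p q = P := by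
  have hset : {d | OnFace F p q d} = (P.support : Set (Fin 2 →₀ ℕ)) := by
    ext d
    rw [Set.mem_ofPred_eq, h.onFace_iff_coeff]; simp
  rw [facePoly, hset, finsum_mem_coe_finset]
  refine Eq.trans ?_ (MvPolynomial.support_sum_monomial_coeff P)
  refine Finset.sum_congr rfl fun d hd => ?_
  rw [h.coeff_eq (h.homog d (MvPolynomial.mem_support_iff.1 hd))]

theorem HasMult.mul {F G : MvPowerSeries (Fin 2) K} {s : HNStep K} {V W k l : ℕ}
    (hF : HasMult F s V k) (hG : HasMult G s W l) : HasMult (F * G) s (V + W) (k + l) := by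
  obtain ⟨A, hA, hA'⟩ := hF
  obtain ⟨B, hB, hB'⟩ := hG
  refine ⟨A * B, by rw [map_mul]; exact mul_ne_zero hA hB, ?_⟩
  have := hA'.mul hB'
  rwa [show A * binomP s.p s.q s.μ ^ k * (B * binomP s.p s.q s.μ ^ l) =
    A * B * binomP s.p s.q s.μ ^ (k + l) by rw [pow_add]; ring] at this

theorem eval_point_binomP {s : HNStep K} (hs : s.Admissible) :
    MvPolynomial.eval s.point (binomP s.p s.q s.μ) = 0 := by
  rw [HNStep.point, eval_binomP]
  obtain ⟨m, κ, -, h⟩ := hs.binom_eq (0 : K)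
  simpa using h

/-- The binomial vanishes at `s.point` and the cofactor A does not. One evaluation thus excludes a
further factor, without any factorization of the face polynomial. -/
theorem HasMult.faceMult_eq {F : MvPowerSeries (Fin 2) K} {s : HNStep K} (hs : s.Admissible)
    {W k : ℕ} (h : HasMult F s W k) : faceMult F s.p s.q s.μ = k := by
  obtain ⟨A, hA, hA'⟩ := h
  have hb : binomP s.p s.q s.μ ≠ 0 := by
    intro h0
    have := congrArg (MvPolynomial.eval ![1, 0]) h0
    rw [eval_binomP] at this
    simp [hs.p_pos.ne'] at this
  rw [faceMult, hA'.facePoly_eq]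
  change emultiplicity (binomP s.p s.q s.μ) _ = _
  rw [emultiplicity_eq_coe]
  refine ⟨dvd_mul_left _ _, fun h => ?_⟩
  rw [pow_succ', mul_dvd_mul_iff_right (pow_ne_zero _ hb)] at h
  obtain ⟨B, rfl⟩ := h
  rw [map_mul, eval_point_binomP hs, zero_mul] at hA
  exact hA rfl

/-- If the face were a single point, the initial form would be a monomial, which does not vanish at
a point with nonzero coordinates; but the binomial does. -/
theorem HasMult.isEdge {F : MvPowerSeries (Fin 2) K} {s : HNStep K} (hs : s.Admissible)
    {W k : ℕ} (h : HasMult F s W k) (hk : k ≠ 0) : IsEdge F s.p s.q := by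
  obtain ⟨A, hA, hA'⟩ := h
  refine ⟨hs.p_pos, hs.q_pos, hs.coprime, ?_⟩
  by_contra! hne
  set P := A * binomP s.p s.q s.μ ^ k
  obtain ⟨d, hd⟩ := MvPolynomial.ne_zero_iff.1 hA'.ne_zero
  have hP : P = MvPolynomial.monomial d (P.coeff d) := by
    classical
    ext e
    rw [MvPolynomial.coeff_monomial]
    split_ifs with h
    · rw [h]
    · by_contra he
      exact hne d e h ((hA'.onFace_iff_coeff d).2 hd) ((hA'.onFace_iff_coeff e).2 he)
  have h1 : MvPolynomial.eval s.point P = 0 := by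
    simp only [P, map_mul, map_pow, eval_point_binomP hs, zero_pow hk, mul_zero]
  rw [hP, MvPolynomial.eval_monomial, Finsupp.prod_fintype _ _ (by simp), Fin.prod_univ_two] at h1
  have hc := hs.center_ne
  refine mul_ne_zero hd (mul_ne_zero ?_ ?_) h1
  · exact pow_ne_zero _ (pow_ne_zero _ hc)
  · exact pow_ne_zero _ (pow_ne_zero _ hc)

/-- On the exceptional divisor the binomial pulls back to a unit times y (`binom_eq`) and the
cofactor A to a unit, so k binomials give order k. For k = 0 the strict transform misses the point.
-/
theorem HasMult.exists_subst {F : MvPowerSeries (Fin 2) K} {s : HNStep K} (hs : s.Admissible)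
    {W k : ℕ} (h : HasMult F s W k) : ∃ G : MvPowerSeries (Fin 2) K,
      MvPowerSeries.subst s.subst F = MvPowerSeries.X 0 ^ W * G ∧
        (evalAt G 0 PowerSeries.X).order = k := by
  have hz : PowerSeries.constantCoeff (0 : PowerSeries K) = 0 := map_zero _
  have hX : PowerSeries.constantCoeff (PowerSeries.X : PowerSeries K) = 0 :=
    PowerSeries.constantCoeff_X
  obtain ⟨A, hA, hA'⟩ := h
  obtain ⟨G, hG⟩ := hA'.exists_subst hs.p_pos hs.q_pos (0 : Fin 2)
    ((MvPowerSeries.X 1 + MvPowerSeries.C s.center) ^ (hnExp s.p s.q).1)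
    ((MvPowerSeries.X 1 + MvPowerSeries.C s.center) ^ (hnExp s.p s.q).2)
  refine ⟨_, hG, ?_⟩
  set w : PowerSeries K := PowerSeries.X + PowerSeries.C s.center
  have hw : ∀ n : ℕ, evalAt ((MvPowerSeries.X 1 + MvPowerSeries.C s.center) ^ n) 0
      PowerSeries.X = w ^ n := fun n => by
    rw [evalAt_pow hz hX, evalAt_add hz hX, evalAt_X1 hz hX, evalAt_C]
  rw [evalAt_add hz hX, evalAt_mul hz hX, evalAt_X0 hz hX, zero_mul, add_zero,
    ← evHom_apply hz hX, MvPolynomial.comp_aeval_apply]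
  have hfun : (fun i => evHom 0 PowerSeries.X hz hX
      (![(MvPowerSeries.X 1 + MvPowerSeries.C s.center) ^ (hnExp s.p s.q).1,
        (MvPowerSeries.X 1 + MvPowerSeries.C s.center) ^ (hnExp s.p s.q).2] i)) =
      ![w ^ (hnExp s.p s.q).1, w ^ (hnExp s.p s.q).2] := by
    funext i
    fin_cases i
    · simpa [evHom_apply] using hw _
    · simpa [evHom_apply] using hw _
  rw [hfun, map_mul, map_pow]
  obtain ⟨m, κ, hκ, hb⟩ := hs.binom_eq (PowerSeries.X : PowerSeries K)
  have hb' : MvPolynomial.aeval ![w ^ (hnExp s.p s.q).1, w ^ (hnExp s.p s.q).2]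
      (binomP s.p s.q s.μ) = w ^ m * (PowerSeries.C κ * PowerSeries.X) := by
    refine Eq.trans ?_ hb
    simp [binomP]; rfl
  rw [hb']
  have hcA := constantCoeff_aeval (τ := Unit) (w ^ (hnExp s.p s.q).1) (w ^ (hnExp s.p s.q).2) A
  have hwc : PowerSeries.constantCoeff w = s.center := by simp [w]
  have hcA' : PowerSeries.constantCoeff
      (MvPolynomial.aeval ![w ^ (hnExp s.p s.q).1, w ^ (hnExp s.p s.q).2] A) ≠ 0 := by
    have h1 : ![MvPowerSeries.constantCoeff (w ^ (hnExp s.p s.q).1),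
        MvPowerSeries.constantCoeff (w ^ (hnExp s.p s.q).2)] = s.point := by
      rw [HNStep.point, ← hwc, ← map_pow, ← map_pow]; rfl
    rw [h1] at hcA
    intro h2
    exact hA (hcA.symm.trans h2)
  refine order_eq_of_eq_X_pow_mul (b := MvPolynomial.aeval ![w ^ (hnExp s.p s.q).1,
    w ^ (hnExp s.p s.q).2] A * (w ^ m * PowerSeries.C κ) ^ k) (by ring) ?_
  rw [map_mul, map_pow, map_mul, map_pow, hwc]
  exact mul_ne_zero hcA' (pow_ne_zero _ (mul_ne_zero (pow_ne_zero _ hs.center_ne) (by simpa)))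

end NewtonTree

end

noncomputable section

namespace NewtonTree

variable {K : Type*} [Field K]

/-! ### Transforms of power series -/

theorem HNStep.Admissible.subst_mul {s : HNStep K} (hs : s.Admissible)
    (f g : MvPowerSeries (Fin 2) K) : MvPowerSeries.subst s.subst (f * g) =
      MvPowerSeries.subst s.subst f * MvPowerSeries.subst s.subst g :=
  MvPowerSeries.subst_mul hs.hasSubst f g

theorem HNStep.Admissible.constantCoeff_subst_apply {s : HNStep K} (hs : s.Admissible)
    (f : MvPowerSeries (Fin 2) K) : MvPowerSeries.constantCoeff (MvPowerSeries.subst s.subst f) =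
      MvPowerSeries.constantCoeff f :=
  constantCoeff_subst_pair (hs.constantCoeff_subst 0) (hs.constantCoeff_subst 1) f

theorem HNStep.Admissible.isUnit_subst {s : HNStep K} (hs : s.Admissible)
    {f : MvPowerSeries (Fin 2) K} : IsUnit (MvPowerSeries.subst s.subst f) ↔ IsUnit f := by
  rw [MvPowerSeries.isUnit_iff_constantCoeff, hs.constantCoeff_subst_apply,
    ← MvPowerSeries.isUnit_iff_constantCoeff]

theorem transform_mul {L : List (HNStep K)} (hL : ∀ s ∈ L, s.Admissible)
    (f g : MvPowerSeries (Fin 2) K) :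
    transform (f * g) L = transform f L * transform g L := by
  induction L with
  | nil => rfl
  | cons s L ih =>
    rw [List.forall_mem_cons] at hL
    rw [transform, ih hL.2, hL.1.subst_mul]; rfl

theorem isUnit_center {s : HNStep K} (hs : s.Admissible) :
    IsUnit (MvPowerSeries.X 1 + MvPowerSeries.C s.center : MvPowerSeries (Fin 2) K) := by
  rw [MvPowerSeries.isUnit_iff_constantCoeff]
  simpa using hs.center_ne

theorem HNStep.Admissible.subst_X0_pow {s : HNStep K} (hs : s.Admissible) (N : ℕ) :
    ∃ u : MvPowerSeries (Fin 2) K, IsUnit u ∧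
      MvPowerSeries.subst s.subst (MvPowerSeries.X 0 ^ N : MvPowerSeries (Fin 2) K) =
      MvPowerSeries.X 0 ^ (s.p * N) * u := by
  refine ⟨((MvPowerSeries.X 1 + MvPowerSeries.C s.center) ^ (hnExp s.p s.q).1) ^ N,
    ((isUnit_center hs).pow _).pow _, ?_⟩
  rw [MvPowerSeries.subst_pow hs.hasSubst, MvPowerSeries.subst_X hs.hasSubst, pow_mul]
  simp only [HNStep.subst, Matrix.cons_val_zero, mul_pow]
  ring

theorem HNStep.Admissible.X0_dvd_subst {s : HNStep K} (hs : s.Admissible)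
    {f : MvPowerSeries (Fin 2) K} (hf : ¬ IsUnit f) :
    MvPowerSeries.X 0 ∣ MvPowerSeries.subst s.subst f := by
  have h := X_pow_dvd_subst (i := (0 : Fin 2))
    (u := (MvPowerSeries.X 1 + MvPowerSeries.C s.center) ^ (hnExp s.p s.q).1)
    (v := (MvPowerSeries.X 1 + MvPowerSeries.C s.center) ^ (hnExp s.p s.q).2)
    (W := 1) hs.p_pos hs.q_pos (F := f) fun d hd => by
      by_contra! hlt
      have h1 : d = 0 := by
        have h2 := hs.p_pos
        have h3 := hs.q_pos
        refine expo_ext ?_ ?_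
        · by_contra h0
          have := Nat.mul_pos h2 (Nat.pos_of_ne_zero h0); omega
        · by_contra h0
          have := Nat.mul_pos h3 (Nat.pos_of_ne_zero h0); omega
      rw [h1, MvPowerSeries.coeff_zero_eq_constantCoeff_apply] at hd
      exact hf (MvPowerSeries.isUnit_iff_constantCoeff.2 (isUnit_iff_ne_zero.2 hd))
  rwa [pow_one] at h

/-- As long as the strict transform of `a` is not a unit, the exponent of the exceptional divisor
grows. -/
theorem exists_transform_eq {L : List (HNStep K)} (hL : ∀ s ∈ L, s.Admissible)
    (a : MvPowerSeries (Fin 2) K) : ∃ (N : ℕ) (a' : MvPowerSeries (Fin 2) K),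
      transform a L = MvPowerSeries.X 0 ^ N * a' ∧ (IsUnit a' ∨ L.length ≤ N) := by
  induction L with
  | nil => exact ⟨0, a, by simp [transform], Or.inr le_rfl⟩
  | cons s L ih =>
    rw [List.forall_mem_cons] at hL
    obtain ⟨N, a', h, h'⟩ := ih hL.2
    obtain ⟨u, hu, hu'⟩ := hL.1.subst_X0_pow N
    by_cases ha : IsUnit a'
    · exact ⟨s.p * N, u * MvPowerSeries.subst s.subst a', by
        rw [transform, h, hL.1.subst_mul, hu', mul_assoc],
        Or.inl (hu.mul (hL.1.isUnit_subst.2 ha))⟩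
    · obtain ⟨b, hb⟩ := hL.1.X0_dvd_subst ha
      refine ⟨s.p * N + 1, u * b, by
        rw [transform, h, hL.1.subst_mul, hu', hb]; ring, Or.inr ?_⟩
      have h1 := h'.resolve_left ha
      have h2 := Nat.mul_le_mul_right N hL.1.p_pos
      simp only [List.length_cons]; omega

/-- `f` becomes a power of the exceptional divisor. -/
def IsOut (f : MvPowerSeries (Fin 2) K) (L : List (HNStep K)) : Prop :=
  ∃ (N : ℕ) (u : MvPowerSeries (Fin 2) K), IsUnit u ∧ transform f L = MvPowerSeries.X 0 ^ N * u

theorem IsOut.cons {f : MvPowerSeries (Fin 2) K} {L : List (HNStep K)} (h : IsOut f L)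
    {s : HNStep K} (hs : s.Admissible) : IsOut f (s :: L) := by
  obtain ⟨N, u, hu, h⟩ := h
  obtain ⟨v, hv, hv'⟩ := hs.subst_X0_pow N
  exact ⟨s.p * N, v * MvPowerSeries.subst s.subst u, hv.mul (hs.isUnit_subst.2 hu), by
    rw [transform, h, hs.subst_mul, hv', mul_assoc]⟩

/-! ### Lifting parametrizations -/

theorem evalAt_subst_step {s : HNStep K} (hs : s.Admissible) {X Y : PowerSeries K}
    (hX : PowerSeries.constantCoeff X = 0) (hY : PowerSeries.constantCoeff Y = 0)
    (F : MvPowerSeries (Fin 2) K) : evalAt (MvPowerSeries.subst s.subst F) X Y =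
      evalAt F ((Y + PowerSeries.C s.center) ^ (hnExp s.p s.q).1 * X ^ s.p)
        ((Y + PowerSeries.C s.center) ^ (hnExp s.p s.q).2 * X ^ s.q) := by
  rw [evalAt, MvPowerSeries.subst_comp_subst_apply hs.hasSubst (hasSubst_pair hX hY), evalAt]
  congr 1
  funext i
  have h : ∀ m n : ℕ, evalAt ((MvPowerSeries.X 1 + MvPowerSeries.C s.center) ^ m *
      MvPowerSeries.X 0 ^ n) X Y = (Y + PowerSeries.C s.center) ^ m * X ^ n := fun m n => by
    rw [evalAt_mul hX hY, evalAt_pow hX hY, evalAt_pow hX hY, evalAt_add hX hY, evalAt_X0 hX hY,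
      evalAt_X1 hX hY, evalAt_C]
  fin_cases i
  · exact h _ _
  · exact h _ _

/-- The tangent of the parametrization `(X, Y)` in terms of the data of a Hamburger-Noether map. -/
structure EdgeAt (X Y : PowerSeries K) (s : HNStep K) (k : ℕ) : Prop where
  adm : s.Admissible
  pos : 0 < k
  ordX : X.order = (k * s.p : ℕ)
  ordY : Y.order = (k * s.q : ℕ)
  lc : PowerSeries.coeff (k * s.p) X ^ s.q = s.μ * PowerSeries.coeff (k * s.q) Y ^ s.p

theorem exists_edgeAt {X Y : PowerSeries K} (hX : PowerSeries.constantCoeff X = 0)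
    (hY : PowerSeries.constantCoeff Y = 0) (hX0 : X ≠ 0) (hY0 : Y ≠ 0) :
    ∃ s k, EdgeAt X Y s k := by
  have hpos : ∀ Z : PowerSeries K, PowerSeries.constantCoeff Z = 0 → Z ≠ 0 →
      ∃ n : ℕ, 0 < n ∧ Z.order = n := fun Z hZ hZ0 => by
    obtain ⟨n, hn⟩ := ENat.ne_top_iff_exists.1 (PowerSeries.order_eq_top.not.2 hZ0)
    refine ⟨n, Nat.pos_of_ne_zero fun h0 => ?_, hn.symm⟩
    subst h0
    exact (PowerSeries.order_ne_zero_iff_constCoeff_eq_zero.2 hZ) hn.symm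
  obtain ⟨m, hm, hXm⟩ := hpos X hX hX0
  obtain ⟨n, hn, hYn⟩ := hpos Y hY hY0
  obtain ⟨p, q, hpq, hm', hn'⟩ := Nat.exists_coprime m n
  have hk : 0 < m.gcd n := Nat.gcd_pos_of_pos_left _ hm
  set k := m.gcd n
  rw [mul_comm] at hm' hn'
  rw [hm'] at hXm
  rw [hn'] at hYn
  obtain ⟨u, -, -, hu⟩ := exists_of_order_eq hXm
  obtain ⟨v, -, -, hv⟩ := exists_of_order_eq hYn
  have hp : 0 < p := Nat.pos_of_ne_zero fun h => by simp [h] at hm'; omega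
  have hq : 0 < q := Nat.pos_of_ne_zero fun h => by simp [h] at hn'; omega
  refine ⟨⟨p, q, PowerSeries.coeff (k * p) X ^ q / PowerSeries.coeff (k * q) Y ^ p⟩, k,
    ⟨hp, hq, hpq, div_ne_zero (pow_ne_zero _ hu) (pow_ne_zero _ hv)⟩, hk, hXm, hYn, ?_⟩
  exact (div_mul_cancel₀ _ (pow_ne_zero _ hv)).symm

theorem EdgeAt.coeff_ne {X Y : PowerSeries K} {s : HNStep K} {k : ℕ} (h : EdgeAt X Y s k) :
    PowerSeries.coeff (k * s.p) X ≠ 0 ∧ PowerSeries.coeff (k * s.q) Y ≠ 0 := by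
  obtain ⟨u, -, -, hu⟩ := exists_of_order_eq h.ordX
  obtain ⟨v, -, -, hv⟩ := exists_of_order_eq h.ordY
  exact ⟨hu, hv⟩

theorem EdgeAt.X_ne {X Y : PowerSeries K} {s : HNStep K} {k : ℕ} (h : EdgeAt X Y s k) :
    X ≠ 0 := by
  rintro rfl
  exact h.coeff_ne.1 (map_zero _)

theorem EdgeAt.Y_ne {X Y : PowerSeries K} {s : HNStep K} {k : ℕ} (h : EdgeAt X Y s k) :
    Y ≠ 0 := by
  rintro rfl
  exact h.coeff_ne.2 (map_zero _)

theorem EdgeAt.weights_eq {X Y : PowerSeries K} {s t : HNStep K} {k l : ℕ} (h : EdgeAt X Y s k)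
    (h' : EdgeAt X Y t l) : s.p = t.p ∧ s.q = t.q ∧ k = l := by
  have h1 : k * s.p = l * t.p := by exact_mod_cast h.ordX.symm.trans h'.ordX
  have h2 : k * s.q = l * t.q := by exact_mod_cast h.ordY.symm.trans h'.ordY
  have h3 : k = l := by
    have h3 := Nat.gcd_mul_left k s.p s.q
    have h4 := Nat.gcd_mul_left l t.p t.q
    rw [h.adm.coprime.gcd_eq_one, mul_one] at h3
    rw [h'.adm.coprime.gcd_eq_one, mul_one] at h4
    rw [← h3, h1, h2, h4]
  subst h3
  exact ⟨Nat.eq_of_mul_eq_mul_left h.pos h1, Nat.eq_of_mul_eq_mul_left h.pos h2, rfl⟩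

theorem EdgeAt.unique {X Y : PowerSeries K} {s t : HNStep K} {k l : ℕ} (h : EdgeAt X Y s k)
    (h' : EdgeAt X Y t l) : s = t := by
  obtain ⟨h1, h2, h3⟩ := h.weights_eq h'
  subst h3
  obtain ⟨p, q, μ⟩ := s
  obtain ⟨p', q', μ'⟩ := t
  obtain rfl : p = p' := h1
  obtain rfl : q = q' := h2
  have := mul_right_cancel₀ (pow_ne_zero _ h.coeff_ne.2) (h.lc.symm.trans h'.lc)
  obtain rfl : μ = μ' := this
  rfl

/-- The monomial map is inverted explicitly. With w = Y' + center: if pb = qa + 1 then X' = X^b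
Y^(-a) and w = Y^p X^(-q); otherwise X' = Y^a X^(-b) and w = X^q Y^(-p). The determinant gives X'
order k, and the relation between the leading coefficients makes the center the constant term of w.
-/
theorem EdgeAt.exists_lift {X Y : PowerSeries K} {s : HNStep K} {k : ℕ} (h : EdgeAt X Y s k) :
    ∃ X' Y' : PowerSeries K, X'.order = k ∧ PowerSeries.constantCoeff Y' = 0 ∧
      X = (Y' + PowerSeries.C s.center) ^ (hnExp s.p s.q).1 * X' ^ s.p ∧
      Y = (Y' + PowerSeries.C s.center) ^ (hnExp s.p s.q).2 * X' ^ s.q := by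
  obtain ⟨u, hu, hu1, hu0⟩ := exists_of_order_eq h.ordX
  obtain ⟨v, hv, hv1, hv0⟩ := exists_of_order_eq h.ordY
  have hlc := h.lc
  rw [← hu1, ← hv1] at hlc
  rw [← hu1] at hu0
  rw [← hv1] at hv0
  obtain ⟨ui, hui⟩ := (PowerSeries.isUnit_iff_constantCoeff.2
    (isUnit_iff_ne_zero.2 hu0)).exists_right_inv
  obtain ⟨vi, hvi⟩ := (PowerSeries.isUnit_iff_constantCoeff.2
    (isUnit_iff_ne_zero.2 hv0)).exists_right_inv
  have hui' := congrArg PowerSeries.constantCoeff hui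
  have hvi' := congrArg PowerSeries.constantCoeff hvi
  rw [map_mul, map_one] at hui' hvi'
  have hui0 := right_ne_zero_of_mul_eq_one hui'
  have hvi0 := right_ne_zero_of_mul_eq_one hvi'
  have hμ := h.adm.μ_ne
  set a := (hnExp s.p s.q).1
  set b := (hnExp s.p s.q).2
  rcases hnExp_spec s.p s.q h.adm.coprime with hab | hab
  · refine ⟨PowerSeries.X ^ k * (u ^ b * vi ^ a), v ^ s.p * ui ^ s.q - PowerSeries.C s.center,
      ?_, ?_, ?_, ?_⟩
    · refine order_eq_of_eq_X_pow_mul rfl ?_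
      rw [map_mul, map_pow, map_pow]
      exact mul_ne_zero (pow_ne_zero _ hu0) (pow_ne_zero _ hvi0)
    · rw [HNStep.center, if_pos hab, map_sub, map_mul, map_pow, map_pow,
        PowerSeries.constantCoeff_C, sub_eq_zero]
      refine eq_inv_of_mul_eq_one_right ?_
      have h1 := congrArg (· ^ s.q) hui'
      simp only [mul_pow, one_pow] at h1
      rw [hlc] at h1
      linear_combination h1
    · rw [sub_add_cancel, hu]
      have h1 : s.p * b = s.q * a + 1 := hab
      have h2 : (v * vi) ^ (s.p * a) * (u * ui) ^ (s.q * a) = 1 := by rw [hui, hvi]; simp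
      have h3 : u ^ (s.p * b) = u ^ (s.q * a) * u := by rw [h1, pow_succ]
      simp only [mul_pow, ← pow_mul] at h2 ⊢
      rw [mul_comm b s.p, mul_comm a s.p, h3]
      linear_combination (-(u * PowerSeries.X ^ (k * s.p))) * h2
    · rw [sub_add_cancel, hv]
      have h1 : s.p * b = s.q * a + 1 := hab
      have h2 : (v * vi) ^ (s.q * a) * (u * ui) ^ (s.q * b) = 1 := by rw [hui, hvi]; simp
      have h3 : v ^ (s.p * b) = v ^ (s.q * a) * v := by rw [h1, pow_succ]
      simp only [mul_pow, ← pow_mul] at h2 ⊢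
      rw [mul_comm b s.q, mul_comm a s.q, h3]
      linear_combination (-(v * PowerSeries.X ^ (k * s.q))) * h2
  · refine ⟨PowerSeries.X ^ k * (v ^ a * ui ^ b), u ^ s.q * vi ^ s.p - PowerSeries.C s.center,
      ?_, ?_, ?_, ?_⟩
    · refine order_eq_of_eq_X_pow_mul rfl ?_
      rw [map_mul, map_pow, map_pow]
      exact mul_ne_zero (pow_ne_zero _ hv0) (pow_ne_zero _ hui0)
    · have hab' : ¬ (s.p * (hnExp s.p s.q).2 = s.q * (hnExp s.p s.q).1 + 1) := by omega
      rw [HNStep.center, if_neg hab', map_sub, map_mul, map_pow, map_pow,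
        PowerSeries.constantCoeff_C, sub_eq_zero, hlc]
      have h1 := congrArg (· ^ s.p) hvi'
      simp only [mul_pow, one_pow] at h1
      linear_combination s.μ * h1
    · rw [sub_add_cancel, hu]
      have h1 : s.q * a = s.p * b + 1 := hab
      have h2 : (v * vi) ^ (s.p * a) * (u * ui) ^ (s.p * b) = 1 := by rw [hui, hvi]; simp
      have h3 : u ^ (s.q * a) = u ^ (s.p * b) * u := by rw [h1, pow_succ]
      simp only [mul_pow, ← pow_mul] at h2 ⊢
      rw [mul_comm b s.p, mul_comm a s.p, h3]
      linear_combination (-(u * PowerSeries.X ^ (k * s.p))) * h2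
    · rw [sub_add_cancel, hv]
      have h1 : s.q * a = s.p * b + 1 := hab
      have h2 : (v * vi) ^ (s.p * b) * (u * ui) ^ (s.q * b) = 1 := by rw [hui, hvi]; simp
      have h3 : v ^ (s.q * a) = v ^ (s.p * b) * v := by rw [h1, pow_succ]
      simp only [mul_pow, ← pow_mul] at h2 ⊢
      rw [mul_comm b s.q, mul_comm a s.q, h3]
      linear_combination (-(v * PowerSeries.X ^ (k * s.q))) * h2

theorem EdgeAt.hasMult [IsAlgClosed K] {F : MvPowerSeries (Fin 2) K} {X Y : PowerSeries K}
    {s : HNStep K} {k : ℕ} (h : EdgeAt X Y s k) (hF : IsBranch F X Y) :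
    HasMult F s (k * (s.p * s.q)) k := by
  obtain ⟨c, hc, hc'⟩ := hF.exists_isInit h.adm.p_pos h.adm.q_pos h.adm.coprime h.ordX h.ordY h.lc
  exact ⟨MvPolynomial.C c, by simpa, hc'⟩

/-- The strict transform of a branch along its own tangent. -/
theorem EdgeAt.exists_branch [IsAlgClosed K] {F : MvPowerSeries (Fin 2) K} {X Y : PowerSeries K}
    {s : HNStep K} {k : ℕ} (h : EdgeAt X Y s k) (hF : IsBranch F X Y) :
    ∃ (F' : MvPowerSeries (Fin 2) K) (X' Y' : PowerSeries K), IsBranch F' X' Y' ∧ X'.order = k ∧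
      MvPowerSeries.subst s.subst F = MvPowerSeries.X 0 ^ (k * (s.p * s.q)) * F' ∧
      X = (Y' + PowerSeries.C s.center) ^ (hnExp s.p s.q).1 * X' ^ s.p ∧
      Y = (Y' + PowerSeries.C s.center) ^ (hnExp s.p s.q).2 * X' ^ s.q := by
  obtain ⟨X', Y', hX', hY', hX, hY⟩ := h.exists_lift
  obtain ⟨G, hG, hord⟩ := (h.hasMult hF).exists_subst h.adm
  have hX'0 : X' ≠ 0 := by
    rintro rfl
    rw [PowerSeries.order_zero] at hX'
    exact ENat.top_ne_natCast _ hX'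
  have hX'c : PowerSeries.constantCoeff X' = 0 := by
    rw [← PowerSeries.order_ne_zero_iff_constCoeff_eq_zero, hX']
    exact_mod_cast h.pos.ne'
  have hG0 : evalAt G X' Y' = 0 := by
    have h1 := evalAt_subst_step h.adm hX'c hY' F
    rw [← hX, ← hY, hF.param.eval_eq_zero, hG, evalAt_mul hX'c hY', evalAt_pow hX'c hY',
      evalAt_X0 hX'c hY'] at h1
    exact (mul_eq_zero.1 h1).resolve_left (pow_ne_zero _ hX'0)
  -- G vanishes on the lift, whose primitivity is inherited since any factorization of it pushes
  -- forward to one of (X,Y). The criterion applies because both G(0,y) and X' have order k.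
  refine ⟨G, X', Y', IsPrimitiveParametrization.isBranch_of_order
    ⟨hX'c, hY', Or.inl hX'0, hG0, fun φ₁ ψ₁ τ hτ h1 h2 => ?_⟩ hX'0 (by rw [hord, hX']),
    hX', hG, hX, hY⟩
  refine hF.param.primitive ((ψ₁ + PowerSeries.C s.center) ^ (hnExp s.p s.q).1 * φ₁ ^ s.p)
    ((ψ₁ + PowerSeries.C s.center) ^ (hnExp s.p s.q).2 * φ₁ ^ s.q) τ hτ ?_ ?_
  · rw [hX, h1, h2]
    simp only [← substHom_apply hτ, map_mul, map_pow, map_add, substHom_C]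
  · rw [hY, h1, h2]
    simp only [← substHom_apply hτ, map_mul, map_pow, map_add, substHom_C]

end NewtonTree

end

noncomputable section

namespace NewtonTree

variable {K : Type*} [Field K]

/-! ### Faces of Newton polygons -/

/-- The middle weight is a positive combination of the outer two, so d minimizes it, and equality
forces equality for both outer weights, which are linearly independent. -/
theorem onFace_convex {h : MvPowerSeries (Fin 2) K} {p₁ q₁ p₂ q₂ p₃ q₃ : ℕ}
    (h12 : p₂ * q₁ < p₁ * q₂) (h23 : p₃ * q₂ < p₂ * q₃) {d : Fin 2 →₀ ℕ} (h1 : OnFace h p₁ q₁ d)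
    (h3 : OnFace h p₃ q₃ d) (e : Fin 2 →₀ ℕ) : OnFace h p₂ q₂ e ↔ e = d := by
  have key : ∀ e : Fin 2 →₀ ℕ, MvPowerSeries.coeff e h ≠ 0 →
      p₂ * d 0 + q₂ * d 1 ≤ p₂ * e 0 + q₂ * e 1 ∧
        (p₂ * e 0 + q₂ * e 1 ≤ p₂ * d 0 + q₂ * d 1 → e = d) := by
    intro e he
    have e1 := h1.2 e he
    have e3 := h3.2 e he
    zify at h12 h23 e1 e3 ⊢
    generalize hx : (d 0 : ℤ) = x at *
    generalize hy : (d 1 : ℤ) = y at *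
    generalize hx' : (e 0 : ℤ) = x' at *
    generalize hy' : (e 1 : ℤ) = y' at *
    set a : ℤ := p₂ * q₃ - p₃ * q₂ with ha
    set b : ℤ := p₁ * q₂ - p₂ * q₁ with hb
    set c : ℤ := p₁ * q₃ - p₃ * q₁ with hc
    have ha0 : 0 < a := by omega
    have hb0 : 0 < b := by omega
    have hp1 : (0 : ℤ) < p₁ := by
      by_contra hn
      have : (p₁ : ℤ) = 0 := by omega
      rw [this, zero_mul] at h12
      exact absurd h12 (not_lt.2 (by positivity))
    have hp2 : (0 : ℤ) < p₂ := by
      by_contra hn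
      have : (p₂ : ℤ) = 0 := by omega
      rw [this, zero_mul] at h23
      exact absurd h23 (not_lt.2 (by positivity))
    have hc0 : 0 < c := by
      have : c * p₂ = a * p₁ + b * p₃ := by rw [ha, hb, hc]; ring
      have h5 : 0 < c * p₂ := by rw [this]; positivity
      exact (pos_iff_pos_of_mul_pos h5).2 hp2
    have e1' : (0 : ℤ) ≤ p₁ * (x' - x) + q₁ * (y' - y) := by linarith
    have e3' : (0 : ℤ) ≤ p₃ * (x' - x) + q₃ * (y' - y) := by linarith
    -- Cramer's rule: a, b, c are the determinants of the weight pairs (2,3), (1,2) and (1,3).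
    have hcomb : c * (p₂ * (x' - x) + q₂ * (y' - y)) =
        a * (p₁ * (x' - x) + q₁ * (y' - y)) + b * (p₃ * (x' - x) + q₃ * (y' - y)) := by
      rw [ha, hb, hc]; ring
    constructor
    · have h5 : 0 ≤ c * (p₂ * (x' - x) + q₂ * (y' - y)) := by
        rw [hcomb]; exact add_nonneg (mul_nonneg ha0.le e1') (mul_nonneg hb0.le e3')
      have := nonneg_of_mul_nonneg_right h5 hc0
      linarith
    · intro hle
      have h5 : c * (p₂ * (x' - x) + q₂ * (y' - y)) ≤ 0 :=
        mul_nonpos_of_nonneg_of_nonpos hc0.le (by linarith)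
      rw [hcomb] at h5
      have h6 := mul_nonneg ha0.le e1'
      have h7 := mul_nonneg hb0.le e3'
      have h8 := (mul_eq_zero.1 (le_antisymm (by linarith) h6)).resolve_left ha0.ne'
      have h9 := (mul_eq_zero.1 (le_antisymm (by linarith) h7)).resolve_left hb0.ne'
      have h10 : c * (x' - x) = 0 := by rw [hc]; linear_combination q₃ * h8 - q₁ * h9
      have h11 : c * (y' - y) = 0 := by rw [hc]; linear_combination p₁ * h9 - p₃ * h8
      have h12 := (mul_eq_zero.1 h10).resolve_left hc0.ne'
      have h13 := (mul_eq_zero.1 h11).resolve_left hc0.ne'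
      exact expo_ext (by omega) (by omega)
  constructor
  · intro he
    exact (key e he.1).2 (he.2 d h1.1)
  · rintro rfl
    exact ⟨h1.1, fun e' he' => (key e' he').1⟩

/-- Only the pair (d, e) contributes to the coefficient at d + e: another pair would have equality
for two independent linear forms. So this corner of the polygon of a product cannot cancel. -/
theorem OnFace.mul {F G : MvPowerSeries (Fin 2) K} {p q p' q' : ℕ} (hne : p * q' ≠ p' * q)
    {d e : Fin 2 →₀ ℕ} (hF : OnFace F p q d) (hF' : OnFace F p' q' d) (hG : OnFace G p q e)
    (hG' : OnFace G p' q' e) :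
    OnFace (F * G) p q (d + e) ∧ OnFace (F * G) p' q' (d + e) := by
  classical
  have hcoeff : MvPowerSeries.coeff (d + e) (F * G) ≠ 0 := by
    rw [MvPowerSeries.coeff_mul, Finset.sum_eq_single (d, e)]
    · exact mul_ne_zero hF.1 hG.1
    · rintro ⟨a, b⟩ hab hne'
      rw [Finset.HasAntidiagonal.mem_antidiagonal] at hab
      simp only at hab ⊢
      by_contra h0
      have ha := left_ne_zero_of_mul h0
      have hb := right_ne_zero_of_mul h0
      have h1 := hF.2 a ha
      have h2 := hG.2 b hb
      have h3 := hF'.2 a ha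
      have h4 := hG'.2 b hb
      have hab0 := DFunLike.congr_fun hab 0
      have hab1 := DFunLike.congr_fun hab 1
      simp only [Finsupp.add_apply] at hab0 hab1
      zify at h1 h2 h3 h4 hab0 hab1 hne
      have h5 : (p : ℤ) * (a 0 - d 0) + q * (a 1 - d 1) = 0 := by
        apply le_antisymm
        · have : (p : ℤ) * (a 0 - d 0) + q * (a 1 - d 1) =
            p * e 0 + q * e 1 - (p * b 0 + q * b 1) := by
              linear_combination (p : ℤ) * hab0 + q * hab1
          rw [this]; linarith
        · linarith
      have h6 : (p' : ℤ) * (a 0 - d 0) + q' * (a 1 - d 1) = 0 := by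
        apply le_antisymm
        · have : (p' : ℤ) * (a 0 - d 0) + q' * (a 1 - d 1) =
            p' * e 0 + q' * e 1 - (p' * b 0 + q' * b 1) := by
              linear_combination (p' : ℤ) * hab0 + q' * hab1
          rw [this]; linarith
        · linarith
      have hc := sub_ne_zero.2 hne
      have h7 : (p * q' - p' * q : ℤ) * (a 0 - d 0) = 0 := by
        linear_combination q' * h5 - q * h6
      have h8 : (p * q' - p' * q : ℤ) * (a 1 - d 1) = 0 := by
        linear_combination p * h6 - p' * h5
      have h9 := (mul_eq_zero.1 h7).resolve_left hc
      have h10 := (mul_eq_zero.1 h8).resolve_left hc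
      have had : a = d := expo_ext (by omega) (by omega)
      refine hne' ?_
      rw [Prod.mk.injEq]
      refine ⟨had, ?_⟩
      rw [had] at hab
      exact add_left_cancel hab
    · intro hn
      refine absurd ?_ hn
      rw [Finset.HasAntidiagonal.mem_antidiagonal]
  have hle : ∀ x, MvPowerSeries.coeff x (F * G) ≠ 0 → ∃ a b, a + b = x ∧
      MvPowerSeries.coeff a F ≠ 0 ∧ MvPowerSeries.coeff b G ≠ 0 := fun x hx => by
    rw [MvPowerSeries.coeff_mul] at hx
    obtain ⟨⟨a, b⟩, hab, h0⟩ := Finset.exists_ne_zero_of_sum_ne_zero hx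
    exact ⟨a, b, Finset.HasAntidiagonal.mem_antidiagonal.1 hab, left_ne_zero_of_mul h0,
      right_ne_zero_of_mul h0⟩
  refine ⟨⟨hcoeff, fun x hx => ?_⟩, ⟨hcoeff, fun x hx => ?_⟩⟩
  · obtain ⟨a, b, rfl, ha, hb⟩ := hle x hx
    have h1 := hF.2 a ha
    have h2 := hG.2 b hb
    simp only [Finsupp.add_apply, mul_add]; omega
  · obtain ⟨a, b, rfl, ha, hb⟩ := hle x hx
    have h1 := hF'.2 a ha
    have h2 := hG'.2 b hb
    simp only [Finsupp.add_apply, mul_add]; omega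

theorem onFace_of_isUnit {u : MvPowerSeries (Fin 2) K} (hu : IsUnit u) (p q : ℕ) :
    OnFace u p q 0 := by
  refine ⟨?_, fun e _ => by simp⟩
  rw [MvPowerSeries.isUnit_iff_constantCoeff, isUnit_iff_ne_zero] at hu
  simpa using hu

theorem onFace_X_pow (i : Fin 2) (N p q : ℕ) :
    OnFace (MvPowerSeries.X i ^ N : MvPowerSeries (Fin 2) K) p q (Finsupp.single i N) := by
  classical
  refine ⟨by simp [MvPowerSeries.coeff_X_pow], fun e he => ?_⟩
  rw [MvPowerSeries.coeff_X_pow] at he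
  split_ifs at he with h
  · rw [h]
  · exact absurd rfl he

theorem OnFace.mul_isUnit {F u : MvPowerSeries (Fin 2) K} {p q : ℕ} {d : Fin 2 →₀ ℕ}
    (h : OnFace F p q d) (hu : IsUnit u) (h' : ∀ p' q', OnFace F p' q' d) :
    OnFace (F * u) p q d := by
  by_cases h0 : q = 0 ∧ p = 0
  · obtain ⟨rfl, rfl⟩ := h0
    have := (OnFace.mul (p := 1) (q := 0) (p' := 0) (q' := 1) (by simp) (h' _ _) (h' _ _)
      (onFace_of_isUnit hu _ _) (onFace_of_isUnit hu _ _)).1.1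
    rw [add_zero] at this
    exact ⟨this, by simp⟩
  -- The auxiliary second weight is any one not proportional to (p, q).
  · have := (OnFace.mul (p := p) (q := q) (p' := if q = 0 then 0 else 1)
      (q' := if q = 0 then 1 else 0) (by split_ifs with h1 <;> simp; tauto; tauto) (h' _ _) (h' _ _)
      (onFace_of_isUnit hu _ _) (onFace_of_isUnit hu _ _)).1
    rwa [add_zero] at this

theorem isInit_of_single {F : MvPowerSeries (Fin 2) K} {p q : ℕ} (hp : 0 < p) (hq : 0 < q)
    {d : Fin 2 →₀ ℕ} (h : ∀ e, OnFace F p q e ↔ e = d) :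
    IsInit F p q (p * d 0 + q * d 1) (MvPolynomial.monomial d (MvPowerSeries.coeff d F)) := by
  have hd := (h d).2 rfl
  have hF : F ≠ 0 := by
    rintro rfl
    exact hd.1 (map_zero _)
  obtain ⟨W, P, hP⟩ := exists_isInit hF hp hq
  have hW := ((hP.onFace_iff d).1 hd).2
  have hPd : P = MvPolynomial.monomial d (MvPowerSeries.coeff d F) := by
    classical
    ext e
    rw [MvPolynomial.coeff_monomial]
    split_ifs with he
    · subst he; rw [hP.coeff_eq hW]
    · by_contra h0
      exact he ((h e).1 ((hP.onFace_iff_coeff e).2 h0)).symm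
  rw [hW, ← hPd]
  exact hP

theorem hasMult_zero_of_single {F : MvPowerSeries (Fin 2) K} {s : HNStep K} (hs : s.Admissible)
    {d : Fin 2 →₀ ℕ} (h : ∀ e, OnFace F s.p s.q e ↔ e = d) :
    HasMult F s (s.p * d 0 + s.q * d 1) 0 := by
  refine ⟨_, ?_, by simpa using isInit_of_single hs.p_pos hs.q_pos h⟩
  rw [MvPolynomial.eval_monomial, Finsupp.prod_fintype _ _ (by simp), Fin.prod_univ_two]
  have hc := hs.center_ne
  exact mul_ne_zero ((h d).2 rfl).1
    (mul_ne_zero (pow_ne_zero _ (pow_ne_zero _ hc)) (pow_ne_zero _ (pow_ne_zero _ hc)))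

theorem order_evalAt_of_single {F : MvPowerSeries (Fin 2) K} {X Y : PowerSeries K}
    {s : HNStep K} {k : ℕ} (hs : EdgeAt X Y s k) {d : Fin 2 →₀ ℕ}
    (h : ∀ e, OnFace F s.p s.q e ↔ e = d) :
    (evalAt F X Y).order = (k * (s.p * d 0 + s.q * d 1) : ℕ) := by
  obtain ⟨G, hG, hG'⟩ := (isInit_of_single hs.adm.p_pos hs.adm.q_pos h).exists_evalAt
    hs.adm.p_pos hs.adm.q_pos hs.pos hs.ordX hs.ordY
  refine order_eq_of_eq_X_pow_mul hG ?_
  rw [hG', MvPolynomial.eval_monomial, Finsupp.prod_fintype _ _ (by simp), Fin.prod_univ_two]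
  exact mul_ne_zero ((h d).2 rfl).1
    (mul_ne_zero (pow_ne_zero _ hs.coeff_ne.1) (pow_ne_zero _ hs.coeff_ne.2))

/-! ### The Newton polygon of a branch -/

theorem IsBranch.associated_of_dvd {F G : MvPowerSeries (Fin 2) K} {φ ψ φ' ψ' : PowerSeries K}
    (hF : IsBranch F φ ψ) (hG : IsBranch G φ' ψ') (h : F ∣ G) : Associated F G := by
  refine associated_of_dvd_dvd h ?_
  obtain ⟨H, hH⟩ := h
  by_contra h0
  rw [← hG.ker] at h0
  exact hF.not_isUnit (hG.isUnit_of_mul hH h0)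

theorem IsBranch.associated_X0 {F : MvPowerSeries (Fin 2) K} {Y : PowerSeries K}
    (hF : IsBranch F 0 Y) : Associated F (MvPowerSeries.X 0) :=
  hF.associated_of_dvd isBranch_X0 ((hF.ker _).1
    (evalAt_X0 (map_zero _) hF.param.constantCoeff_snd))

theorem IsBranch.associated_X1 {F : MvPowerSeries (Fin 2) K} {X : PowerSeries K}
    (hF : IsBranch F X 0) : Associated F (MvPowerSeries.X 1) :=
  hF.associated_of_dvd isBranch_X1 ((hF.ker _).1
    (evalAt_X1 hF.param.constantCoeff_fst (map_zero _)))

theorem onFace_of_associated_X {F : MvPowerSeries (Fin 2) K} {i : Fin 2}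
    (h : Associated F (MvPowerSeries.X i)) (p q : ℕ) : OnFace F p q (Finsupp.single i 1) := by
  obtain ⟨u, hu⟩ := h.symm
  rw [← hu]
  have h1 : ∀ p q, OnFace (MvPowerSeries.X i : MvPowerSeries (Fin 2) K) p q
      (Finsupp.single i 1) := fun p q => by simpa using onFace_X_pow (K := K) i 1 p q
  exact (h1 p q).mul_isUnit u.isUnit h1

/-- By symmetry the order of F on x = 0 is ord X = kp, which locates the upper end of the segment.
-/
theorem EdgeAt.onFace_upper [IsAlgClosed K] {F : MvPowerSeries (Fin 2) K} {X Y : PowerSeries K}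
    {s : HNStep K} {k : ℕ} (h : EdgeAt X Y s k) (hF : IsBranch F X Y) :
    OnFace F 1 0 (expo 0 (k * s.p)) ∧ OnFace F s.p s.q (expo 0 (k * s.p)) := by
  have hc : MvPowerSeries.coeff (expo 0 (k * s.p)) F ≠ 0 := by
    obtain ⟨u, -, -, hu⟩ := exists_of_order_eq ((hF.order_evalAt_zero_X h.X_ne).trans h.ordX)
    rwa [coeff_evalAt_zero_X] at hu
  refine ⟨⟨hc, by simp⟩, ?_⟩
  obtain ⟨A, -, hA⟩ := h.hasMult hF
  refine (hA.onFace_iff _).2 ⟨hc, ?_⟩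
  simp only [expo_zero, expo_one]; ring

theorem EdgeAt.onFace_lower [IsAlgClosed K] {F : MvPowerSeries (Fin 2) K} {X Y : PowerSeries K}
    {s : HNStep K} {k : ℕ} (h : EdgeAt X Y s k) (hF : IsBranch F X Y) :
    OnFace F s.p s.q (expo (k * s.q) 0) ∧ OnFace F 0 1 (expo (k * s.q) 0) := by
  have hc : MvPowerSeries.coeff (expo (k * s.q) 0) F ≠ 0 := by
    obtain ⟨u, -, -, hu⟩ := exists_of_order_eq ((hF.order_evalAt_X_zero h.Y_ne).trans h.ordY)
    rwa [coeff_evalAt_X_zero] at hu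
  refine ⟨?_, ⟨hc, by simp⟩⟩
  obtain ⟨A, -, hA⟩ := h.hasMult hF
  refine (hA.onFace_iff _).2 ⟨hc, ?_⟩
  simp only [expo_zero, expo_one]; ring

/-- The point of the Newton polygon of a branch on a face above its edge. -/
theorem EdgeAt.single_upper [IsAlgClosed K] {F : MvPowerSeries (Fin 2) K} {X Y : PowerSeries K}
    {s : HNStep K} {k : ℕ} (h : EdgeAt X Y s k) (hF : IsBranch F X Y) {p q : ℕ}
    (hpq : s.p * q < p * s.q) (hq : 0 < q) (e : Fin 2 →₀ ℕ) :
    OnFace F p q e ↔ e = expo 0 (k * s.p) :=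
  onFace_convex (by simpa using hq) hpq (h.onFace_upper hF).1 (h.onFace_upper hF).2 e

/-- The point of the Newton polygon of a branch on a face below its edge. -/
theorem EdgeAt.single_lower [IsAlgClosed K] {F : MvPowerSeries (Fin 2) K} {X Y : PowerSeries K}
    {s : HNStep K} {k : ℕ} (h : EdgeAt X Y s k) (hF : IsBranch F X Y) {p q : ℕ}
    (hpq : p * s.q < s.p * q) (hp : 0 < p) (e : Fin 2 →₀ ℕ) :
    OnFace F p q e ↔ e = expo (k * s.q) 0 :=
  onFace_convex hpq (by simpa using hp) (h.onFace_lower hF).1 (h.onFace_lower hF).2 e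

theorem single_of_associated_X {F : MvPowerSeries (Fin 2) K} {i : Fin 2}
    (h : Associated F (MvPowerSeries.X i)) {p q : ℕ} (hp : 0 < p) (hq : 0 < q)
    (e : Fin 2 →₀ ℕ) : OnFace F p q e ↔ e = Finsupp.single i 1 :=
  onFace_convex (p₁ := 1) (q₁ := 0) (p₃ := 0) (q₃ := 1) (by simpa using hq) (by simpa using hp)
    (onFace_of_associated_X h _ _) (onFace_of_associated_X h _ _) e

theorem eq_of_coprime_of_mul_eq {p q p' q' : ℕ} (h : p.Coprime q) (h' : p'.Coprime q')
    (he : p' * q = p * q') : p = p' ∧ q = q' := by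
  have h1 : p ∣ p' := h.dvd_of_dvd_mul_right (Dvd.intro _ he.symm)
  have h2 : p' ∣ p := h'.dvd_of_dvd_mul_right (Dvd.intro _ he)
  have h3 : q ∣ q' := h.symm.dvd_of_dvd_mul_left (Dvd.intro_left _ he)
  have h4 : q' ∣ q := h'.symm.dvd_of_dvd_mul_left (Dvd.intro_left _ he.symm)
  exact ⟨Nat.dvd_antisymm h1 h2, Nat.dvd_antisymm h3 h4⟩

/-- The Newton polygon of a branch has no other edge than the one given by its tangent. -/
theorem IsBranch.exists_single [IsAlgClosed K] {F : MvPowerSeries (Fin 2) K}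
    {X Y : PowerSeries K} (hF : IsBranch F X Y) {p q : ℕ} (hp : 0 < p) (hq : 0 < q)
    (hpq : p.Coprime q) (h : ∀ s k, EdgeAt X Y s k → ¬ (s.p = p ∧ s.q = q)) :
    ∃ d, ∀ e, OnFace F p q e ↔ e = d := by
  by_cases hX : X = 0
  · subst hX
    exact ⟨_, single_of_associated_X hF.associated_X0 hp hq⟩
  by_cases hY : Y = 0
  · subst hY
    exact ⟨_, single_of_associated_X hF.associated_X1 hp hq⟩
  obtain ⟨s, k, hs⟩ := exists_edgeAt hF.param.constantCoeff_fst hF.param.constantCoeff_snd hX hY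
  rcases lt_trichotomy (s.p * q) (p * s.q) with h1 | h1 | h1
  · exact ⟨_, hs.single_upper hF h1 hq⟩
  · exact absurd (eq_of_coprime_of_mul_eq hpq hs.adm.coprime h1) fun h2 =>
      h s k hs ⟨h2.1.symm, h2.2.symm⟩
  · exact ⟨_, hs.single_lower hF h1 hp⟩

/-- The binomials which do not belong to a branch do not divide its face polynomials. -/
theorem IsBranch.hasMult_zero [IsAlgClosed K] {F : MvPowerSeries (Fin 2) K}
    {X Y : PowerSeries K} (hF : IsBranch F X Y) {s : HNStep K} (hs : s.Admissible)
    (h : ∀ k, ¬ EdgeAt X Y s k) : ∃ W, HasMult F s W 0 := by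
  by_cases h' : ∀ t k, EdgeAt X Y t k → ¬ (t.p = s.p ∧ t.q = s.q)
  · obtain ⟨d, hd⟩ := hF.exists_single hs.p_pos hs.q_pos hs.coprime h'
    exact ⟨_, hasMult_zero_of_single hs hd⟩
  · push Not at h'
    obtain ⟨⟨p, q, μ⟩, k, ht, hp, hq⟩ := h'
    obtain ⟨p', q', μ'⟩ := s
    obtain rfl : p = p' := hp
    obtain rfl : q = q' := hq
    have hne : μ ≠ μ' := by
      rintro rfl
      exact h k ht
    obtain ⟨c, hc, hc'⟩ := hF.exists_isInit ht.adm.p_pos ht.adm.q_pos ht.adm.coprime ht.ordX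
      ht.ordY ht.lc
    refine ⟨_, _, ?_, by simpa using hc'⟩
    rw [map_mul, map_pow, HNStep.point, eval_binomP, MvPolynomial.eval_C]
    exact mul_ne_zero hc (pow_ne_zero _ (hs.binom_ne hne))

end NewtonTree

end

noncomputable section

namespace NewtonTree

variable {K : Type*} [Field K]

/-! ### Branches at infinitely near points -/

/-- The exponent of the exceptional divisor in the total transform of a branch, divided by the
intersection multiplicity of its strict transform with the exceptional divisor. -/
def excMult : List (HNStep K) → ℕ
  | [] => 0
  | s :: L => s.p * upper L s.p s.q

omit [Field K] in
theorem upper_eq (L : List (HNStep K)) (p q : ℕ) : upper L p q = q + excMult L * p := by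
  cases L <;> simp [upper, excMult]

/-- The strict transform `F` of the branch `f` after the maps in `L`, parametrized by `(X, Y)`,
a lift of the parametrization `(φ, ψ)` of `f`. -/
structure Lift (f : MvPowerSeries (Fin 2) K) (φ ψ : PowerSeries K) (L : List (HNStep K))
    (F : MvPowerSeries (Fin 2) K) (X Y : PowerSeries K) : Prop where
  adm : ∀ s ∈ L, s.Admissible
  branch : IsBranch F X Y
  transform_eq : ∃ u : MvPowerSeries (Fin 2) K, IsUnit u ∧
    transform f L = MvPowerSeries.X 0 ^ (excMult L * X.order.toNat) * (u * F)
  eval : ∀ h, evalAt (transform h L) X Y = evalAt h φ ψ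
  ne : L ≠ [] → X ≠ 0

theorem IsBranch.lift_nil {f : MvPowerSeries (Fin 2) K} {φ ψ : PowerSeries K}
    (h : IsBranch f φ ψ) : Lift f φ ψ [] f φ ψ :=
  ⟨by simp, h, ⟨1, isUnit_one, by simp [transform, excMult]⟩, fun _ => rfl, fun h => absurd rfl h⟩

variable [IsAlgClosed K] {f : MvPowerSeries (Fin 2) K} {φ ψ : PowerSeries K}
  {L : List (HNStep K)} {F : MvPowerSeries (Fin 2) K} {X Y : PowerSeries K}

/-- Origin of the decorations. With e = `excMult L` and X of order kp, the old divisor contributes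
p·e·kp and the branch k·pq to the new exponent. The sum is k·p(q + ep), that is, k times `excMult (s
:: L)`. -/
theorem Lift.cons (h : Lift f φ ψ L F X Y) {s : HNStep K} {k : ℕ} (e : EdgeAt X Y s k) :
    ∃ F' X' Y', Lift f φ ψ (s :: L) F' X' Y' ∧ X'.order = k := by
  obtain ⟨F', X', Y', hB, hk, hF', hX, hY⟩ := e.exists_branch h.branch
  obtain ⟨u, hu, hf⟩ := h.transform_eq
  obtain ⟨v, hv, hv'⟩ := e.adm.subst_X0_pow (excMult L * X.order.toNat)
  refine ⟨F', X', Y', ⟨List.forall_mem_cons.2 ⟨e.adm, h.adm⟩, hB,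
    ⟨v * MvPowerSeries.subst s.subst u, hv.mul (e.adm.isUnit_subst.2 hu), ?_⟩, fun g => ?_,
    fun _ => ?_⟩, hk⟩
  · rw [transform, hf, e.adm.subst_mul, e.adm.subst_mul, hv', hF', hk, e.ordX, ENat.toNat_natCast,
      ENat.toNat_natCast, excMult, upper_eq]
    ring
  · rw [transform, evalAt_subst_step e.adm hB.param.constantCoeff_fst hB.param.constantCoeff_snd,
      ← hX, ← hY, h.eval]
  · rintro rfl
    rw [PowerSeries.order_zero] at hk
    exact ENat.top_ne_natCast _ hk

/-- If s is not the tangent, its binomial does not divide the initial form of F, so the strict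
transform is a unit at the new point. -/
theorem Lift.isOut_cons (h : Lift f φ ψ L F X Y) {s : HNStep K} (hs : s.Admissible)
    (hn : ∀ k, ¬ EdgeAt X Y s k) : IsOut f (s :: L) := by
  obtain ⟨W, hW⟩ := h.branch.hasMult_zero hs hn
  obtain ⟨G, hG, hG'⟩ := hW.exists_subst hs
  obtain ⟨u, hu, hf⟩ := h.transform_eq
  obtain ⟨v, hv, hv'⟩ := hs.subst_X0_pow (excMult L * X.order.toNat)
  refine ⟨s.p * (excMult L * X.order.toNat) + W, v * MvPowerSeries.subst s.subst u * G,
    (hv.mul (hs.isUnit_subst.2 hu)).mul ?_, ?_⟩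
  · rw [MvPowerSeries.isUnit_iff_constantCoeff, isUnit_iff_ne_zero]
    intro h0
    have h1 := constantCoeff_evalAt (map_zero _) PowerSeries.constantCoeff_X G
    rw [h0] at h1
    exact (PowerSeries.order_ne_zero_iff_constCoeff_eq_zero.2 h1) (by rw [hG']; rfl)
  · rw [transform, hf, hs.subst_mul, hs.subst_mul, hv', hG]
    ring

/-- The dichotomy behind all later case distinctions: at each step either s is the tangent and the
branch passes through the new point, or it leaves for good. -/
theorem exists_lift_or_isOut (hf : IsBranch f φ ψ) (hL : ∀ s ∈ L, s.Admissible) :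
    (∃ F X Y, Lift f φ ψ L F X Y) ∨ IsOut f L := by
  induction L with
  | nil => exact Or.inl ⟨_, _, _, hf.lift_nil⟩
  | cons s L ih =>
    rw [List.forall_mem_cons] at hL
    rcases ih hL.2 with ⟨F, X, Y, h⟩ | h
    · by_cases hn : ∀ k, ¬ EdgeAt X Y s k
      · exact Or.inr (h.isOut_cons hL.1 hn)
      · push Not at hn
        obtain ⟨k, hk⟩ := hn
        obtain ⟨F', X', Y', h', -⟩ := h.cons hk
        exact Or.inl ⟨_, _, _, h'⟩
    · exact Or.inr (h.cons hL.1)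

omit [IsAlgClosed K] in
theorem Lift.not_X0_dvd (h : Lift f φ ψ L F X Y) (hX : X ≠ 0) : ¬ MvPowerSeries.X 0 ∣ F :=
  h.branch.not_dvd (not_isUnit_of_constantCoeff (by simp))
    (by rwa [evalAt_X0 h.branch.param.constantCoeff_fst h.branch.param.constantCoeff_snd])

omit [IsAlgClosed K] in
/-- A power of the exceptional divisor can be cancelled. -/
theorem eq_of_X0_pow_mul_eq {a b : ℕ} {A B : MvPowerSeries (Fin 2) K}
    (h : MvPowerSeries.X 0 ^ a * A = MvPowerSeries.X 0 ^ b * B) (hA : ¬ MvPowerSeries.X 0 ∣ A)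
    (hB : ¬ MvPowerSeries.X 0 ∣ B) : a = b ∧ A = B := by
  have h0 : (MvPowerSeries.X 0 : MvPowerSeries (Fin 2) K) ≠ 0 := X0_prime.ne_zero
  have key : ∀ {a b : ℕ} {A B : MvPowerSeries (Fin 2) K},
      MvPowerSeries.X 0 ^ a * A = MvPowerSeries.X 0 ^ b * B → ¬ MvPowerSeries.X 0 ∣ A →
      b ≤ a := by
    intro a b A B h hA
    by_contra! hlt
    obtain ⟨c, rfl⟩ := Nat.exists_eq_add_of_lt hlt
    rw [show a + c + 1 = a + (c + 1) by ring, pow_add, mul_assoc] at h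
    exact hA ⟨MvPowerSeries.X 0 ^ c * B, by
      rw [mul_left_cancel₀ (pow_ne_zero _ h0) h]; ring⟩
  have hab := le_antisymm (key h.symm hB) (key h hA)
  subst hab
  exact ⟨rfl, mul_left_cancel₀ (pow_ne_zero _ h0) h⟩

omit [IsAlgClosed K] in
theorem not_X0_dvd_of_isUnit {u : MvPowerSeries (Fin 2) K} (hu : IsUnit u) :
    ¬ MvPowerSeries.X 0 ∣ u := fun h => X0_prime.not_isUnit (isUnit_of_dvd_unit h hu)

omit [IsAlgClosed K] in
theorem not_X0_dvd_unit_mul {u F : MvPowerSeries (Fin 2) K} (hu : IsUnit u)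
    (hF : ¬ MvPowerSeries.X 0 ∣ F) : ¬ MvPowerSeries.X 0 ∣ u * F := by
  rwa [hu.dvd_mul_left]

omit [IsAlgClosed K] in
theorem Lift.not_isOut (h : Lift f φ ψ L F X Y) (hX : X ≠ 0) : ¬ IsOut f L := by
  rintro ⟨N, v, hv, h'⟩
  obtain ⟨u, hu, hf⟩ := h.transform_eq
  have := (eq_of_X0_pow_mul_eq (hf.symm.trans h') (not_X0_dvd_unit_mul hu (h.not_X0_dvd hX))
    (not_X0_dvd_of_isUnit hv)).2
  exact h.branch.not_isUnit (isUnit_of_mul_isUnit_right (this ▸ hv))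

theorem Lift.tail {s : HNStep K} (h : Lift f φ ψ (s :: L) F X Y) (hf : IsBranch f φ ψ) :
    ∃ F' X' Y', Lift f φ ψ L F' X' Y' := by
  have hs := List.forall_mem_cons.1 h.adm
  refine (exists_lift_or_isOut hf hs.2).resolve_right fun h' => ?_
  exact h.not_isOut (h.ne (by simp)) (h'.cons hs.1)

theorem Lift.exists_edgeAt {s : HNStep K} (h : Lift f φ ψ (s :: L) F X Y)
    {F' : MvPowerSeries (Fin 2) K} {X' Y' : PowerSeries K} (h' : Lift f φ ψ L F' X' Y') :
    ∃ k, EdgeAt X' Y' s k := by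
  by_contra! hn
  exact h.not_isOut (h.ne (by simp)) (h'.isOut_cons (List.forall_mem_cons.1 h.adm).1 hn)

/-- The points followed by a branch form a chain. -/
theorem Lift.suffix_or {L' : List (HNStep K)} {F' : MvPowerSeries (Fin 2) K}
    {X' Y' : PowerSeries K} (hf : IsBranch f φ ψ) (h : Lift f φ ψ L F X Y)
    (h' : Lift f φ ψ L' F' X' Y') : L <:+ L' ∨ L' <:+ L := by
  induction L generalizing F X Y L' F' X' Y' with
  | nil => exact Or.inl (List.nil_suffix)
  | cons s L ih =>
    obtain ⟨F₁, X₁, Y₁, h₁⟩ := h.tail hf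
    rcases ih h₁ h' with ⟨M, hM⟩ | hs
    · rcases List.eq_nil_or_concat M with rfl | ⟨M', t, rfl⟩
      · rw [List.nil_append] at hM
        exact Or.inr (hM ▸ List.suffix_cons _ _)
      · left
        have h₂ : ∃ F X Y, Lift f φ ψ (t :: L) F X Y := by
          have : ∀ (M' : List (HNStep K)) {F X Y}, Lift f φ ψ (M' ++ t :: L) F X Y →
              ∃ F X Y, Lift f φ ψ (t :: L) F X Y := by
            intro M'
            induction M' with
            | nil => exact fun h => ⟨_, _, _, h⟩
            | cons r M' ihM =>
              intro F X Y h
              obtain ⟨_, _, _, h''⟩ := h.tail hf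
              exact ihM h''
          refine this M' (F := F') (X := X') (Y := Y') ?_
          rw [← hM] at h'
          simpa using h'
        obtain ⟨F₂, X₂, Y₂, h₂⟩ := h₂
        obtain ⟨k, hk⟩ := h.exists_edgeAt h₁
        obtain ⟨l, hl⟩ := h₂.exists_edgeAt h₁
        rw [hk.unique hl]
        exact ⟨M', by rw [← hM]; simp⟩
    · exact Or.inr (hs.trans (List.suffix_cons _ _))

omit [IsAlgClosed K] in
theorem Lift.order_ne_top (h : Lift f φ ψ L F X Y) (hX : X ≠ 0) :
    ∃ n : ℕ, 0 < n ∧ X.order = n := by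
  obtain ⟨n, hn⟩ := ENat.ne_top_iff_exists.1 (PowerSeries.order_eq_top.not.2 hX)
  refine ⟨n, Nat.pos_of_ne_zero fun h0 => ?_, hn.symm⟩
  subst h0
  exact (PowerSeries.order_ne_zero_iff_constCoeff_eq_zero.2 h.branch.param.constantCoeff_fst)
    hn.symm

omit [IsAlgClosed K] in
/-- At sufficiently many infinitely near points a power series becomes a power of the exceptional
divisor. -/
theorem Lift.dvd_order (h : Lift f φ ψ L F X Y) {a : MvPowerSeries (Fin 2) K} {n : ℕ}
    (ha : (evalAt a φ ψ).order = n) (hn : n < L.length) {k : ℕ} (hk : X.order = k) :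
    k ∣ n ∧ IsOut a L := by
  have hc := h.branch.param.constantCoeff_fst
  have hd := h.branch.param.constantCoeff_snd
  have hL : L ≠ [] := by rintro rfl; simp at hn
  obtain ⟨m, hm, hm'⟩ := h.order_ne_top (h.ne hL)
  obtain rfl : k = m := by exact_mod_cast hk.symm.trans hm'
  obtain ⟨N, a', hN, hN'⟩ := exists_transform_eq h.adm a
  have h1 := h.eval a
  rw [hN, evalAt_mul hc hd, evalAt_pow hc hd, evalAt_X0 hc hd] at h1
  have h2 := congrArg PowerSeries.order h1
  rw [PowerSeries.order_mul, PowerSeries.order_pow, hk, ha] at h2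
  -- Evaluation gives n = N·k + ord a'(X,Y), hence N ≤ n, below the length of L; so a' must be a
  -- unit and n = N·k.
  have hle : N ≤ n := by
    have h3 : ((N * k : ℕ) : ℕ∞) ≤ n := by
      rw [← h2]; push_cast; rw [nsmul_eq_mul]; exact le_self_add
    have h3' : N * k ≤ n := by exact_mod_cast h3
    exact (Nat.le_mul_of_pos_right N hm).trans h3'
  have hu := hN'.resolve_right (by omega)
  have h3 : (evalAt a' X Y).order = 0 := by
    have := evalAt_isUnit hc hd hu
    rw [← PowerSeries.order_zero_of_unit this]
  rw [h3, add_zero, nsmul_eq_mul] at h2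
  exact ⟨Dvd.intro_left N (by exact_mod_cast h2), N, a', hu, hN⟩

omit [IsAlgClosed K] in
/-- Far up the points followed by a branch, it is transversal to the exceptional divisor and
separated from a given series. -/
theorem exists_length_bound (hf : IsBranch f φ ψ) {g : MvPowerSeries (Fin 2) K}
    (hg : evalAt g φ ψ ≠ 0) : ∃ M : ℕ, ∀ L F X Y, Lift f φ ψ L F X Y → M < L.length →
      X.order = 1 ∧ IsOut g L := by
  -- Far up, ord X divides the orders n + 1 and n of the values of a and b, hence is 1.
  obtain ⟨a, b, hb, hab⟩ := hf.param.exists_order_eq_add_one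
  obtain ⟨n, hn⟩ := ENat.ne_top_iff_exists.1 (PowerSeries.order_eq_top.not.2 hb)
  obtain ⟨m, hm⟩ := ENat.ne_top_iff_exists.1 (PowerSeries.order_eq_top.not.2 hg)
  rw [← hn] at hab
  refine ⟨max m (n + 1), fun L F X Y h hM => ?_⟩
  rw [max_lt_iff] at hM
  have hL : L ≠ [] := by rintro rfl; simp at hM
  obtain ⟨k, hk, hk'⟩ := h.order_ne_top (h.ne hL)
  have h1 := (h.dvd_order hn.symm (by omega) hk').1
  have h2 := (h.dvd_order (a := a) (n := n + 1) (by rw [hab]; push_cast; rfl) hM.2 hk').1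
  have h3 := h.dvd_order hm.symm hM.1 hk'
  have h4 : k = 1 := Nat.dvd_one.1 ((Nat.dvd_add_right h1).1 h2)
  rw [hk', h4]
  exact ⟨rfl, h3.2⟩

end NewtonTree

end

noncomputable section

namespace NewtonTree

variable {K : Type*} [Field K] {h : MvPowerSeries (Fin 2) K}

/-! ### Newton trees are forests -/

/-- The maps leading to the Newton polygon at which a node is created; for an arrowhead of a factor
of exponent one, the maps leading to the point that it represents. -/
def Node.chart : Node K → List (HNStep K)
  | .vertex L _ _ => L
  | .arrow L s => s :: L
  | .top => []
  | .bottom L => L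

theorem IsEdge.not_single {p q : ℕ} (he : IsEdge h p q) {d : Fin 2 →₀ ℕ}
    (hd : ∀ e, OnFace h p q e ↔ e = d) : False := by
  obtain ⟨-, -, -, a, b, hab, ha, hb⟩ := he
  exact hab (((hd a).1 ha).trans ((hd b).1 hb).symm)

/-- A compact edge does not lie between two faces which intersect. -/
theorem Meets.not_between {p₁ q₁ p₂ q₂ p₃ q₃ : ℕ} (hm : Meets h p₁ q₁ p₃ q₃)
    (he : IsEdge h p₂ q₂) (h12 : p₂ * q₁ < p₁ * q₂) (h23 : p₃ * q₂ < p₂ * q₃) : False := by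
  obtain ⟨d, h1, h3⟩ := hm
  exact he.not_single (onFace_convex h12 h23 h1 h3)

theorem eq_of_meets_above {p₁ q₁ p₂ q₂ p₃ q₃ : ℕ} (h1 : IsEdge h p₁ q₁) (h2 : IsEdge h p₂ q₂)
    (h13 : p₃ * q₁ < p₁ * q₃) (h23 : p₃ * q₂ < p₂ * q₃)
    (m1 : Meets h p₁ q₁ p₃ q₃) (m2 : Meets h p₂ q₂ p₃ q₃) : p₁ = p₂ ∧ q₁ = q₂ := by
  rcases lt_trichotomy (p₂ * q₁) (p₁ * q₂) with h12 | h12 | h12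
  · exact (m1.not_between h2 h12 h23).elim
  · exact eq_of_coprime_of_mul_eq h1.2.2.1 h2.2.2.1 h12
  · exact (m2.not_between h1 h12 h13).elim

theorem eq_of_meets_below {p₁ q₁ p₂ q₂ p₃ q₃ : ℕ} (h2 : IsEdge h p₂ q₂) (h3 : IsEdge h p₃ q₃)
    (h12 : p₂ * q₁ < p₁ * q₂) (h13 : p₃ * q₁ < p₁ * q₃)
    (m2 : Meets h p₁ q₁ p₂ q₂) (m3 : Meets h p₁ q₁ p₃ q₃) : p₂ = p₃ ∧ q₂ = q₃ := by
  rcases lt_trichotomy (p₃ * q₂) (p₂ * q₃) with h23 | h23 | h23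
  · exact (m3.not_between h2 h12 h23).elim
  · exact eq_of_coprime_of_mul_eq h2.2.2.1 h3.2.2.1 h23
  · exact (m2.not_between h3 h13 h23).elim

/-- Two different parents in the same polygon would put a compact edge strictly between two faces
which intersect, against convexity. The top arrowhead and a gluing vertex act as the vertical face
(1, 0). -/
theorem TreeEdge.parent_unique {u u' x : Node K} (hu : TreeEdge h u x) (hu' : TreeEdge h u' x) :
    u = u' := by
  cases hu with
  | topBottom m =>
    cases hu' with
    | topBottom => rfl
    | vertexBottom _ p q _ e m' =>
      exact (m.not_between e (by simpa using e.2.1) (by simpa using e.1)).elim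
  | topVertex p q e m =>
    cases hu' with
    | topVertex => rfl
    | vertical _ p' q' _ _ _ e' _ hlt m' =>
      exact (m.not_between e' (by simpa using e'.2.1) hlt).elim
  | vertical L p q p' q' _ e e' hlt m =>
    cases hu' with
    | topVertex _ _ _ m' => exact (m'.not_between e (by simpa using e.2.1) hlt).elim
    | vertical _ p₁ q₁ _ _ _ e₁ _ hlt' m' =>
      obtain ⟨rfl, rfl⟩ := eq_of_meets_above e e₁ hlt hlt' m m'
      rfl
    | glue L s _ _ _ _ m' => exact (m'.not_between e (by simpa using e.2.1) hlt).elim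
  | vertexBottom L p q _ e m =>
    cases hu' with
    | topBottom m' => exact (m'.not_between e (by simpa using e.2.1) (by simpa using e.1)).elim
    | vertexBottom _ p₁ q₁ _ e₁ m₁ =>
      obtain ⟨rfl, rfl⟩ := eq_of_meets_above e e₁ (by simpa using e.1) (by simpa using e₁.1) m m₁
      rfl
  | vertexArrow L s _ => cases hu'; rfl
  | glue L s p q _ e m =>
    cases hu' with
    | vertical _ p' q' _ _ _ e' _ hlt m' =>
      exact (m.not_between e' (by simpa using e'.2.1) hlt).elim
    | glue => rfl

/-- The same convexity argument below a vertex; the condition on the chart discards the edges going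
right. -/
theorem TreeEdge.down_unique {L : List (HNStep K)} {p q : ℕ} {b b' : Node K}
    (hb : TreeEdge h (.vertex L p q) b) (hb' : TreeEdge h (.vertex L p q) b')
    (hc : b.chart = L) (hc' : b'.chart = L) : b = b' := by
  have hne : ∀ s : HNStep K, s :: L ≠ L := fun s => List.cons_ne_self s L
  cases hb with
  | vertical _ _ _ p' q' _ e e' hlt m =>
    cases hb' with
    | vertical _ _ _ p₁ q₁ _ _ e₁ hlt' m' =>
      obtain ⟨rfl, rfl⟩ := eq_of_meets_below e' e₁ hlt hlt' m m'
      rfl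
    | vertexBottom _ _ _ _ _ m' =>
      exact (m'.not_between e' hlt (by simpa using e'.1)).elim
    | vertexArrow _ s _ => exact (hne s hc').elim
    | glue _ s => exact (hne s hc').elim
  | vertexBottom _ _ _ _ e m =>
    cases hb' with
    | vertical _ _ _ p₁ q₁ _ _ e₁ hlt' m' =>
      exact (m.not_between e₁ hlt' (by simpa using e₁.1)).elim
    | vertexBottom => rfl
    | vertexArrow _ s _ => exact (hne s hc').elim
    | glue _ s => exact (hne s hc').elim
  | vertexArrow _ s _ => exact (hne s hc).elim
  | glue _ s => exact (hne s hc).elim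

/-- A rank which increases along the edges of a Newton tree. -/
def Node.rank : Node K → ℕ ×ₗ WithTop ℚ
  | .vertex L p q => toLex (L.length, ((q / p : ℚ) : WithTop ℚ))
  | .arrow L _ => toLex (L.length + 1, 0)
  | .top => toLex (0, ((-1 : ℚ) : WithTop ℚ))
  | .bottom L => toLex (L.length, ⊤)

theorem TreeEdge.rank_lt {x y : Node K} (e : TreeEdge h x y) : x.rank < y.rank := by
  cases e with
  | topBottom => exact Prod.Lex.toLex_lt_toLex.2 (Or.inr ⟨rfl, WithTop.coe_lt_top _⟩)
  | topVertex p q =>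
    refine Prod.Lex.toLex_lt_toLex.2 (Or.inr ⟨rfl, WithTop.coe_lt_coe.2 ?_⟩)
    exact lt_of_lt_of_le (neg_lt_zero.2 one_pos) (by positivity)
  | vertical L p q p' q' _ e e' hlt =>
    refine Prod.Lex.toLex_lt_toLex.2 (Or.inr ⟨rfl, WithTop.coe_lt_coe.2 ?_⟩)
    rw [div_lt_div_iff₀ (by exact_mod_cast e.1) (by exact_mod_cast e'.1)]
    have : q * p' < q' * p := by linarith
    exact_mod_cast this
  | vertexBottom => exact Prod.Lex.toLex_lt_toLex.2 (Or.inr ⟨rfl, WithTop.coe_lt_top _⟩)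
  | vertexArrow => exact Prod.Lex.toLex_lt_toLex.2 (Or.inl (Nat.lt_succ_self _))
  | glue => exact Prod.Lex.toLex_lt_toLex.2 (Or.inl (Nat.lt_succ_self _))

theorem adj_iff {x y : Node K} :
    (newtonTree h).Adj x y ↔ TreeEdge h x y ∨ TreeEdge h y x := by
  rw [newtonTree, SimpleGraph.fromRel_adj]
  refine ⟨And.right, fun e => ⟨?_, e⟩⟩
  rintro rfl
  rcases e with e | e <;> exact lt_irrefl _ e.rank_lt

theorem TreeEdge.adj {x y : Node K} (e : TreeEdge h x y) : (newtonTree h).Adj x y :=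
  adj_iff.2 (Or.inl e)

/-- On a cycle a node of maximal rank would have two distinct neighbours of smaller rank, both of
them its parents. -/
theorem newtonTree_isAcyclic (h : MvPowerSeries (Fin 2) K) : (newtonTree h).IsAcyclic := by
  classical
  intro v c hc
  obtain ⟨x, hx, hmax⟩ := c.support.toFinset.exists_max_image Node.rank ⟨v, by simp⟩
  rw [List.mem_toFinset] at hx
  have hc' := hc.rotate hx
  have hsup : ∀ y ∈ (c.rotate x hx).support, y.rank ≤ x.rank := fun y hy =>
    hmax y (by simpa [SimpleGraph.Walk.mem_support_rotate_iff] using hy)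
  set c' := c.rotate x hx
  have key : ∀ y ∈ c'.support, (newtonTree h).Adj x y → TreeEdge h y x := fun y hy hxy =>
    (adj_iff.1 hxy).resolve_left fun e => absurd e.rank_lt (hsup y hy).not_gt
  have h1 := key _ (c'.getVert_mem_support _) (c'.adj_snd hc'.not_nil)
  have h2 := key _ (c'.getVert_mem_support _) (c'.adj_penultimate hc'.not_nil).symm
  exact hc'.snd_ne_penultimate (h1.parent_unique h2)

/-! ### The product of the decorations adjacent to a path -/

theorem decoration_parent {u : Node K} {L : List (HNStep K)} {p q : ℕ}
    (e : TreeEdge h u (.vertex L p q)) : decoration (.vertex L p q) u = upper L p q := by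
  cases e with
  | topVertex => rfl
  | vertical _ p' q' _ _ _ _ _ hlt => simp [decoration, hlt.le]
  | glue L s => simp [decoration]

theorem decoration_down {b : Node K} {L : List (HNStep K)} {p q : ℕ}
    (e : TreeEdge h (.vertex L p q) b) (hc : b.chart = L) :
    decoration (.vertex L p q) b = p := by
  cases e with
  | vertical _ _ _ p' q' _ _ _ hlt => simp [decoration, hlt]
  | vertexBottom => rfl
  | vertexArrow _ s _ => exact (List.cons_ne_self s L hc).elim
  | glue _ s => exact (List.cons_ne_self s L hc).elim

theorem decoration_right {b : Node K} {L : List (HNStep K)} {p q : ℕ}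
    (e : TreeEdge h (.vertex L p q) b) (hc : b.chart ≠ L) :
    decoration (.vertex L p q) b = 1 := by
  cases e with
  | vertical _ _ _ p' q' _ _ _ hlt => exact (hc rfl).elim
  | vertexBottom => exact (hc rfl).elim
  | vertexArrow _ s _ => rfl
  | glue _ s => simp [decoration]

open Classical in
/-- The contribution of a vertex with parent `u` and lower neighbour `b`. -/
theorem finprod_decoration {L : List (HNStep K)} {p q : ℕ} {u b : Node K}
    (hu : TreeEdge h u (.vertex L p q)) (hb : TreeEdge h (.vertex L p q) b) (hc : b.chart = L)
    (S : Node K → Prop) :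
    ∏ᶠ y ∈ {y | (newtonTree h).Adj (.vertex L p q) y ∧ ¬ S y}, decoration (.vertex L p q) y =
      (if S u then 1 else upper L p q) * (if S b then 1 else p) := by
  have hub : u ≠ b := by
    rintro rfl
    exact lt_asymm hu.rank_lt hb.rank_lt
  rw [finprod_mem_def, finprod_eq_finsetProd_of_mulSupport_subset (s := {u, b}),
    Finset.prod_pair hub, Set.mulIndicator_apply, Set.mulIndicator_apply]
  · congr 1
    · rw [decoration_parent hu]
      by_cases hS : S u <;> simp [hS, adj_iff, hu]
    · rw [decoration_down hb hc]
      by_cases hS : S b <;> simp [hS, adj_iff, hb]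
  · intro y hy
    rw [Function.mem_mulSupport] at hy
    have hy1 := Set.mem_of_mulIndicator_ne_one hy
    rw [Set.mulIndicator_of_mem hy1] at hy
    rcases adj_iff.1 hy1.1 with e | e
    · by_cases hyc : y.chart = L
      · simp [e.down_unique hb hyc hc]
      · exact absurd (decoration_right e hyc) hy
    · simp [e.parent_unique hu]

theorem rho_reverse {α β : Node K} (w : (newtonTree h).Walk α β) : rho w.reverse = rho w := by
  classical
  have hp : ({β, α} : Finset (Node K)) = {α, β} := Finset.pair_comm β α
  simp only [rho, SimpleGraph.Walk.support_reverse, SimpleGraph.Walk.edges_reverse,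
    List.toFinset_reverse, List.mem_reverse]
  convert rfl using 3
  convert hp.symm

theorem rho_cons_nil {u v : Node K} (e : (newtonTree h).Adj u v) :
    rho (SimpleGraph.Walk.cons e SimpleGraph.Walk.nil) = 1 := by
  simp [rho]

theorem rho_nil (u : Node K) : rho (SimpleGraph.Walk.nil : (newtonTree h).Walk u u) = 1 := by
  simp [rho]

/-- Prepending u makes v an inner vertex and changes nothing at the others, since u does not lie on
w. -/
theorem rho_cons {u v β : Node K} (e : (newtonTree h).Adj u v) (w : (newtonTree h).Walk v β)
    (hw : (SimpleGraph.Walk.cons e w).IsPath) (hv : v ≠ β) :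
    rho (SimpleGraph.Walk.cons e w) =
      (∏ᶠ y ∈ {y | (newtonTree h).Adj v y ∧ ¬ s(v, y) ∈ (SimpleGraph.Walk.cons e w).edges},
        decoration v y) * rho w := by
  classical
  obtain ⟨hw', hu⟩ := (SimpleGraph.Walk.cons_isPath_iff _ _).1 hw
  have hset : (SimpleGraph.Walk.cons e w).support.toFinset \ {u, β} =
      insert v (w.support.toFinset \ {v, β}) := by
    ext x
    simp only [SimpleGraph.Walk.support_cons, List.toFinset_cons, Finset.mem_sdiff,
      Finset.mem_insert, List.mem_toFinset, Finset.mem_singleton, not_or]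
    constructor
    · rintro ⟨h1 | h1, h2, h3⟩
      · exact absurd h1 h2
      · by_cases hxv : x = v
        · exact Or.inl hxv
        · exact Or.inr ⟨h1, hxv, h3⟩
    · rintro (rfl | ⟨h1, h2, h3⟩)
      · exact ⟨Or.inr w.start_mem_support, e.ne', hv⟩
      · refine ⟨Or.inr h1, ?_, h3⟩
        rintro rfl
        exact hu h1
  unfold rho
  have hset' : ((SimpleGraph.Walk.cons e w).support.toFinset \ {u, β} : Finset (Node K)) =
      insert v (w.support.toFinset \ {v, β}) := hset
  convert Finset.prod_insert (s := w.support.toFinset \ {v, β}) (a := v)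
    (f := fun x => ∏ᶠ y ∈ {y | (newtonTree h).Adj x y ∧
      ¬ s(x, y) ∈ (SimpleGraph.Walk.cons e w).edges}, decoration x y) (by simp) using 1
  · convert rfl using 2
    convert hset.symm
  · congr 1
    refine Finset.prod_congr (by congr!) fun x hx => ?_
    simp only [Finset.mem_sdiff, List.mem_toFinset, Finset.mem_insert, Finset.mem_singleton,
      not_or] at hx
    have hxu : x ≠ u := by
      rintro rfl
      exact hu hx.1
    congr! 5 with y
    simp [SimpleGraph.Walk.edges_cons, hxu, hx.2.1]

end NewtonTree

end

noncomputable section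

namespace NewtonTree

variable {K : Type*} [Field K] {h : MvPowerSeries (Fin 2) K}

/-! ### Charts of a Newton tree -/

theorem IsChart.adm {L : List (HNStep K)} (hL : IsChart h L) : ∀ s ∈ L, s.Admissible := by
  induction hL with
  | nil => simp
  | cons s L _ he hμ _ ih => exact List.forall_mem_cons.2 ⟨⟨he.1, he.2.1, he.2.2.1, hμ⟩, ih⟩

theorem IsChart.of_suffix {L M : List (HNStep K)} (hL : IsChart h L) (hM : M <:+ L) :
    IsChart h M := by
  induction hL with
  | nil => rw [List.suffix_nil.1 hM]; exact .nil
  | cons s L hL he hμ hm ih =>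
    rcases List.suffix_cons_iff.1 hM with rfl | hM
    · exact .cons s L hL he hμ hm
    · exact ih hM

theorem IsChart.two_le {s : HNStep K} {L : List (HNStep K)} (hL : IsChart h (s :: L)) :
    2 ≤ faceMult (transform h L) s.p s.q s.μ := by
  cases hL; assumption

/-- The total transform of `f` after the maps in `L` contains the binomial of `s` exactly
`k` times. -/
def MultAt (f : MvPowerSeries (Fin 2) K) (L : List (HNStep K)) (s : HNStep K) (k : ℕ) : Prop :=
  ∃ W, HasMult (transform f L) s W k

theorem MultAt.mul {f g : MvPowerSeries (Fin 2) K} {L : List (HNStep K)} {s : HNStep K}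
    {k l : ℕ} (hL : ∀ s ∈ L, s.Admissible) (hf : MultAt f L s k) (hg : MultAt g L s l) :
    MultAt (f * g) L s (k + l) := by
  obtain ⟨V, hV⟩ := hf
  obtain ⟨W, hW⟩ := hg
  exact ⟨V + W, by rw [transform_mul hL]; exact hV.mul hW⟩

theorem MultAt.mul_zero {f g : MvPowerSeries (Fin 2) K} {L : List (HNStep K)} {s : HNStep K}
    {k : ℕ} (hL : ∀ s ∈ L, s.Admissible) (hf : MultAt f L s k) (hg : MultAt g L s 0) :
    MultAt (f * g) L s k := by
  have := hf.mul hL hg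
  rwa [add_zero] at this

theorem hasMult_X0_pow {s : HNStep K} (hs : s.Admissible) (N : ℕ) :
    HasMult (MvPowerSeries.X 0 ^ N) s (s.p * N) 0 :=
  ⟨MvPolynomial.X 0 ^ N, by
    rw [map_pow, MvPolynomial.eval_X]
    exact pow_ne_zero _ (pow_ne_zero _ hs.center_ne), by simpa using isInit_X0_pow N s.p s.q⟩

theorem hasMult_of_isUnit {s : HNStep K} (hs : s.Admissible) {u : MvPowerSeries (Fin 2) K}
    (hu : IsUnit u) : HasMult u s 0 0 :=
  ⟨_, by
    rw [MvPolynomial.eval_C]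
    exact isUnit_iff_ne_zero.1 (MvPowerSeries.isUnit_iff_constantCoeff.1 hu),
    by simpa using isInit_of_isUnit hu hs.p_pos hs.q_pos⟩

theorem IsOut.multAt {f : MvPowerSeries (Fin 2) K} {L : List (HNStep K)} (hf : IsOut f L)
    {s : HNStep K} (hs : s.Admissible) : MultAt f L s 0 := by
  obtain ⟨N, u, hu, hf⟩ := hf
  have := (hasMult_X0_pow hs N).mul (hasMult_of_isUnit hs hu)
  rw [← hf] at this
  exact ⟨_, this⟩

theorem Lift.multAt {f : MvPowerSeries (Fin 2) K} {φ ψ : PowerSeries K}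
    {L : List (HNStep K)} {F : MvPowerSeries (Fin 2) K} {X Y : PowerSeries K}
    (hF : Lift f φ ψ L F X Y) {s : HNStep K} (hs : s.Admissible) {W k : ℕ}
    (hm : HasMult F s W k) : MultAt f L s k := by
  obtain ⟨u, hu, hf⟩ := hF.transform_eq
  have := (hasMult_X0_pow hs (excMult L * X.order.toNat)).mul ((hasMult_of_isUnit hs hu).mul hm)
  rw [← hf] at this
  simp only [zero_add] at this
  exact ⟨_, this⟩

theorem MultAt.faceMult_eq {L : List (HNStep K)} {s : HNStep K} (hs : s.Admissible) {k : ℕ}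
    (hm : MultAt h L s k) : faceMult (transform h L) s.p s.q s.μ = k := by
  obtain ⟨W, hW⟩ := hm
  exact hW.faceMult_eq hs

theorem MultAt.isEdge {L : List (HNStep K)} {s : HNStep K} (hs : s.Admissible) {k : ℕ}
    (hm : MultAt h L s k) (hk : k ≠ 0) : IsEdge (transform h L) s.p s.q := by
  obtain ⟨W, hW⟩ := hm
  exact hW.isEdge hs hk

theorem MultAt.isChart {L : List (HNStep K)} {s : HNStep K} (hs : s.Admissible) {k : ℕ}
    (hm : MultAt h L s k) (hk : 2 ≤ k) (hL : IsChart h L) : IsChart h (s :: L) :=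
  .cons s L hL (hm.isEdge hs (by omega)) hs.μ_ne (by
    rw [hm.faceMult_eq hs]; exact_mod_cast hk)

/-! ### Intersections of faces -/

theorem Meets.mul {F G : MvPowerSeries (Fin 2) K} {p q p' q' : ℕ} (hne : p * q' ≠ p' * q)
    (hF : Meets F p q p' q') (hG : Meets G p q p' q') : Meets (F * G) p q p' q' := by
  obtain ⟨d, hd, hd'⟩ := hF
  obtain ⟨e, he, he'⟩ := hG
  exact ⟨d + e, hd.mul hne hd' he he'⟩

theorem meets_X0_pow (N p q p' q' : ℕ) :
    Meets (MvPowerSeries.X 0 ^ N : MvPowerSeries (Fin 2) K) p q p' q' :=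
  ⟨_, onFace_X_pow 0 N p q, onFace_X_pow 0 N p' q'⟩

theorem meets_of_isUnit {u : MvPowerSeries (Fin 2) K} (hu : IsUnit u) (p q p' q' : ℕ) :
    Meets u p q p' q' :=
  ⟨0, onFace_of_isUnit hu p q, onFace_of_isUnit hu p' q'⟩

theorem IsOut.meets {f : MvPowerSeries (Fin 2) K} {L : List (HNStep K)} (hf : IsOut f L)
    {p q p' q' : ℕ} (hne : p * q' ≠ p' * q) : Meets (transform f L) p q p' q' := by
  obtain ⟨N, u, hu, hf⟩ := hf
  rw [hf]
  exact (meets_X0_pow N p q p' q').mul hne (meets_of_isUnit hu p q p' q')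

theorem Lift.meets {f : MvPowerSeries (Fin 2) K} {φ ψ : PowerSeries K}
    {L : List (HNStep K)} {F : MvPowerSeries (Fin 2) K} {X Y : PowerSeries K}
    (hF : Lift f φ ψ L F X Y) {p q p' q' : ℕ} (hne : p * q' ≠ p' * q) (hm : Meets F p q p' q') :
    Meets (transform f L) p q p' q' := by
  obtain ⟨u, hu, hf⟩ := hF.transform_eq
  rw [hf]
  exact (meets_X0_pow _ p q p' q').mul hne ((meets_of_isUnit hu p q p' q').mul hne hm)

theorem meets_of_associated_X {F : MvPowerSeries (Fin 2) K} {i : Fin 2}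
    (hF : Associated F (MvPowerSeries.X i)) (p q p' q' : ℕ) : Meets F p q p' q' :=
  ⟨_, onFace_of_associated_X hF p q, onFace_of_associated_X hF p' q'⟩

/-! ### Ends of a path -/

open Classical in
/-- The product of the decorations adjacent to a walk, including those at its start. -/
def rhoStart {v β : Node K} (w : (newtonTree h).Walk v β) : ℕ :=
  (if v = β then 1 else
    ∏ᶠ y ∈ {y | (newtonTree h).Adj v y ∧ ¬ s(v, y) ∈ w.edges}, decoration v y) * rho w

/-- The new edge carries decoration 1 at v, so it does not matter that it now lies on the path.
Extensions to the right, where decorations are 1, thus turn `rhoStart` into `rho`. -/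
theorem rho_cons_of_decoration {u v β : Node K} (e : (newtonTree h).Adj u v)
    (w : (newtonTree h).Walk v β) (hw : (SimpleGraph.Walk.cons e w).IsPath)
    (hd : decoration v u = 1) : rho (SimpleGraph.Walk.cons e w) = rhoStart w := by
  by_cases hv : v = β
  · subst hv
    have hw' := ((SimpleGraph.Walk.cons_isPath_iff _ _).1 hw).1
    rw [SimpleGraph.Walk.isPath_iff_nil, ← SimpleGraph.Walk.eq_nil_iff_nil] at hw'
    subst hw'
    rw [rho_cons_nil, rhoStart, if_pos rfl, rho_nil]
  · rw [rho_cons e w hw hv, rhoStart, if_neg hv]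
    congr 1
    rw [finprod_mem_def, finprod_mem_def]
    refine finprod_congr fun y => ?_
    by_cases hy : y = u
    · subst hy
      rw [Set.mulIndicator_apply_eq_one.2 fun _ => hd, Set.mulIndicator_apply_eq_one.2 fun _ => hd]
    · have hiff : y ∈ {y | (newtonTree h).Adj v y ∧
          ¬ s(v, y) ∈ (SimpleGraph.Walk.cons e w).edges} ↔
          y ∈ {y | (newtonTree h).Adj v y ∧ ¬ s(v, y) ∈ w.edges} := by
        have : s(v, y) ≠ s(u, v) := by
          rw [Sym2.eq_swap, Ne, Sym2.congr_left]
          exact hy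
        rw [Set.mem_ofPred_eq, Set.mem_ofPred_eq, SimpleGraph.Walk.edges_cons, List.mem_cons]
        simp only [this, false_or]
      by_cases h1 : y ∈ {y | (newtonTree h).Adj v y ∧ ¬ s(v, y) ∈ w.edges}
      · rw [Set.mulIndicator_of_mem h1, Set.mulIndicator_of_mem (hiff.2 h1)]
      · rw [Set.mulIndicator_of_notMem h1, Set.mulIndicator_of_notMem (hiff.not.2 h1)]

open Classical in
theorem rhoStart_eq {L : List (HNStep K)} {p q : ℕ} {u b β : Node K}
    (hu : TreeEdge h u (.vertex L p q)) (hb : TreeEdge h (.vertex L p q) b) (hc : b.chart = L)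
    (w : (newtonTree h).Walk (.vertex L p q) β) (hβ : .vertex L p q ≠ β) :
    rhoStart w = (if s(.vertex L p q, u) ∈ w.edges then 1 else upper L p q) *
      (if s(.vertex L p q, b) ∈ w.edges then 1 else p) * rho w := by
  rw [rhoStart, if_neg hβ, finprod_decoration hu hb hc]
  congr!

/-! ### A branch after its separation from the other -/

/-- Two branches and their product. -/
structure BranchPair (h f : MvPowerSeries (Fin 2) K) (φ ψ : PowerSeries K)
    (g : MvPowerSeries (Fin 2) K) (φ' ψ' : PowerSeries K) : Prop where
  fst : IsBranch f φ ψ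
  snd : IsBranch g φ' ψ'
  eq_mul : h = f * g
  ne : evalAt g φ ψ ≠ 0

theorem BranchPair.symm {f g : MvPowerSeries (Fin 2) K} {φ ψ φ' ψ' : PowerSeries K}
    (P : BranchPair h f φ ψ g φ' ψ') : BranchPair h g φ' ψ' f φ ψ :=
  ⟨P.snd, P.fst, P.eq_mul.trans (mul_comm _ _), fun h0 => P.ne (by
    have h1 := P.fst.order_comm P.snd P.ne
    rw [h0, PowerSeries.order_zero] at h1
    exact PowerSeries.order_eq_top.1 h1)⟩

theorem IsBranch.order_eq_one {F : MvPowerSeries (Fin 2) K} {X : PowerSeries K}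
    (hF : IsBranch F X 0) : X.order = 1 := by
  have hX : X ≠ 0 := hF.param.ne_zero.resolve_right (by simp)
  have hz : PowerSeries.constantCoeff (0 : PowerSeries K) = 0 := map_zero _
  have hT : PowerSeries.constantCoeff (PowerSeries.X : PowerSeries K) = 0 :=
    PowerSeries.constantCoeff_X
  have ha := hF.associated_X1
  have h1 := evalAt_dvd hz hT ha.dvd
  have h2 := evalAt_dvd hz hT ha.symm.dvd
  rw [evalAt_X1 hz hT] at h1 h2
  rw [← hF.order_evalAt_zero_X hX]
  refine le_antisymm ?_ ?_
  · simpa using order_mono_of_dvd h1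
  · simpa using order_mono_of_dvd h2

omit [Field K] in
theorem suffix_cons_ne {L : List (HNStep K)} {s : HNStep K} : ¬ s :: L <:+ L := fun h => by
  have := h.length_le
  simp at this

theorem TreeEdge.ne {x y : Node K} (e : TreeEdge h x y) : x ≠ y := by
  rintro rfl
  exact lt_irrefl _ e.rank_lt

variable [IsAlgClosed K] {f g : MvPowerSeries (Fin 2) K} {φ ψ φ' ψ' : PowerSeries K}

/-- Either g has left before s, or s is not its tangent; otherwise its strict transform would
survive the map s. -/
theorem IsOut.multAt_of_cons (hg : IsBranch g φ' ψ') {L : List (HNStep K)} {s : HNStep K}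
    (hL : ∀ s ∈ L, s.Admissible) (hs : s.Admissible) (ho : IsOut g (s :: L)) :
    MultAt g L s 0 := by
  rcases exists_lift_or_isOut hg hL with ⟨G, X, Y, hG⟩ | hG
  · have hn : ∀ k, ¬ EdgeAt X Y s k := fun k hk => by
      obtain ⟨G', X', Y', hG', -⟩ := hG.cons hk
      exact hG'.not_isOut (hG'.ne (by simp)) ho
    obtain ⟨W, hW⟩ := hG.branch.hasMult_zero hs hn
    exact hG.multAt hs hW
  · exact hG.multAt hs

/-- The part of the path from the vertex at which `f` and `g` are separated to the arrowhead
of `f`. -/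
theorem BranchPair.descent (P : BranchPair h f φ ψ g φ' ψ') {M : ℕ}
    (hM : ∀ L F X Y, Lift f φ ψ L F X Y → M < L.length → X.order = 1 ∧ IsOut g L) (n : ℕ)
    {L : List (HNStep K)} {s : HNStep K} {F : MvPowerSeries (Fin 2) K} {X Y : PowerSeries K}
    {k : ℕ} (hn : M ≤ n + L.length) (hF : Lift f φ ψ (s :: L) F X Y) (hk : X.order = k)
    (ho : IsOut g (s :: L)) (hL : IsChart h L) (hm : MultAt h L s k) {β : Node K}
    (w : (newtonTree h).Walk (.vertex L s.p s.q) β) (hw : w.IsPath)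
    (ha : ∀ x ∈ w.support, ¬ s :: L <:+ x.chart) :
    ∃ (α : Node K) (w' : (newtonTree h).Walk α β), w'.IsPath ∧ Represents h f α ∧
      rho w' = k * rhoStart w ∧ s :: L <:+ α.chart ∧
      ∀ x ∈ w'.support, x ∈ w.support ∨ s :: L <:+ x.chart := by
  have hs := (List.forall_mem_cons.1 hF.adm).1
  have hX0 := hF.ne (by simp)
  obtain ⟨k', hk0, hk'⟩ := hF.order_ne_top hX0
  obtain rfl : k = k' := by exact_mod_cast hk.symm.trans hk'
  have hE := hm.isEdge hs hk0.ne'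
  -- Multiplicity one is the case of an arrowhead: the path ends here and no factor remains.
  by_cases hk1 : k = 1
  · have hA : IsArrow h L s := ⟨hL, hE, hs.μ_ne, by rw [hm.faceMult_eq hs, hk1]; rfl⟩
    have e := (TreeEdge.vertexArrow L s hA).adj.symm
    have hp : (SimpleGraph.Walk.cons e w).IsPath :=
      (SimpleGraph.Walk.cons_isPath_iff _ _).2 ⟨hw, fun hmem => ha _ hmem List.suffix_rfl⟩
    obtain ⟨u, hu, hfu⟩ := hF.transform_eq
    refine ⟨_, SimpleGraph.Walk.cons e w, hp, ⟨hA, _, _, hfu,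
      not_X0_dvd_unit_mul hu (hF.not_X0_dvd hX0),
      fun h' => hF.branch.not_isUnit (isUnit_of_mul_isUnit_right h')⟩, ?_, List.suffix_rfl,
      fun x hx => ?_⟩
    · rw [hk1, one_mul, rho_cons_of_decoration e w hp rfl]
    · rw [SimpleGraph.Walk.support_cons, List.mem_cons] at hx
      rcases hx with rfl | hx
      · exact Or.inr List.suffix_rfl
      · exact Or.inl hx
  · have hC := hm.isChart hs (by omega) hL
    have hlen : L.length + 1 ≤ M := by
      by_contra! hlt
      have := (hM _ _ _ _ hF (by simpa using hlt)).1
      rw [hk] at this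
      exact hk1 (by exact_mod_cast this)
    cases n with
    | zero => omega
    | succ n =>
      have hY0 : Y ≠ 0 := by
        rintro rfl
        have := hF.branch.order_eq_one
        rw [hk] at this
        exact hk1 (by exact_mod_cast this)
      obtain ⟨t, l, ht⟩ := NewtonTree.exists_edgeAt hF.branch.param.constantCoeff_fst
        hF.branch.param.constantCoeff_snd hX0 hY0
      -- The lower decoration of the next vertex is exactly what the multiplicity loses in this
      -- step.
      have hkl : k = l * t.p := by exact_mod_cast hk.symm.trans ht.ordX
      obtain ⟨F', X', Y', hF', hl⟩ := hF.cons ht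
      have hfm : MultAt f (s :: L) t l := hF.multAt ht.adm (ht.hasMult hF.branch)
      have hm' : MultAt h (s :: L) t l := by
        rw [P.eq_mul]
        exact hfm.mul_zero hF.adm (ho.multAt ht.adm)
      have hE' := hm'.isEdge ht.adm ht.pos.ne'
      have htr : transform h (s :: L) = transform f (s :: L) * transform g (s :: L) := by
        rw [P.eq_mul, transform_mul hF.adm]
      have hne1 : 1 * t.q ≠ t.p * 0 := by simpa using ht.adm.q_pos.ne'
      have hne2 : t.p * 1 ≠ 0 * t.q := by simpa using ht.adm.p_pos.ne'
      have e1 : TreeEdge h (.vertex L s.p s.q) (.vertex (s :: L) t.p t.q) := by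
        refine .glue L s t.p t.q hC hE' ?_
        rw [htr]
        exact (hF.meets hne1 ⟨_, ht.onFace_upper hF.branch⟩).mul hne1 (ho.meets hne1)
      have e2 : TreeEdge h (.vertex (s :: L) t.p t.q) (.bottom (s :: L)) := by
        refine .vertexBottom _ _ _ hC hE' ?_
        rw [htr]
        exact (hF.meets hne2 ⟨_, ht.onFace_lower hF.branch⟩).mul hne2 (ho.meets hne2)
      have hnot : Node.vertex (s :: L) t.p t.q ∉ w.support := fun hmem =>
        ha _ hmem List.suffix_rfl
      have hp : (SimpleGraph.Walk.cons e1.adj.symm w).IsPath :=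
        (SimpleGraph.Walk.cons_isPath_iff _ _).2 ⟨hw, hnot⟩
      obtain ⟨α, w', hw', hα, hrho, hαc, hsup⟩ := BranchPair.descent P hM n
        (by simp only [List.length_cons]; omega) hF' hl (ho.cons ht.adm) hC hm'
        (SimpleGraph.Walk.cons e1.adj.symm w) hp (by
          intro x hx hsx
          rw [SimpleGraph.Walk.support_cons, List.mem_cons] at hx
          rcases hx with rfl | hx
          · exact suffix_cons_ne hsx
          · exact ha x hx ((List.suffix_cons _ _).trans hsx))
      refine ⟨α, w', hw', hα, ?_, (List.suffix_cons _ _).trans hαc, fun x hx => ?_⟩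
      -- At this vertex the edge back to the previous vertex is on the path and the edge to the
      -- bottom arrowhead is not, so the contribution is `t.p`.
      · have hβ : Node.vertex (s :: L) t.p t.q ≠ β := by
          rintro rfl
          exact hnot w.end_mem_support
        have c1 : s(Node.vertex (s :: L) t.p t.q, Node.vertex L s.p s.q) ∈
            (SimpleGraph.Walk.cons e1.adj.symm w).edges := by
          rw [SimpleGraph.Walk.edges_cons]; exact List.mem_cons_self
        have c2 : s(Node.vertex (s :: L) t.p t.q, Node.bottom (s :: L)) ∉
            (SimpleGraph.Walk.cons e1.adj.symm w).edges := by
          rw [SimpleGraph.Walk.edges_cons, List.mem_cons, not_or]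
          refine ⟨?_, fun hmem => hnot (w.fst_mem_support_of_mem_edges hmem)⟩
          rw [Sym2.congr_right]
          simp
        have r := rhoStart_eq e1 e2 rfl (SimpleGraph.Walk.cons e1.adj.symm w) hβ
        rw [if_pos c1, if_neg c2] at r
        have r' := rho_cons_of_decoration e1.adj.symm w hp
          (decoration_right e1 (List.cons_ne_self s L))
        rw [hrho, r, r', hkl]
        ring
      · rcases hsup x hx with hx | hx
        · rw [SimpleGraph.Walk.support_cons, List.mem_cons] at hx
          rcases hx with rfl | hx
          · exact Or.inr List.suffix_rfl
          · exact Or.inl hx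
        · exact Or.inr ((List.suffix_cons _ _).trans hx)

end NewtonTree

end

noncomputable section

namespace NewtonTree

variable {K : Type*} [Field K] {h : MvPowerSeries (Fin 2) K}

/-! ### The vertex at which two branches are separated -/

theorem exists_parent {L : List (HNStep K)} (hL : IsChart h L) {p q : ℕ}
    (he : IsEdge (transform h L) p q) (hm : Meets (transform h L) 1 0 p q) :
    ∃ u, TreeEdge h u (.vertex L p q) ∧ u.chart <:+ L := by
  cases L with
  | nil => exact ⟨_, .topVertex p q he hm, List.suffix_rfl⟩
  | cons s L => exact ⟨_, .glue L s p q hL he hm, List.suffix_cons _ _⟩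

omit [Field K] in
theorem eq_of_cons_suffix {L M : List (HNStep K)} {s t : HNStep K} (hs : s :: L <:+ M)
    (ht : t :: L <:+ M) : s = t := by
  have h1 := (List.suffix_of_suffix_length_le hs ht (by simp)).eq_of_length (by simp)
  exact (List.cons.inj h1).1

/-- The conclusion of the theorem for one choice of the arrowheads, the path and the
parametrization. -/
def HasPath (h f g : MvPowerSeries (Fin 2) K) (φ ψ : PowerSeries K) : Prop :=
  ∃ (α β : Node K) (w : (newtonTree h).Walk α β), Represents h f α ∧ Represents h g β ∧
    w.IsPath ∧ (evalAt g φ ψ).order = (rho w : ℕ∞)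

variable {f g : MvPowerSeries (Fin 2) K} {φ ψ φ' ψ' : PowerSeries K} {L : List (HNStep K)}
  {F G : MvPowerSeries (Fin 2) K} {X Y X' Y' : PowerSeries K} {s t : HNStep K} {k l : ℕ}

theorem BranchPair.hasPath_symm (P : BranchPair h f φ ψ g φ' ψ') (hp : HasPath h g f φ' ψ') :
    HasPath h f g φ ψ := by
  obtain ⟨α, β, w, hα, hβ, hw, ho⟩ := hp
  exact ⟨β, α, w.reverse, hβ, hα, hw.reverse, by
    rw [rho_reverse, ← ho, P.fst.order_comm P.snd P.ne]⟩

theorem BranchPair.transform_eq (P : BranchPair h f φ ψ g φ' ψ')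
    (hL : ∀ s ∈ L, s.Admissible) : transform h L = transform f L * transform g L := by
  rw [P.eq_mul, transform_mul hL]

theorem BranchPair.meets (P : BranchPair h f φ ψ g φ' ψ') (hF : Lift f φ ψ L F X Y)
    (hG : Lift g φ' ψ' L G X' Y') {p q p' q' : ℕ} (hne : p * q' ≠ p' * q)
    (hm : Meets F p q p' q') (hm' : Meets G p q p' q') : Meets (transform h L) p q p' q' := by
  rw [P.transform_eq hF.adm]
  exact (hF.meets hne hm).mul hne (hG.meets hne hm')

/-- Evaluate the total transform of g on the lift of f: the divisor gives the first term and the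
strict transform the second. -/
theorem Lift.order_evalAt_eq (hF : Lift f φ ψ L F X Y)
    (hG : Lift g φ' ψ' L G X' Y') : (evalAt g φ ψ).order =
      (excMult L * X'.order.toNat) • X.order + (evalAt G X Y).order := by
  have hc := hF.branch.param.constantCoeff_fst
  have hd := hF.branch.param.constantCoeff_snd
  obtain ⟨u, hu, hg⟩ := hG.transform_eq
  rw [← hF.eval, hg, evalAt_mul hc hd, evalAt_mul hc hd, evalAt_pow hc hd, evalAt_X0 hc hd,
    PowerSeries.order_mul, PowerSeries.order_mul, PowerSeries.order_pow,
    PowerSeries.order_zero_of_unit (evalAt_isUnit hc hd hu), zero_add]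

variable [IsAlgClosed K]

theorem BranchPair.isEdge (P : BranchPair h f φ ψ g φ' ψ') (hF : Lift f φ ψ L F X Y)
    (hs : EdgeAt X Y s k) (hg : IsOut g (s :: L)) :
    MultAt h L s k ∧ IsEdge (transform h L) s.p s.q := by
  have hm : MultAt h L s k := by
    rw [P.eq_mul]
    exact (hF.multAt hs.adm (hs.hasMult hF.branch)).mul_zero hF.adm
      (hg.multAt_of_cons P.snd hF.adm hs.adm)
  exact ⟨hm, hm.isEdge hs.adm hs.pos.ne'⟩

theorem BranchPair.exists_walk (P : BranchPair h f φ ψ g φ' ψ') (hL : IsChart h L)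
    (hF : Lift f φ ψ L F X Y) (hs : EdgeAt X Y s k) (hg : IsOut g (s :: L)) {β : Node K}
    (w : (newtonTree h).Walk (.vertex L s.p s.q) β) (hw : w.IsPath)
    (ha : ∀ x ∈ w.support, ¬ s :: L <:+ x.chart) :
    ∃ (α : Node K) (w' : (newtonTree h).Walk α β), w'.IsPath ∧ Represents h f α ∧
      rho w' = k * rhoStart w ∧ s :: L <:+ α.chart ∧
      ∀ x ∈ w'.support, x ∈ w.support ∨ s :: L <:+ x.chart := by
  obtain ⟨M, hM⟩ := exists_length_bound P.fst P.ne
  obtain ⟨F', X', Y', hF', hk⟩ := hF.cons hs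
  exact P.descent hM M (Nat.le_add_right _ _) hF' hk hg hL (P.isEdge hF hs hg).1 w hw ha

/-- The path from the vertex at which `f` and `g` are separated to the arrowhead of `f`. -/
theorem BranchPair.exists_walk_reverse (P : BranchPair h f φ ψ g φ' ψ') (hL : IsChart h L)
    (hF : Lift f φ ψ L F X Y) (hs : EdgeAt X Y s k) (hg : IsOut g (s :: L)) :
    ∃ (α : Node K) (w : (newtonTree h).Walk (.vertex L s.p s.q) α), w.IsPath ∧
      Represents h f α ∧ rho w = k ∧ s :: L <:+ α.chart ∧
      ∀ x ∈ w.support, x = .vertex L s.p s.q ∨ s :: L <:+ x.chart := by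
  obtain ⟨α, w, hw, hα, hr, hc, hsup⟩ := P.exists_walk hL hF hs hg SimpleGraph.Walk.nil
    SimpleGraph.Walk.IsPath.nil (fun x hx => by
      rw [SimpleGraph.Walk.support_nil, List.mem_singleton] at hx
      rw [hx]; exact suffix_cons_ne)
  refine ⟨α, w.reverse, hw.reverse, hα, ?_, hc, fun x hx => ?_⟩
  · rw [rho_reverse, hr, rhoStart, if_pos rfl, rho_nil, mul_one, mul_one]
  · rw [SimpleGraph.Walk.support_reverse, List.mem_reverse] at hx
    simpa using hsup x hx

theorem Lift.isOut_of_ne (hG : Lift g φ' ψ' L G X' Y') (hs : s.Admissible)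
    (ht : EdgeAt X' Y' t l) (hne : s ≠ t) : IsOut g (s :: L) :=
  hG.isOut_cons hs fun _ hk => hne (hk.unique ht)

/-- The path runs through both vertices. At s the upward edge is off it, giving s.q + e·s.p with e =
`excMult L`; at t the downward edge is, giving t.p. On the other side, G has the single point (0,
l·t.p) on the face of s, so the intersection number is e·(l·t.p)(k·s.p) + k·s.q·l·t.p, the same
product. -/
theorem BranchPair.hasPath_of_above (P : BranchPair h f φ ψ g φ' ψ') (hL : IsChart h L)
    (hF : Lift f φ ψ L F X Y) (hG : Lift g φ' ψ' L G X' Y') (hs : EdgeAt X Y s k)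
    (ht : EdgeAt X' Y' t l) (hlt : t.p * s.q < s.p * t.q) : HasPath h f g φ ψ := by
  have hst : s ≠ t := by
    rintro rfl
    exact lt_irrefl _ hlt
  have hgo := hG.isOut_of_ne hs.adm ht hst
  have hfo := hF.isOut_of_ne ht.adm hs hst.symm
  have hEs := (P.isEdge hF hs hgo).2
  have hEt := (P.symm.isEdge hG ht hfo).2
  have m1 : Meets (transform h L) 1 0 s.p s.q :=
    P.meets hF hG (by simpa using hs.adm.q_pos.ne') ⟨_, hs.onFace_upper hF.branch⟩
      ⟨_, (ht.onFace_upper hG.branch).1, (ht.single_upper hG.branch hlt hs.adm.q_pos _).2 rfl⟩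
  have m2 : Meets (transform h L) s.p s.q t.p t.q :=
    P.meets hF hG hlt.ne'
      ⟨_, (hs.onFace_lower hF.branch).1, (hs.single_lower hF.branch hlt ht.adm.p_pos _).2 rfl⟩
      ⟨_, (ht.single_upper hG.branch hlt hs.adm.q_pos _).2 rfl, (ht.onFace_upper hG.branch).2⟩
  have m3 : Meets (transform h L) t.p t.q 0 1 :=
    P.meets hF hG (by simpa using ht.adm.p_pos.ne')
      ⟨_, (hs.single_lower hF.branch hlt ht.adm.p_pos _).2 rfl, (hs.onFace_lower hF.branch).2⟩
      ⟨_, ht.onFace_lower hG.branch⟩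
  obtain ⟨u, hu, huc⟩ := exists_parent hL hEs m1
  have e : TreeEdge h (.vertex L s.p s.q) (.vertex L t.p t.q) :=
    .vertical L _ _ _ _ hL hEs hEt hlt m2
  have eb : TreeEdge h (.vertex L t.p t.q) (.bottom L) := .vertexBottom L _ _ hL hEt m3
  obtain ⟨β, w₁, hw₁, hβ, hr₁, hβc, hsup₁⟩ := P.symm.exists_walk_reverse hL hG ht hfo
  have hnot : Node.vertex L s.p s.q ∉ w₁.support := fun hmem => by
    rcases hsup₁ _ hmem with h1 | h1
    · exact e.ne h1
    · exact suffix_cons_ne h1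
  have hp : (SimpleGraph.Walk.cons e.adj w₁).IsPath :=
    (SimpleGraph.Walk.cons_isPath_iff _ _).2 ⟨hw₁, hnot⟩
  have hsup₂ : ∀ x ∈ (SimpleGraph.Walk.cons e.adj w₁).support, x = .vertex L s.p s.q ∨
      x = .vertex L t.p t.q ∨ t :: L <:+ x.chart := fun x hx => by
    rw [SimpleGraph.Walk.support_cons, List.mem_cons] at hx
    exact hx.imp_right (hsup₁ x)
  obtain ⟨α, w, hw, hα, hr, -⟩ := P.exists_walk hL hF hs hgo _ hp (fun x hx hsx => by
    rcases hsup₂ x hx with rfl | rfl | hx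
    · exact suffix_cons_ne hsx
    · exact suffix_cons_ne hsx
    · exact hst (eq_of_cons_suffix hsx hx))
  refine ⟨α, β, w, hα, hβ, hw, ?_⟩
  have hβs : Node.vertex L s.p s.q ≠ β := by
    rintro rfl
    exact suffix_cons_ne hβc
  have hβt : Node.vertex L t.p t.q ≠ β := by
    rintro rfl
    exact suffix_cons_ne hβc
  have c1 : s(Node.vertex L s.p s.q, u) ∉ (SimpleGraph.Walk.cons e.adj w₁).edges := fun hmem => by
    rcases hsup₂ _ (SimpleGraph.Walk.snd_mem_support_of_mem_edges _ hmem) with h1 | h1 | h1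
    · exact hu.ne h1
    · rw [h1] at hu; exact lt_asymm hu.rank_lt e.rank_lt
    · exact suffix_cons_ne (h1.trans huc)
  have c2 : s(Node.vertex L s.p s.q, Node.vertex L t.p t.q) ∈
      (SimpleGraph.Walk.cons e.adj w₁).edges := by
    rw [SimpleGraph.Walk.edges_cons]; exact List.mem_cons_self
  have c3 : s(Node.vertex L t.p t.q, Node.vertex L s.p s.q) ∈
      (SimpleGraph.Walk.cons e.adj w₁).edges := by
    rw [Sym2.eq_swap]; exact c2
  have c4 : s(Node.vertex L t.p t.q, Node.bottom L) ∉
      (SimpleGraph.Walk.cons e.adj w₁).edges := fun hmem => by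
    rcases hsup₂ _ (SimpleGraph.Walk.snd_mem_support_of_mem_edges _ hmem) with h1 | h1 | h1
    · cases h1
    · cases h1
    · exact suffix_cons_ne h1
  have r1 := rhoStart_eq hu e rfl (SimpleGraph.Walk.cons e.adj w₁) hβs
  rw [if_neg c1, if_pos c2] at r1
  have r2 := rho_cons e.adj w₁ hp hβt
  rw [finprod_decoration e eb rfl, if_pos c3, if_neg c4] at r2
  rw [hr, r1, r2, hr₁, hF.order_evalAt_eq hG, hs.ordX, ht.ordX,
    order_evalAt_of_single hs (ht.single_upper hG.branch hlt hs.adm.q_pos), ENat.toNat_natCast,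
    upper_eq, expo_zero, expo_one, nsmul_eq_mul]
  norm_cast
  ring

/-- Both vertical edges are off the path and contribute (q + ep)·p, where e = `excMult L`. Since μ ≠
μ' the face polynomial of G does not vanish on the tangent of f, so the strict transforms meet with
multiplicity klpq, and e·kp·lp + klpq = kl·p(q + ep). -/
theorem BranchPair.hasPath_of_same {p q : ℕ} {μ μ' : K} (P : BranchPair h f φ ψ g φ' ψ')
    (hL : IsChart h L)
    (hF : Lift f φ ψ L F X Y) (hG : Lift g φ' ψ' L G X' Y') (hs : EdgeAt X Y ⟨p, q, μ⟩ k)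
    (ht : EdgeAt X' Y' ⟨p, q, μ'⟩ l) (hne : μ ≠ μ') : HasPath h f g φ ψ := by
  have hst : (⟨p, q, μ⟩ : HNStep K) ≠ ⟨p, q, μ'⟩ := fun h => hne (HNStep.mk.inj h).2.2
  have hgo := hG.isOut_of_ne hs.adm ht hst
  have hfo := hF.isOut_of_ne ht.adm hs hst.symm
  have hE : IsEdge (transform h L) p q := (P.isEdge hF hs hgo).2
  have hp0 : 0 < p := hs.adm.p_pos
  have hq0 : 0 < q := hs.adm.q_pos
  have m1 : Meets (transform h L) 1 0 p q :=
    P.meets hF hG (by simpa using hq0.ne') ⟨_, hs.onFace_upper hF.branch⟩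
      ⟨_, ht.onFace_upper hG.branch⟩
  have m2 : Meets (transform h L) p q 0 1 :=
    P.meets hF hG (by simpa using hp0.ne') ⟨_, hs.onFace_lower hF.branch⟩
      ⟨_, ht.onFace_lower hG.branch⟩
  obtain ⟨u, hu, huc⟩ := exists_parent hL hE m1
  have eb : TreeEdge h (.vertex L p q) (.bottom L) := .vertexBottom L _ _ hL hE m2
  obtain ⟨β, w₁, hw₁, hβ, hr₁, hβc, hsup₁⟩ := P.symm.exists_walk_reverse hL hG ht hfo
  obtain ⟨α, w, hw, hα, hr, -⟩ := P.exists_walk hL hF hs hgo w₁ hw₁ (fun x hx hsx => by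
    rcases hsup₁ x hx with rfl | hx
    · exact suffix_cons_ne hsx
    · exact hst (eq_of_cons_suffix hsx hx))
  refine ⟨α, β, w, hα, hβ, hw, ?_⟩
  have hβt : Node.vertex L p q ≠ β := by
    rintro rfl
    exact suffix_cons_ne hβc
  have c1 : s(Node.vertex L p q, u) ∉ w₁.edges := fun hmem => by
    rcases hsup₁ _ (SimpleGraph.Walk.snd_mem_support_of_mem_edges _ hmem) with h1 | h1
    · exact hu.ne h1
    · exact suffix_cons_ne (h1.trans huc)
  have c2 : s(Node.vertex L p q, Node.bottom L) ∉ w₁.edges := fun hmem => by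
    rcases hsup₁ _ (SimpleGraph.Walk.snd_mem_support_of_mem_edges _ hmem) with h1 | h1
    · cases h1
    · exact suffix_cons_ne h1
  have r1 : rhoStart w₁ = upper L p q * p * rho w₁ := by
    have r1 := rhoStart_eq hu eb rfl w₁ hβt
    rwa [if_neg c1, if_neg c2] at r1
  have ho : (evalAt G X Y).order = (k * (l * (p * q)) : ℕ) := by
    obtain ⟨c, hc, hc'⟩ := hG.branch.exists_isInit ht.adm.p_pos ht.adm.q_pos ht.adm.coprime
      ht.ordX ht.ordY ht.lc
    obtain ⟨H, hH, hH'⟩ := hc'.exists_evalAt hp0 hq0 hs.pos hs.ordX hs.ordY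
    refine order_eq_of_eq_X_pow_mul hH ?_
    rw [hH', map_mul, map_pow, eval_binomP, MvPolynomial.eval_C]
    refine mul_ne_zero hc (pow_ne_zero _ fun h0 => hne ?_)
    exact mul_right_cancel₀ (pow_ne_zero _ hs.coeff_ne.2)
      (hs.lc.symm.trans (sub_eq_zero.1 h0))
  rw [hr, r1, hr₁, hF.order_evalAt_eq hG, hs.ordX, ht.ordX, ho, ENat.toNat_natCast, upper_eq,
    nsmul_eq_mul]
  norm_cast
  ring

omit [IsAlgClosed K] in
theorem Lift.represents_bottom (hG : Lift g φ' ψ' L G X' 0) (hL : IsChart h L) : Represents h g (.bottom L) := by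
  obtain ⟨u, hu, hg⟩ := hG.transform_eq
  refine ⟨hL, excMult L * X'.order.toNat, ?_⟩
  rw [hg]
  refine (Associated.refl _).mul_mul ?_
  exact (associated_unit_mul_left _ _ hu).trans hG.branch.associated_X1

/-- Here g is the axis y = 0 transversal to the divisor, so X' has order 1. The path leaves the
vertex downwards and only the upper decoration counts. -/
theorem BranchPair.hasPath_of_bottom (P : BranchPair h f φ ψ g φ' ψ') (hL : IsChart h L)
    (hF : Lift f φ ψ L F X Y) (hG : Lift g φ' ψ' L G X' 0) (hs : EdgeAt X Y s k) :
    HasPath h f g φ ψ := by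
  have hgo : IsOut g (s :: L) := hG.isOut_cons hs.adm fun _ hk => hk.Y_ne rfl
  have hE := (P.isEdge hF hs hgo).2
  have hGa := hG.branch.associated_X1
  have m1 : Meets (transform h L) 1 0 s.p s.q :=
    P.meets hF hG (by simpa using hs.adm.q_pos.ne') ⟨_, hs.onFace_upper hF.branch⟩
      (meets_of_associated_X hGa _ _ _ _)
  have m2 : Meets (transform h L) s.p s.q 0 1 :=
    P.meets hF hG (by simpa using hs.adm.p_pos.ne') ⟨_, hs.onFace_lower hF.branch⟩
      (meets_of_associated_X hGa _ _ _ _)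
  obtain ⟨u, hu, huc⟩ := exists_parent hL hE m1
  have eb : TreeEdge h (.vertex L s.p s.q) (.bottom L) := .vertexBottom L _ _ hL hE m2
  have hp : (SimpleGraph.Walk.cons eb.adj SimpleGraph.Walk.nil).IsPath :=
    (SimpleGraph.Walk.cons_isPath_iff _ _).2 ⟨SimpleGraph.Walk.IsPath.nil, by simp⟩
  obtain ⟨α, w, hw, hα, hr, -⟩ := P.exists_walk hL hF hs hgo _ hp (fun x hx hsx => by
    simp only [SimpleGraph.Walk.support_cons, SimpleGraph.Walk.support_nil, List.mem_cons,
      List.not_mem_nil, or_false] at hx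
    rcases hx with rfl | rfl
    · exact suffix_cons_ne hsx
    · exact suffix_cons_ne hsx)
  refine ⟨α, _, w, hα, hG.represents_bottom hL, hw, ?_⟩
  have hub : u ≠ .bottom L := by
    rintro rfl
    exact lt_asymm hu.rank_lt eb.rank_lt
  have c1 : s(Node.vertex L s.p s.q, u) ∉
      (SimpleGraph.Walk.cons eb.adj SimpleGraph.Walk.nil).edges := by
    simp only [SimpleGraph.Walk.edges_cons, SimpleGraph.Walk.edges_nil, List.mem_singleton,
      Sym2.congr_right]
    exact hub
  have c2 : s(Node.vertex L s.p s.q, Node.bottom L) ∈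
      (SimpleGraph.Walk.cons eb.adj SimpleGraph.Walk.nil).edges := by
    rw [SimpleGraph.Walk.edges_cons]; exact List.mem_cons_self
  have r1 := rhoStart_eq hu eb rfl (SimpleGraph.Walk.cons eb.adj SimpleGraph.Walk.nil) (by simp)
  rw [if_neg c1, if_pos c2, rho_cons_nil] at r1
  have h1 : X'.order = ((1 : ℕ) : ℕ∞) := hG.branch.order_eq_one
  rw [hr, r1, hF.order_evalAt_eq hG, hs.ordX, h1,
    order_evalAt_of_single hs (single_of_associated_X hGa hs.adm.p_pos hs.adm.q_pos),
    ENat.toNat_natCast, upper_eq, nsmul_eq_mul]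
  simp only [Finsupp.single_eq_same, ne_eq, zero_ne_one, not_false_eq_true,
    Finsupp.single_eq_of_ne]
  norm_cast
  ring

omit [IsAlgClosed K] in
theorem Lift.nil_of_X_eq_zero (hG : Lift g φ' ψ' L G 0 Y') : L = [] := by
  by_contra hL
  exact hG.ne hL rfl

omit [IsAlgClosed K] in
theorem Lift.represents_top (hG : Lift g φ' ψ' [] G 0 Y') : Represents h g .top := by
  obtain ⟨u, hu, hg⟩ := hG.transform_eq
  rw [excMult, zero_mul, pow_zero, one_mul, transform] at hg
  rw [hg]
  exact (associated_unit_mul_left _ _ hu).trans hG.branch.associated_X0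

/-- A strict transform x = 0 occurs only in the first polygon, because later this is the exceptional
divisor. The path leaves upwards and the lower decoration counts. -/
theorem BranchPair.hasPath_of_top (P : BranchPair h f φ ψ g φ' ψ')
    (hF : Lift f φ ψ [] F X Y) (hG : Lift g φ' ψ' [] G 0 Y') (hs : EdgeAt X Y s k) :
    HasPath h f g φ ψ := by
  have hL : IsChart h [] := .nil
  have hgo : IsOut g [s] := hG.isOut_cons hs.adm fun _ hk => hk.X_ne rfl
  have hE := (P.isEdge hF hs hgo).2
  have hGa := hG.branch.associated_X0
  have m1 : Meets (transform h []) 1 0 s.p s.q :=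
    P.meets hF hG (by simpa using hs.adm.q_pos.ne') ⟨_, hs.onFace_upper hF.branch⟩
      (meets_of_associated_X hGa _ _ _ _)
  have m2 : Meets (transform h []) s.p s.q 0 1 :=
    P.meets hF hG (by simpa using hs.adm.p_pos.ne') ⟨_, hs.onFace_lower hF.branch⟩
      (meets_of_associated_X hGa _ _ _ _)
  have hu : TreeEdge h .top (.vertex [] s.p s.q) := .topVertex _ _ hE m1
  have eb : TreeEdge h (.vertex [] s.p s.q) (.bottom []) := .vertexBottom [] _ _ hL hE m2
  have hp : (SimpleGraph.Walk.cons hu.adj.symm SimpleGraph.Walk.nil).IsPath :=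
    (SimpleGraph.Walk.cons_isPath_iff _ _).2 ⟨SimpleGraph.Walk.IsPath.nil, by simp⟩
  obtain ⟨α, w, hw, hα, hr, -⟩ := P.exists_walk hL hF hs hgo _ hp (fun x hx hsx => by
    simp only [SimpleGraph.Walk.support_cons, SimpleGraph.Walk.support_nil, List.mem_cons,
      List.not_mem_nil, or_false] at hx
    rcases hx with rfl | rfl
    · exact suffix_cons_ne hsx
    · exact suffix_cons_ne hsx)
  refine ⟨α, _, w, hα, hG.represents_top, hw, ?_⟩
  have c1 : s(Node.vertex [] s.p s.q, Node.top) ∈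
      (SimpleGraph.Walk.cons hu.adj.symm SimpleGraph.Walk.nil).edges := by
    rw [SimpleGraph.Walk.edges_cons]; exact List.mem_cons_self
  have c2 : s(Node.vertex [] s.p s.q, Node.bottom []) ∉
      (SimpleGraph.Walk.cons hu.adj.symm SimpleGraph.Walk.nil).edges := by
    simp only [SimpleGraph.Walk.edges_cons, SimpleGraph.Walk.edges_nil, List.mem_singleton,
      Sym2.congr_right]
    simp
  have r1 := rhoStart_eq hu eb rfl (SimpleGraph.Walk.cons hu.adj.symm SimpleGraph.Walk.nil)
    (by simp)
  rw [if_pos c1, if_neg c2, rho_cons_nil] at r1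
  rw [hr, r1, hF.order_evalAt_eq hG, hs.ordX,
    order_evalAt_of_single hs (single_of_associated_X hGa hs.adm.p_pos hs.adm.q_pos),
    excMult, zero_mul, zero_nsmul, zero_add]
  simp only [Finsupp.single_eq_same, ne_eq, one_ne_zero, not_false_eq_true,
    Finsupp.single_eq_of_ne]
  norm_cast
  ring

omit [IsAlgClosed K] in
theorem BranchPair.hasPath_top_bottom (P : BranchPair h f φ ψ g φ' ψ')
    (hF : Lift f φ ψ [] F 0 Y) (hG : Lift g φ' ψ' [] G X' 0) : HasPath h f g φ ψ := by
  have hGa := hG.branch.associated_X1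
  have m : Meets (transform h []) 1 0 0 1 :=
    P.meets hF hG (by simp) (meets_of_associated_X hF.branch.associated_X0 _ _ _ _)
      (meets_of_associated_X hGa _ _ _ _)
  have e : TreeEdge h .top (.bottom []) := .topBottom m
  refine ⟨_, _, SimpleGraph.Walk.cons e.adj SimpleGraph.Walk.nil, hF.represents_top,
    hG.represents_bottom .nil,
    (SimpleGraph.Walk.cons_isPath_iff _ _).2 ⟨SimpleGraph.Walk.IsPath.nil, by simp⟩, ?_⟩
  have hY : Y ≠ 0 := hF.branch.param.ne_zero.resolve_left (by simp)
  have hc := hF.branch.param.constantCoeff_fst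
  have hd := hF.branch.param.constantCoeff_snd
  rw [rho_cons_nil, hF.order_evalAt_eq hG, excMult, zero_mul, zero_nsmul, zero_add]
  have h1 := evalAt_dvd hc hd hGa.dvd
  have h2 := evalAt_dvd hc hd hGa.symm.dvd
  rw [evalAt_X1 hc hd] at h1 h2
  rw [le_antisymm (order_mono_of_dvd h1) (order_mono_of_dvd h2),
    ← hF.branch.order_evalAt_X_zero hY]
  have hz : PowerSeries.constantCoeff (0 : PowerSeries K) = 0 := map_zero _
  have hT : PowerSeries.constantCoeff (PowerSeries.X : PowerSeries K) = 0 :=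
    PowerSeries.constantCoeff_X
  have ha := hF.branch.associated_X0
  have h3 := evalAt_dvd hT hz ha.dvd
  have h4 := evalAt_dvd hT hz ha.symm.dvd
  rw [evalAt_X0 hT hz] at h3 h4
  rw [le_antisymm (order_mono_of_dvd h3) (order_mono_of_dvd h4)]
  simp

end NewtonTree

end

noncomputable section

namespace NewtonTree

variable {K : Type*} [Field K] [IsAlgClosed K] {h f g : MvPowerSeries (Fin 2) K}
  {φ ψ φ' ψ' : PowerSeries K} {L : List (HNStep K)}
  {F G : MvPowerSeries (Fin 2) K} {X Y X' Y' : PowerSeries K}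

/-! ### Existence of the path -/

omit [IsAlgClosed K] in
theorem BranchPair.evalAt_ne (P : BranchPair h f φ ψ g φ' ψ') (hF : Lift f φ ψ L F X Y)
    (hG : Lift g φ' ψ' L G X' Y') : evalAt G X Y ≠ 0 := by
  intro h0
  have hc := hF.branch.param.constantCoeff_fst
  have hd := hF.branch.param.constantCoeff_snd
  obtain ⟨u, hu, hg⟩ := hG.transform_eq
  refine P.ne ?_
  rw [← hF.eval, hg, evalAt_mul hc hd, evalAt_mul hc hd, h0, mul_zero, mul_zero]

/-- Without a common tangent there remain the five configurations, up to exchanging the branches.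
Two equal axes are excluded since G does not vanish on the parametrization of F. -/
theorem BranchPair.hasPath_of_separated (P : BranchPair h f φ ψ g φ' ψ') (hL : IsChart h L)
    (hF : Lift f φ ψ L F X Y) (hG : Lift g φ' ψ' L G X' Y')
    (hsep : ∀ s k l, EdgeAt X Y s k → ¬ EdgeAt X' Y' s l) : HasPath h f g φ ψ := by
  have hc := hF.branch.param.constantCoeff_fst
  have hd := hF.branch.param.constantCoeff_snd
  have hc' := hG.branch.param.constantCoeff_fst
  have hd' := hG.branch.param.constantCoeff_snd
  have hne := P.evalAt_ne hF hG
  by_cases hX : X = 0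
  · subst hX
    obtain rfl := hF.nil_of_X_eq_zero
    by_cases hX' : X' = 0
    · subst hX'
      refine absurd ?_ hne
      obtain ⟨H, hH⟩ := hG.branch.associated_X0.symm.dvd
      rw [hH, evalAt_mul hc hd, evalAt_X0 hc hd, zero_mul]
    by_cases hY' : Y' = 0
    · subst hY'
      exact P.hasPath_top_bottom hF hG
    obtain ⟨t, l, ht⟩ := exists_edgeAt hc' hd' hX' hY'
    exact P.hasPath_symm (P.symm.hasPath_of_top hG hF ht)
  by_cases hY : Y = 0
  · subst hY
    by_cases hY' : Y' = 0
    · subst hY'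
      refine absurd ?_ hne
      obtain ⟨H, hH⟩ := hG.branch.associated_X1.symm.dvd
      rw [hH, evalAt_mul hc hd, evalAt_X1 hc hd, zero_mul]
    by_cases hX' : X' = 0
    · subst hX'
      obtain rfl := hG.nil_of_X_eq_zero
      exact P.hasPath_symm (P.symm.hasPath_top_bottom hG hF)
    obtain ⟨t, l, ht⟩ := exists_edgeAt hc' hd' hX' hY'
    exact P.hasPath_symm (P.symm.hasPath_of_bottom hL hG hF ht)
  obtain ⟨s, k, hs⟩ := exists_edgeAt hc hd hX hY
  by_cases hX' : X' = 0
  · subst hX'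
    obtain rfl := hG.nil_of_X_eq_zero
    exact P.hasPath_of_top hF hG hs
  by_cases hY' : Y' = 0
  · subst hY'
    exact P.hasPath_of_bottom hL hF hG hs
  obtain ⟨t, l, ht⟩ := exists_edgeAt hc' hd' hX' hY'
  rcases lt_trichotomy (t.p * s.q) (s.p * t.q) with hlt | heq | hlt
  · exact P.hasPath_of_above hL hF hG hs ht hlt
  · obtain ⟨h1, h2⟩ := eq_of_coprime_of_mul_eq hs.adm.coprime ht.adm.coprime heq
    obtain ⟨p, q, μ⟩ := s
    obtain ⟨p', q', μ'⟩ := t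
    obtain rfl : p = p' := h1
    obtain rfl : q = q' := h2
    refine P.hasPath_of_same hL hF hG hs ht ?_
    rintro rfl
    exact hsep _ _ _ hs ht
  · exact P.hasPath_symm (P.symm.hasPath_of_above hL hG hF ht hs hlt)

/-- As long as the tangents agree, the binomial has multiplicity k + l ≥ 2 in the face polynomial,
so the Newton algorithm performs this map too. The bound M on common points ends the recursion. -/
theorem BranchPair.hasPath_of_lift (P : BranchPair h f φ ψ g φ' ψ') {M : ℕ}
    (hM : ∀ L F X Y, Lift f φ ψ L F X Y → M < L.length → X.order = 1 ∧ IsOut g L) (n : ℕ)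
    {L : List (HNStep K)} {F G : MvPowerSeries (Fin 2) K} {X Y X' Y' : PowerSeries K}
    (hn : M ≤ n + L.length) (hL : IsChart h L) (hF : Lift f φ ψ L F X Y)
    (hG : Lift g φ' ψ' L G X' Y') : HasPath h f g φ ψ := by
  by_cases hsep : ∀ s k l, EdgeAt X Y s k → ¬ EdgeAt X' Y' s l
  · exact P.hasPath_of_separated hL hF hG hsep
  push Not at hsep
  obtain ⟨s, k, l, hs, ht⟩ := hsep
  obtain ⟨F₁, X₁, Y₁, hF₁, -⟩ := hF.cons hs
  obtain ⟨G₁, X₁', Y₁', hG₁, -⟩ := hG.cons ht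
  cases n with
  | zero =>
    refine absurd (hM _ _ _ _ hF₁ ?_).2 (hG₁.not_isOut (hG₁.ne (by simp)))
    simp only [List.length_cons]; omega
  | succ n =>
    have hm : MultAt h L s (k + l) := by
      rw [P.eq_mul]
      exact (hF.multAt hs.adm (hs.hasMult hF.branch)).mul hF.adm
        (hG.multAt hs.adm (ht.hasMult hG.branch))
    have hk := hs.pos
    have hl := ht.pos
    exact BranchPair.hasPath_of_lift P hM n (by simp only [List.length_cons]; omega)
      (hm.isChart hs.adm (by omega) hL) hF₁ hG₁

theorem BranchPair.hasPath (P : BranchPair h f φ ψ g φ' ψ') : HasPath h f g φ ψ := by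
  obtain ⟨M, hM⟩ := exists_length_bound P.fst P.ne
  exact P.hasPath_of_lift hM M (Nat.le_add_right _ _) .nil P.fst.lift_nil P.snd.lift_nil

/-! ### Uniqueness of the arrowheads -/

omit [IsAlgClosed K] in
theorem Lift.eq_of_nil (hf : IsBranch f φ ψ) (hF : Lift f φ ψ [] F X Y) : X = φ ∧ Y = ψ := by
  have hc := hF.branch.param.constantCoeff_fst
  have hd := hF.branch.param.constantCoeff_snd
  have hc' := hf.param.constantCoeff_fst
  have hd' := hf.param.constantCoeff_snd
  have h0 := hF.eval (MvPowerSeries.X 0)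
  have h1 := hF.eval (MvPowerSeries.X 1)
  rw [transform, evalAt_X0 hc hd, evalAt_X0 hc' hd'] at h0
  rw [transform, evalAt_X1 hc hd, evalAt_X1 hc' hd'] at h1
  exact ⟨h0, h1⟩

/-- The coordinate y divides the total transform but neither the divisor nor a unit. So f has not
left, y divides its strict transform F, and F, being a branch, is associated to y. -/
theorem exists_lift_of_bottom (hf : IsBranch f φ ψ) (hr : Represents h f (.bottom L)) :
    IsChart h L ∧ ∃ F X, Lift f φ ψ L F X 0 := by
  obtain ⟨hL, a, ha⟩ := hr
  refine ⟨hL, ?_⟩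
  have hz : PowerSeries.constantCoeff (0 : PowerSeries K) = 0 := map_zero _
  have hT : PowerSeries.constantCoeff (PowerSeries.X : PowerSeries K) = 0 :=
    PowerSeries.constantCoeff_X
  have h1 : MvPowerSeries.X 1 ∣ transform f L := (dvd_mul_left _ _).trans ha.symm.dvd
  have key : ∀ (N : ℕ) (u A : MvPowerSeries (Fin 2) K), IsUnit u →
      transform f L = MvPowerSeries.X 0 ^ N * (u * A) → MvPowerSeries.X 1 ∣ A := by
    intro N u A hu hA
    rw [hA, X1_dvd_iff, evalAt_mul hT hz, evalAt_mul hT hz, evalAt_pow hT hz,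
      evalAt_X0 hT hz] at h1
    rw [X1_dvd_iff]
    exact ((mul_eq_zero.1 ((mul_eq_zero.1 h1).resolve_left
      (pow_ne_zero _ PowerSeries.X_ne_zero))).resolve_left (evalAt_isUnit hT hz hu).ne_zero)
  rcases exists_lift_or_isOut hf hL.adm with ⟨F, X, Y, hF⟩ | ⟨N, u, hu, hN⟩
  · obtain ⟨u, hu, hfu⟩ := hF.transform_eq
    have h2 := key _ _ _ hu hfu
    have h3 := (isBranch_X1.associated_of_dvd hF.branch h2).symm.dvd
    rw [← hF.branch.ker, evalAt_X1 hF.branch.param.constantCoeff_fst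
      hF.branch.param.constantCoeff_snd] at h3
    subst h3
    exact ⟨F, X, hF⟩
  · have h2 := key N u 1 hu (by rw [hN, mul_one])
    exact absurd (isUnit_of_dvd_one h2) isBranch_X1.not_isUnit

theorem exists_lift_of_arrow {s : HNStep K} (hf : IsBranch f φ ψ)
    (hr : Represents h f (.arrow L s)) :
    IsArrow h L s ∧ ∃ F X Y, Lift f φ ψ (s :: L) F X Y := by
  obtain ⟨hA, a, f', hf', h1, h2⟩ := hr
  refine ⟨hA, (exists_lift_or_isOut hf (List.forall_mem_cons.2
    ⟨⟨hA.2.1.1, hA.2.1.2.1, hA.2.1.2.2.1, hA.2.2.1⟩, hA.1.adm⟩)).resolve_right ?_⟩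
  rintro ⟨N, u, hu, hN⟩
  have := (eq_of_X0_pow_mul_eq (hf'.symm.trans hN) h1 (not_X0_dvd_of_isUnit hu)).2
  exact h2 (this ▸ hu)

omit [IsAlgClosed K] in
theorem IsArrow.not_isChart {s : HNStep K} (hA : IsArrow h L s) : ¬ IsChart h (s :: L) := by
  intro hC
  have := hC.two_le
  rw [hA.2.2.2] at this
  exact absurd this (by decide)

/-- A branch is not transformed any more after it has become a coordinate. -/
theorem Lift.suffix_of_eq_zero {L' : List (HNStep K)} (hf : IsBranch f φ ψ)
    (hF : Lift f φ ψ L F X Y) (h0 : X = 0 ∨ Y = 0) (hG : Lift f φ ψ L' G X' Y') : L' <:+ L := by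
  rcases hF.suffix_or hf hG with ⟨M, rfl⟩ | hs
  · rcases List.eq_nil_or_concat M with rfl | ⟨M, t, rfl⟩
    · exact List.suffix_rfl
    · exfalso
      induction M generalizing G X' Y' with
      | nil =>
        obtain ⟨k, hk⟩ := Lift.exists_edgeAt (s := t) hG hF
        rcases h0 with h0 | h0
        · exact hk.X_ne h0
        · exact hk.Y_ne h0
      | cons r M ih =>
        obtain ⟨_, _, _, hG'⟩ := Lift.tail (s := r) hG hf
        exact ih hG'
  · exact hs

/-- Representing nodes lie at points of the chain followed by f. A coordinate axis has no tangent
edge, so nothing of f lies beyond it; beyond an arrowhead of exponent one there is no chart. Each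
type of arrowhead can therefore only be the last point of the chain. -/
theorem represents_unique (hf : IsBranch f φ ψ) {α α' : Node K} (hα : Represents h f α)
    (hα' : Represents h f α') : α = α' := by
  have htop : Represents h f .top → φ = 0 := fun ht => by
    have hd := (show Associated f (MvPowerSeries.X 0) from ht).dvd
    rwa [← hf.ker, evalAt_X0 hf.param.constantCoeff_fst hf.param.constantCoeff_snd] at hd
  have top_bottom : ∀ L, Represents h f .top → Represents h f (.bottom L) → False := by
    intro L ht hb
    have h0 := htop ht
    obtain ⟨-, F, X, hF⟩ := exists_lift_of_bottom hf hb
    obtain rfl := List.suffix_nil.1 (hf.lift_nil.suffix_of_eq_zero hf (Or.inl h0) hF)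
    have hX := hF.eq_of_nil hf
    have := hf.param.ne_zero
    simp [h0, ← hX.2] at this
  have top_arrow : ∀ L s, Represents h f .top → Represents h f (.arrow L s) → False := by
    intro L s ht ha
    obtain ⟨-, F, X, Y, hF⟩ := exists_lift_of_arrow hf ha
    have := List.suffix_nil.1 (hf.lift_nil.suffix_of_eq_zero hf (Or.inl (htop ht)) hF)
    simp at this
  have bottom_arrow : ∀ L L' s, Represents h f (.bottom L) → Represents h f (.arrow L' s) →
      False := by
    intro L L' s hb ha
    obtain ⟨hL, F, X, hF⟩ := exists_lift_of_bottom hf hb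
    obtain ⟨hA, G, X', Y', hG⟩ := exists_lift_of_arrow hf ha
    exact hA.not_isChart (hL.of_suffix (hF.suffix_of_eq_zero hf (Or.inr rfl) hG))
  cases α with
  | vertex => exact hα.elim
  | top =>
    cases α' with
    | vertex => exact hα'.elim
    | top => rfl
    | bottom L => exact (top_bottom L hα hα').elim
    | arrow L s => exact (top_arrow L s hα hα').elim
  | bottom L =>
    cases α' with
    | vertex => exact hα'.elim
    | top => exact (top_bottom L hα' hα).elim
    | bottom L' =>
      obtain ⟨-, F, X, hF⟩ := exists_lift_of_bottom hf hα
      obtain ⟨-, F', X', hF'⟩ := exists_lift_of_bottom hf hα'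
      have h1 := hF.suffix_of_eq_zero hf (Or.inr rfl) hF'
      have h2 := hF'.suffix_of_eq_zero hf (Or.inr rfl) hF
      rw [h2.eq_of_length (le_antisymm h2.length_le h1.length_le)]
    | arrow L' s => exact (bottom_arrow L L' s hα hα').elim
  | arrow L s =>
    cases α' with
    | vertex => exact hα'.elim
    | top => exact (top_arrow L s hα' hα).elim
    | bottom L' => exact (bottom_arrow L' L s hα' hα).elim
    | arrow L' s' =>
      obtain ⟨hA, F, X, Y, hF⟩ := exists_lift_of_arrow hf hα
      obtain ⟨hA', F', X', Y', hF'⟩ := exists_lift_of_arrow hf hα'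
      rcases hF.suffix_or hf hF' with h1 | h1
      · rcases List.suffix_cons_iff.1 h1 with h2 | h2
        · obtain ⟨rfl, rfl⟩ := List.cons.inj h2
          rfl
        · exact (hA.not_isChart (hA'.1.of_suffix h2)).elim
      · rcases List.suffix_cons_iff.1 h1 with h2 | h2
        · obtain ⟨rfl, rfl⟩ := List.cons.inj h2
          rfl
        · exact (hA'.not_isChart (hA.1.of_suffix h2)).elim

end NewtonTree

end

theorem mainTheorem6 {K : Type*} [Field K] [IsAlgClosed K] (f g : MvPowerSeries (Fin 2) K)
    (hf : Irreducible f) (hg : Irreducible g) (hfg : ¬ Associated f g) :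
    (∃ φ ψ : PowerSeries K, NewtonTree.IsPrimitiveParametrization f φ ψ) ∧
    (∃! α : NewtonTree.Node K, NewtonTree.Represents (f * g) f α) ∧
    (∃! β : NewtonTree.Node K, NewtonTree.Represents (f * g) g β) ∧
    ∀ α β : NewtonTree.Node K,
      NewtonTree.Represents (f * g) f α → NewtonTree.Represents (f * g) g β →
        (∃ w : (NewtonTree.newtonTree (f * g)).Walk α β, w.IsPath) ∧
        ∀ w : (NewtonTree.newtonTree (f * g)).Walk α β, w.IsPath →
          ∀ φ ψ : PowerSeries K, NewtonTree.IsPrimitiveParametrization f φ ψ →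
            (NewtonTree.evalAt g φ ψ).order = (NewtonTree.rho w : ℕ∞) := by
  obtain ⟨φ₀, ψ₀, h₀⟩ := NewtonTree.exists_primitive hf.not_isUnit
  obtain ⟨φ', ψ', h'⟩ := NewtonTree.exists_primitive hg.not_isUnit
  have hG := h'.isBranch hg
  have pair : ∀ φ ψ, NewtonTree.IsPrimitiveParametrization f φ ψ →
      NewtonTree.BranchPair (f * g) f φ ψ g φ' ψ' := fun φ ψ h =>
    -- If g vanished on the parametrization, f would divide g, and two branches of which one divides
    -- the other are associated.
    ⟨h.isBranch hf, hG, rfl, fun h0 =>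
      hfg ((h.isBranch hf).associated_of_dvd hG (((h.isBranch hf).ker g).1 h0))⟩
  have hF := h₀.isBranch hf
  obtain ⟨α₀, β₀, w₀, hα₀, hβ₀, hw₀, -⟩ := (pair φ₀ ψ₀ h₀).hasPath
  refine ⟨⟨φ₀, ψ₀, h₀⟩, ⟨α₀, hα₀, fun α hα => NewtonTree.represents_unique hF hα hα₀⟩,
    ⟨β₀, hβ₀, fun β hβ => NewtonTree.represents_unique hG hβ hβ₀⟩, fun α β hα hβ => ⟨?_, ?_⟩⟩
  · obtain rfl := NewtonTree.represents_unique hF hα hα₀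
    obtain rfl := NewtonTree.represents_unique hG hβ hβ₀
    exact ⟨w₀, hw₀⟩
  · intro w hw φ ψ hp
    obtain ⟨α₁, β₁, w₁, hα₁, hβ₁, hw₁, ho⟩ := (pair φ ψ hp).hasPath
    obtain rfl := NewtonTree.represents_unique hF hα hα₁
    obtain rfl := NewtonTree.represents_unique hG hβ hβ₁
    -- The path was produced for this particular parametrization; acyclicity identifies it with the
    -- given one.
    have := congrArg Subtype.val
      ((NewtonTree.newtonTree_isAcyclic (f * g)).subsingleton_path α β |>.elim
        ⟨w, hw⟩ ⟨w₁, hw₁⟩)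
    obtain rfl : w = w₁ := this
    exact ho
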